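/- \textbf{Setting.} Let $G=(S,A,\mathit{Act},\delta,s_0)$ be a finite Markov decision process in which every state enables at least one action and every action $a$ is enabled in exactly one state and has successor distribution $\delta(a)$ on $S$. A \emph{strategy} with memory $\mathsf M$ (a countable set) consists of an initial distribution $\alpha$ on $\mathsf M$, a memory update $\sigma_u:A\times S\times\mathsf M\to\mathrm{Dist}(\mathsf M)$ and a next-move function $\sigma_n(s,m)\in\mathrm{Dist}(\mathit{Act}(s))$; its play from state $s$ is the Markov chain on $S\times\mathsf M\times A$ with initial distribution $(s,m,a)\mapsto\alpha(m)\,\sigma_n(s,m)(a)$ and transitions $P(s,m,a)(s',m',a')=\delta(a)(s')\,\sigma_u(a,s',m)(m')\,\sigma_n(s',m')(a')$; $\mathbb P^\sigma_s$ is the induced measure on runs, $\mathbb P^\sigma=\mathbb P^\sigma_{s_0}$, and $A_t$ is the $t$-th action. The strategy is \emph{deterministic-update} if $\alpha$ and all values of $\sigma_u$ are Dirac, and \emph{Markov} if its memory is a step counter, incremented in every step from a fixed initial value. For $f:A\to\mathbb R$ let $\mathrm{lr}(f)=\liminf_{T\to\infty}\frac1T\sum_{t=1}^T f(A_t)$,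 and let $\mathrm{Freq}_a=\mathrm{lr}(\mathbf 1_{\{a\}})$. An end component is a pair $(T,B)$ with $\emptyset\ne T\subseteq S$ and $B\subseteq\bigcup_{s\in T}\mathit{Act}(s)$ such that actions of $B$ lead only into $T$ and any two states of $T$ are connected by a path inside $T\cup B$; a MEC is a maximal one. Let $\vec r:A\to\mathbb R^n$ and $\vec{exp},\vec{sat}\in\mathbb R^n$. A strategy $\sigma$ is a \emph{witness} for (multi-quant-conjunctive) with $\vec{pr}\in\mathbb R^n$ if, for all $i$, $\mathbb E^\sigma[\mathrm{lr}(\vec r_i)]\ge\vec{exp}_i$ and $\mathbb P^\sigma[\mathrm{lr}(\vec r_i)\ge\vec{sat}_i]\ge\vec{pr}_i$; it is a witness for (multi-quant-joint) with $pr\in\mathbb R$ if $\mathbb E^\sigma[\mathrm{lr}(\vec r_i)]\ge\vec{exp}_i$ for all $i$ and $\mathbb P^\sigma[\forall i:\mathrm{lr}(\vec r_i)\ge\vec{sat}_i]\ge pr$. The problem is \emph{realizable} if some strategy is a witness. Let $\mathcal N=2^{[n]}$ in the conjunctive case and $\mathcal N=\{\emptyset,[n]\}$ in the joint case. Let $L$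 be the following linear program in nonnegative variables $x_{a,N},y_a,y_{s,N}$ ($a\in A$, $s\in S$, $N\in\mathcal N$): \begin{enumerate} \item $\mathbf 1_{s=s_0}+\sum_{a\in A}y_a\delta(a)(s)=\sum_{a\in\mathit{Act}(s)}y_a+\sum_Ny_{s,N}$ for $s\in S$; \item $\sum_{s\in\bigcup\mathrm{MEC}}\sum_Ny_{s,N}=1$; \item $\sum_{s\in C}y_{s,N}=\sum_{a\in C}x_{a,N}$ for every MEC $C$ and every $N$; \item $\sum_{a\in A}x_{a,N}\delta(a)(s)=\sum_{a\in\mathit{Act}(s)}x_{a,N}$ for $s\in S$ and every $N$; \item $\sum_{a,N}x_{a,N}\vec r(a)\ge\vec{exp}$; \item $\sum_{a\in C}x_{a,N}\vec r(a)_i\ge\sum_{a\in C}x_{a,N}\vec{sat}_i$ for every MEC $C$, every $N$ and $i\in N$; \item $\sum_{a\in A}\sum_{N\ni i}x_{a,N}\ge\vec{pr}_i$ for all $i$ (conjunctive case), respectively $\sum_{a\in A}x_{a,[n]}\ge pr$ (joint case). \end{enumerate} \emph{Recurrent strategies} for a solution of $L$ are Markov strategies $\xi_N$ ($N\in\mathcal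 N$) such that, for every MEC $C$ with $\sum_{b\in C}x_{b,N}>0$, the strategy $\xi_N$ plays in every state of $C$ only actions of $C$, and for every $s\in C$, $\mathbb P^{\xi_N}_s$-almost surely $\mathrm{Freq}_a=x_{a,N}/\sum_{b\in C}x_{b,N}$ for all $a\in C$. \textbf{Lemma.} In each of the two cases, (multi-quant-conjunctive) and (multi-quant-joint), suppose that the problem is realizable. Then $L$ has a solution that admits recurrent strategies $(\xi_N)_{N\in\mathcal N}$. Moreover, for every solution of $L$ and all recurrent strategies $(\xi_N)_{N\in\mathcal N}$ for it, there is a \emph{deterministic-update} witness strategy $\varrho$ that uses only \emph{finite memory before switching to the $\xi_N$'s}: its memory is the disjoint union of a finite set $\mathsf M_0$ and of one copy of the memory of each $\xi_N$; in the copy belonging to $\xi_N$ it moves and updates exactly as $\xi_N$; it enters such a copy only in the initial memory element of $\xi_N$; and almost surely it eventually switches to some $\xi_N$ in a MEC $C$ with $\sum_{a\in C}x_{a,N}>0$. -/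

import Mathlib

open MeasureTheory ProbabilityTheory Filter

/-! ### Markov chains -/

/-- A (discrete) Markov chain on the locations `L`: a transition function and an initial
distribution. -/
structure MarkovChain (L : Type*) where
  trans : L → PMF L
  init : PMF L

namespace MarkovChain

variable {L : Type*} [MeasurableSpace L] [DiscreteMeasurableSpace L]

/-- One step of the chain as a kernel from histories `ℓ₀ ⋯ ℓₖ`: it only looks at `ℓₖ`. -/
noncomputable def stepKernel (C : MarkovChain L) (k : ℕ) :
    Kernel ((i : Finset.Iic k) → L) L where
  toFun h := (C.trans (h ⟨k, Finset.mem_Iic.2 le_rfl⟩)).toMeasure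
  measurable' :=
    (Measurable.of_discrete (f := fun l : L => (C.trans l).toMeasure)).comp
      (measurable_pi_apply _)

instance (C : MarkovChain L) (k : ℕ) : IsMarkovKernel (C.stepKernel k) :=
  ⟨fun h => by
    change IsProbabilityMeasure (C.trans (h ⟨k, Finset.mem_Iic.2 le_rfl⟩)).toMeasure
    infer_instance⟩

/-- The probability measure on runs `ℓ₀ ℓ₁ ℓ₂ ⋯` (Ionescu-Tulcea). -/
noncomputable def runMeasure (C : MarkovChain L) : Measure (ℕ → L) :=
  Kernel.trajMeasure (X := fun _ => L) C.init.toMeasure C.stepKernel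

end MarkovChain

/-! ### Markov decision processes -/

/-- A Markov decision process with states `S` and actions `A`; every action is enabled in exactly
one state and every state enables some action. -/
structure MDP (S A : Type*) where
  act : S → Finset A
  act_nonempty : ∀ s, (act s).Nonempty
  act_partition : ∀ a, ∃! s, a ∈ act s
  δ : A → PMF S
  init : S

/-- A location `(s, m, a)` of a play: current state, current memory, action taken next. -/
structure Loc (S M A : Type*) where
  state : S
  mem : M
  act : A

instance {S M A : Type*} : MeasurableSpace (Loc S M A) := ⊤

instance {S M A : Type*} : DiscreteMeasurableSpace (Loc S M A) := ⟨fun _ => trivial⟩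

/-- A strategy with memory elements `M`: stochastic memory update, next move function, and initial
distribution on memory. -/
structure Strategy {S A : Type*} (G : MDP S A) (M : Type*) where
  update : A → S → M → PMF M
  next : S → M → PMF A
  next_enabled : ∀ s m, (next s m).support ⊆ (G.act s : Set A)
  init : PMF M

/-- The limit inferior of the averages of `f` along the actions of a run. (For finite `A` the
averages are bounded, so this is a genuine limit inferior.) -/
noncomputable def lrInf {S M A : Type*} (f : A → ℝ) (ω : ℕ → Loc S M A) : ℝ :=
  liminf (fun T : ℕ => (∑ t ∈ Finset.range T, f (ω t).act) / (T : ℝ)) atTop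

/-- `Freq_a`: the limit-inferior frequency of the action `a` on a run. -/
noncomputable def freq {S M A : Type*} (a : A) (ω : ℕ → Loc S M A) : ℝ :=
  lrInf (({a} : Set A).indicator 1) ω

namespace Strategy

variable {S A : Type*} {G : MDP S A} {M : Type*}

/-- The play determined by a strategy, started in state `s`. -/
noncomputable def play (σ : Strategy G M) (s : S) : MarkovChain (Loc S M A) where
  init := σ.init.bind fun m => (σ.next s m).map fun a => ⟨s, m, a⟩
  trans l := (G.δ l.act).bind fun s' => (σ.update l.act s' l.mem).bind fun m' =>
    (σ.next s' m').map fun a' => ⟨s', m', a'⟩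

/-- The measure on runs when the strategy is started in state `s`. -/
noncomputable def measureFrom (σ : Strategy G M) (s : S) : Measure (ℕ → Loc S M A) :=
  (σ.play s).runMeasure

/-- The measure on runs when the strategy is started in the initial state of the MDP. -/
noncomputable def measure (σ : Strategy G M) : Measure (ℕ → Loc S M A) :=
  σ.measureFrom G.init

/-- The initial memory distribution and all memory updates are Dirac. (Moves may randomize.) -/
def IsDeterministicUpdate (σ : Strategy G M) : Prop :=
  (∃ m, σ.init = PMF.pure m) ∧ ∀ a s m, ∃ m', σ.update a s m = PMF.pure m'

/-- Markov strategies: the memory is a step counter, which starts in `0`. -/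
def IsMarkov (σ : Strategy G ℕ) : Prop :=
  σ.init = PMF.pure 0 ∧ ∀ a s k, σ.update a s k = PMF.pure (k + 1)

variable {n : ℕ}

/-- (EXP): the expected long-run average rewards meet the thresholds `exp`. -/
def SatisfiesExp (σ : Strategy G M) (r : A → Fin n → ℝ) (exp : Fin n → ℝ) : Prop :=
  ∀ i, exp i ≤ ∫ ω, lrInf (fun a => r a i) ω ∂σ.measure

/-- Witness strategies for (multi-quant-conjunctive). -/
def IsConjWitness (σ : Strategy G M) (r : A → Fin n → ℝ) (exp sat pr : Fin n → ℝ) : Prop :=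
  σ.SatisfiesExp r exp ∧
    ∀ i, pr i ≤ σ.measure.real {ω | sat i ≤ lrInf (fun a => r a i) ω}

/-- Witness strategies for (multi-quant-joint). -/
def IsJointWitness (σ : Strategy G M) (r : A → Fin n → ℝ) (exp sat : Fin n → ℝ) (pr : ℝ) : Prop :=
  σ.SatisfiesExp r exp ∧
    pr ≤ σ.measure.real {ω | ∀ i, sat i ≤ lrInf (fun a => r a i) ω}

end Strategy

namespace MDP

variable {S A : Type*} (G : MDP S A) {n : ℕ}

/-- Some strategy (with an arbitrary countable memory, and stochastic update) is a witness. -/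
def ConjRealizable (r : A → Fin n → ℝ) (exp sat pr : Fin n → ℝ) : Prop :=
  ∃ (M : Type) (_ : Countable M) (σ : Strategy G M), σ.IsConjWitness r exp sat pr

/-- Some strategy (with an arbitrary countable memory, and stochastic update) is a witness. -/
def JointRealizable (r : A → Fin n → ℝ) (exp sat : Fin n → ℝ) (pr : ℝ) : Prop :=
  ∃ (M : Type) (_ : Countable M) (σ : Strategy G M), σ.IsJointWitness r exp sat pr

/-! ### End components -/

/-- In one step from `u` to `v`, inside the set of states `C.1` and with actions in `C.2`. -/
def StepIn (C : Finset S × Finset A) (u v : S) : Prop :=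
  u ∈ C.1 ∧ v ∈ C.1 ∧ ∃ a ∈ C.2, a ∈ G.act u ∧ G.δ a v ≠ 0

/-- End components `T ∪ B`, represented by the pair `(T, B)`. -/
structure IsEndComponent (C : Finset S × Finset A) : Prop where
  nonempty : C.1.Nonempty
  enabled : ∀ a ∈ C.2, ∃ s ∈ C.1, a ∈ G.act s
  closed : ∀ a ∈ C.2, ∀ s, G.δ a s ≠ 0 → s ∈ C.1
  connected : ∀ s ∈ C.1, ∀ t ∈ C.1, Relation.ReflTransGen (G.StepIn C) s t

/-- Maximal end components. -/
def IsMEC (C : Finset S × Finset A) : Prop := Maximal G.IsEndComponent C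

end MDP

/-! ### The linear program -/

/-- The variables `x_{a,N}`, `y_a`, `y_{s,N}` of the linear program, where `N` ranges over the
family `𝒩` of sets of reward coordinates. -/
structure LPVars (S A : Type*) {n : ℕ} (𝒩 : Finset (Finset (Fin n))) where
  x : A → 𝒩 → ℝ
  yAct : A → ℝ
  ySwitch : S → 𝒩 → ℝ

/-- All sets `N ⊆ [n]`: the index family for (multi-quant-conjunctive). -/
abbrev allSubsets (n : ℕ) : Finset (Finset (Fin n)) := Finset.univ

/-- The sets `∅` and `[n]`: the index family for (multi-quant-joint). -/
abbrev jointSubsets (n : ℕ) : Finset (Finset (Fin n)) := {∅, Finset.univ}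

namespace LPVars

variable {S A : Type*} [Fintype S] [Fintype A] {n : ℕ} {𝒩 : Finset (Finset (Fin n))}

open scoped Classical in
/-- Nonnegativity and Equations 1 to 6 of the linear program, in this order. -/
structure IsFlow (v : LPVars S A 𝒩) (G : MDP S A) (r : A → Fin n → ℝ) (exp sat : Fin n → ℝ) :
    Prop where
  x_nonneg : ∀ a N, 0 ≤ v.x a N
  yAct_nonneg : ∀ a, 0 ≤ v.yAct a
  ySwitch_nonneg : ∀ s N, 0 ≤ v.ySwitch s N
  transient_flow : ∀ s, (if s = G.init then 1 else 0) + ∑ a, v.yAct a * (G.δ a s).toReal =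
    ∑ a ∈ G.act s, v.yAct a + ∑ N, v.ySwitch s N
  switching : ∑ s with ∃ C, G.IsMEC C ∧ s ∈ C.1, ∑ N, v.ySwitch s N = 1
  switch_eq_freq : ∀ C, G.IsMEC C → ∀ N, ∑ s ∈ C.1, v.ySwitch s N = ∑ a ∈ C.2, v.x a N
  recurrent_flow : ∀ s N, ∑ a, v.x a N * (G.δ a s).toReal = ∑ a ∈ G.act s, v.x a N
  expected_reward : ∀ i, exp i ≤ ∑ a, ∑ N, v.x a N * r a i
  commitment : ∀ C, G.IsMEC C → ∀ N : 𝒩, ∀ i ∈ N.1,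
    ∑ a ∈ C.2, v.x a N * sat i ≤ ∑ a ∈ C.2, v.x a N * r a i

/-- Solutions of the linear program for (multi-quant-conjunctive); the second conjunct is
Equation 7. -/
def IsConjSolution (v : LPVars S A (allSubsets n)) (G : MDP S A) (r : A → Fin n → ℝ)
    (exp sat pr : Fin n → ℝ) : Prop :=
  v.IsFlow G r exp sat ∧
    ∀ i, pr i ≤ ∑ N : allSubsets n with i ∈ N.1, ∑ a, v.x a N

/-- Solutions of the linear program for (multi-quant-joint); the second conjunct is Equation 7. -/
def IsJointSolution (v : LPVars S A (jointSubsets n)) (G : MDP S A) (r : A → Fin n → ℝ)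
    (exp sat : Fin n → ℝ) (pr : ℝ) : Prop :=
  v.IsFlow G r exp sat ∧
    pr ≤ ∑ N : jointSubsets n with N.1 = Finset.univ, ∑ a, v.x a N

end LPVars

/-! ### Recurrent strategies and switching -/

section Switching

variable {S A : Type*} {G : MDP S A} {n : ℕ} {𝒩 : Finset (Finset (Fin n))}

/-- The `ξ_N` are recurrent strategies for `x`: Markov strategies which, started anywhere in a MEC
`C` in which `x_{·,N}` does not vanish, stay in `C` and almost surely play each action `a` of `C`
with frequency `x_{a,N} / ∑_{b ∈ C} x_{b,N}`. -/
def AreRecurrent (x : A → 𝒩 → ℝ) (ξ : 𝒩 → Strategy G ℕ) : Prop :=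
  ∀ N, (ξ N).IsMarkov ∧ ∀ C, G.IsMEC C → 0 < ∑ b ∈ C.2, x b N →
    (∀ s ∈ C.1, ∀ k, ((ξ N).next s k).support ⊆ (C.2 : Set A)) ∧
    ∀ s ∈ C.1, ∀ᵐ ω ∂(ξ N).measureFrom s, ∀ a ∈ C.2, freq a ω = x a N / ∑ b ∈ C.2, x b N

/-- The strategy `ρ` uses the memory `M₀` until it switches to one of the strategies `ξ_N`.
The memory elements `inr (N, k)` are those of `ξ_N`: in them `ρ` behaves exactly as `ξ_N`, and
they are entered in the initial memory element of `ξ_N`. Almost surely, `ρ` switches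
to some `ξ_N` in a MEC in which `x_{·,N}` does not vanish. -/
structure Strategy.SwitchesTo {M₀ : Type*} (ρ : Strategy G (M₀ ⊕ 𝒩 × ℕ)) (x : A → 𝒩 → ℝ)
    (ξ : 𝒩 → Strategy G ℕ) : Prop where
  next_eq : ∀ s N k, ρ.next s (Sum.inr (N, k)) = (ξ N).next s k
  update_eq : ∀ a s N k,
    ρ.update a s (Sum.inr (N, k)) = ((ξ N).update a s k).map fun j => Sum.inr (N, j)
  init_entry : ∀ N k, Sum.inr (N, k) ∈ ρ.init.support → k ∈ (ξ N).init.support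
  update_entry : ∀ a s m N k,
    Sum.inr (N, k) ∈ (ρ.update a s (Sum.inl m)).support → k ∈ (ξ N).init.support
  ae_switches : ∀ᵐ ω ∂ρ.measure, ∃ t N C, G.IsMEC C ∧ 0 < ∑ b ∈ C.2, x b N ∧
    (ω t).state ∈ C.1 ∧ (ω t).mem = Sum.inr (N, 0)

end Switching

/-! From a witness to the program. Classify every run by a set N of coordinates whose thresholds it
meets: all of them in the conjunctive case, `[n]` or `∅` in the joint case. On the event E_N of runs
of class N, consider the expected action frequencies up to time T and the distribution of the state
at time T. These are finitely many numbers in [0,1], so they converge along some sequence of times;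
the limits are x_{a,N} and y_{s,N}. Almost every run is finally trapped in one MEC (`ae_trapped`),
so both families put the same mass on each MEC. The event E_N may depend on the whole future, so
conservation for x is not a one-step identity; it holds because the martingale fluctuations are of
order √T in L² (`integral_fluct_sq_le`), hence negligible on any event. Fatou's lemma yields the
reward inequalities. The y_a come from Farkas' lemma: the only obstruction would be a superharmonic
function of the state that grows in expectation. These arguments are collected in `exists_isFlow`.

Recurrent strategies. A circulation x_N is supported on MECs, but may be reducible inside one.
Adding z/(j+1), with z a circulation positive on exactly the MEC actions, gives weights W_j whose
proportional strategies are irreducible in each nontrivial MEC. The Markov strategy uses W_{J(k)} in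
step k. The Poisson equation for W_j turns visits of an action into a martingale, a telescoping sum
and the desired frequencies. If J grows slowly enough compared with the Poisson solutions, the first
two vanish after division by T (`ae_tendsto_proportional`).

From a solution to a strategy with deterministic update. Choosing N at random in the memory update
is not allowed, so the randomness is taken from the actions. In a MEC C the strategy performs
finitely many tests, counted by its memory: it walks to a state with two suitable actions and plays
either the `hit` or the `miss`. A hit leaves C or triggers the switch to some ξ_N; a miss starts the
next test. If no state offers two actions of C, then the stationary vector of C is unique, all
normalised frequencies agree, and one ξ_N can replace all others (`exists_tests`). The construction
is made on the level of flows on actions with memory (`exists_isLocalFlow_of_nonempty`, glued in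
`exists_isLiftedFlow`). Moving proportionally to such a flow, the strategy visits each switching
pair with probability exactly equal to its flow (`hasSum_occ`, `measure_visits`), and the total loss
of the flow is one. Hence it switches almost surely, and expectations and probabilities are those
prescribed by the program (`exists_strategy`). -/

namespace MarkovChain

/-! ### Runs of a Markov chain: one-step conditioning and martingale fluctuations -/

open Preorder

variable {L : Type*} [MeasurableSpace L] [DiscreteMeasurableSpace L] (C : MarkovChain L)

instance : IsProbabilityMeasure C.runMeasure := by
  unfold runMeasure; infer_instance

lemma map_frestrictLe_compProd (t : ℕ) :
    C.runMeasure.map (frestrictLe t) ⊗ₘ C.stepKernel t =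
      C.runMeasure.map fun ω => (frestrictLe (π := fun _ => L) t ω, ω (t + 1)) :=
  Kernel.map_frestrictLe_trajMeasure_compProd_eq_map_trajMeasure

/-- The expected value of `ψ` after one step of the chain. -/
noncomputable def avg (ψ : L → ℝ) (l : L) : ℝ := ∫ l', ψ l' ∂(C.trans l).toMeasure

omit [DiscreteMeasurableSpace L] in
lemma abs_avg_le {ψ : L → ℝ} {d : ℝ} (hd : ∀ l, |ψ l| ≤ d) (l : L) : |C.avg ψ l| ≤ d := by
  have := norm_integral_le_of_norm_le_const (μ := (C.trans l).toMeasure) (f := ψ) (C := d)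
    (ae_of_all _ fun l => by simpa using hd l)
  simpa [avg] using this

/-- The law of history and next location is a composition product, so `C.avg ψ (ω t)` is the
conditional expectation of `ψ (ω (t + 1))`, tested here against bounded functions of the history. -/
lemma integral_mul_next (t : ℕ) {F : ((i : Finset.Iic t) → L) → ℝ} (hF : Measurable F) {c : ℝ}
    (hc : ∀ x, |F x| ≤ c) {ψ : L → ℝ} {d : ℝ} (hd : ∀ l, |ψ l| ≤ d) :
    ∫ ω, F (frestrictLe t ω) * ψ (ω (t + 1)) ∂C.runMeasure =
      ∫ ω, F (frestrictLe t ω) * C.avg ψ (ω t) ∂C.runMeasure := by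
  have hψ : Measurable ψ := Measurable.of_discrete
  have hm : Measurable fun q : ((i : Finset.Iic t) → L) × L => F q.1 * ψ q.2 := by fun_prop
  have hr : Measurable fun ω : ℕ → L => (frestrictLe (π := fun _ => L) t ω, ω (t + 1)) := by
    fun_prop
  have h1 : ∫ ω, F (frestrictLe t ω) * ψ (ω (t + 1)) ∂C.runMeasure =
      ∫ q, F q.1 * ψ q.2 ∂(C.runMeasure.map (frestrictLe t) ⊗ₘ C.stepKernel t) := by
    rw [map_frestrictLe_compProd, integral_map hr.aemeasurable hm.aestronglyMeasurable]
  have : IsProbabilityMeasure (C.runMeasure.map (frestrictLe (π := fun _ => L) t)) :=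
    Measure.isProbabilityMeasure_map (by fun_prop)
  have hi : Integrable (fun q : ((i : Finset.Iic t) → L) × L => F q.1 * ψ q.2)
      (C.runMeasure.map (frestrictLe t) ⊗ₘ C.stepKernel t) := by
    refine Integrable.of_bound hm.aestronglyMeasurable (c * d) (ae_of_all _ fun q => ?_)
    rw [norm_mul]
    exact mul_le_mul (hc _) (hd _) (norm_nonneg _) ((abs_nonneg _).trans (hc q.1))
  rw [h1, Measure.integral_compProd hi]
  have havg : Measurable (C.avg ψ) := Measurable.of_discrete
  rw [integral_map (by fun_prop)]
  · refine integral_congr_ae (ae_of_all _ fun ω => ?_)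
    simp only [integral_const_mul]
    rfl
  · simp only [integral_const_mul]
    have : (fun x : (i : Finset.Iic t) → L => F x * ∫ a, ψ a ∂(C.stepKernel t) x) =
        fun x => F x * C.avg ψ (x ⟨t, Finset.mem_Iic.2 le_rfl⟩) := rfl
    rw [this]
    exact (hF.mul (havg.comp (measurable_pi_apply _))).aestronglyMeasurable

lemma measure_inter_next (t : ℕ) {E : Set ((i : Finset.Iic t) → L)} (hE : MeasurableSet E)
    (B : Set L) :
    C.runMeasure (frestrictLe t ⁻¹' E ∩ {ω | ω (t + 1) ∈ B}) =
      ∫⁻ ω in frestrictLe t ⁻¹' E, (C.trans (ω t)).toMeasure B ∂C.runMeasure := by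
  have hr : Measurable fun ω : ℕ → L => (frestrictLe (π := fun _ => L) t ω, ω (t + 1)) := by
    fun_prop
  have hB : MeasurableSet B := MeasurableSet.of_discrete
  have h1 : C.runMeasure (frestrictLe t ⁻¹' E ∩ {ω | ω (t + 1) ∈ B}) =
      (C.runMeasure.map (frestrictLe t) ⊗ₘ C.stepKernel t) (E ×ˢ B) := by
    rw [map_frestrictLe_compProd, Measure.map_apply hr (hE.prod hB)]
    rfl
  have : IsProbabilityMeasure (C.runMeasure.map (frestrictLe (π := fun _ => L) t)) :=
    Measure.isProbabilityMeasure_map (by fun_prop)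
  have hm : Measurable fun l => (C.trans l).toMeasure B := Measurable.of_discrete
  rw [h1, Measure.compProd_apply_prod hE hB, setLIntegral_map hE _ (by fun_prop)]
  · rfl
  · exact Kernel.measurable_coe _ hB

lemma measure_path_succ (t : ℕ) {E : Set ((i : Finset.Iic t) → L)} (hE : MeasurableSet E)
    {l : L} (hl : ∀ ω : ℕ → L, frestrictLe t ω ∈ E → ω t = l) (B : Set L) :
    C.runMeasure (frestrictLe t ⁻¹' E ∩ {ω | ω (t + 1) ∈ B}) =
      C.runMeasure (frestrictLe t ⁻¹' E) * (C.trans l).toMeasure B := by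
  rw [measure_inter_next _ _ hE, setLIntegral_congr_fun (g := fun _ => (C.trans l).toMeasure B)]
  · simp [mul_comm]
  · exact measurable_frestrictLe t hE
  · intro ω hω
    simp only
    rw [hl ω hω]

/-- The partial sums of the martingale differences `ψₜ(ωₜ₊₁) - E[ψₜ(ωₜ₊₁) | ωₜ]`. -/
noncomputable def fluct (ψ : ℕ → L → ℝ) (T : ℕ) (ω : ℕ → L) : ℝ :=
  ∑ t ∈ Finset.range T, (ψ t (ω (t + 1)) - C.avg (ψ t) (ω t))

lemma measurable_fluct (ψ : ℕ → L → ℝ) (T : ℕ) : Measurable (C.fluct ψ T) := by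
  unfold fluct
  refine Finset.measurable_sum _ fun t _ => ?_
  exact ((Measurable.of_discrete (f := ψ t)).comp (measurable_pi_apply _)).sub
    ((Measurable.of_discrete (f := C.avg (ψ t))).comp (measurable_pi_apply _))

omit [DiscreteMeasurableSpace L] in
lemma abs_fluct_le {ψ : ℕ → L → ℝ} {d : ℕ → ℝ} (hd : ∀ t l, |ψ t l| ≤ d t) (T : ℕ) (ω : ℕ → L) :
    |C.fluct ψ T ω| ≤ ∑ t ∈ Finset.range T, 2 * d t := by
  refine (Finset.abs_sum_le_sum_abs _ _).trans (Finset.sum_le_sum fun t _ => ?_)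
  have h1 := abs_sub (ψ t (ω (t + 1))) (C.avg (ψ t) (ω t))
  have h2 := hd t (ω (t + 1))
  have h3 := C.abs_avg_le (hd t) (ω t)
  linarith

/-- Puts `fluct` into the form of a function of the history, as `integral_mul_next` requires. -/
lemma exists_fluct_eq (ψ : ℕ → L → ℝ) {d : ℕ → ℝ} (hd : ∀ t l, |ψ t l| ≤ d t) (T : ℕ) :
    ∃ F : ((i : Finset.Iic T) → L) → ℝ, Measurable F ∧
      (∀ x, |F x| ≤ ∑ t ∈ Finset.range T, 2 * d t) ∧
      ∀ ω, C.fluct ψ T ω = F (frestrictLe T ω) := by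
  classical
  rcases isEmpty_or_nonempty L with hL | ⟨⟨l₀⟩⟩
  · exact (IsEmpty.false (C.init.support_nonempty.some)).elim
  -- A history is prolonged to a run by a dummy location; `fluct` up to `T` only reads the
  -- coordinates up to `T`.
  let e : ((i : Finset.Iic T) → L) → ℕ → L := fun x i =>
    if h : i ≤ T then x ⟨i, Finset.mem_Iic.2 h⟩ else l₀
  have he : Measurable e := by
    refine measurable_pi_lambda _ fun i => ?_
    by_cases h : i ≤ T
    · simpa [e, h] using measurable_pi_apply _
    · simp [e, h]
  refine ⟨fun x => C.fluct ψ T (e x), (C.measurable_fluct ψ T).comp he,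
    fun x => C.abs_fluct_le hd T _, fun ω => ?_⟩
  unfold fluct
  refine Finset.sum_congr rfl fun t ht => ?_
  rw [Finset.mem_range] at ht
  simp [e, ht.le, Nat.succ_le_of_lt ht]

/-- Martingale differences are orthogonal: the cross term vanishes by `integral_mul_next`, and the
difference at time `t` is at most `2 * d t` in absolute value. -/
lemma integral_fluct_sq_le {ψ : ℕ → L → ℝ} {d : ℕ → ℝ} (hd : ∀ t l, |ψ t l| ≤ d t) (T : ℕ) :
    ∫ ω, C.fluct ψ T ω ^ 2 ∂C.runMeasure ≤ ∑ t ∈ Finset.range T, (2 * d t) ^ 2 := by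
  induction T with
  | zero => simp [fluct]
  | succ T ih =>
    obtain ⟨F, hF, hFb, hFe⟩ := C.exists_fluct_eq ψ hd T
    have hψ : Measurable (ψ T) := Measurable.of_discrete
    have havg : Measurable (C.avg (ψ T)) := Measurable.of_discrete
    have hms := C.measurable_fluct ψ T
    have hsb := C.abs_fluct_le hd T
    set c := ∑ t ∈ Finset.range T, 2 * d t
    have e1 : ∀ ω, C.fluct ψ (T + 1) ω ^ 2 = C.fluct ψ T ω ^ 2 +
        2 * (F (frestrictLe T ω) * ψ T (ω (T + 1)) - F (frestrictLe T ω) * C.avg (ψ T) (ω T)) +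
        (ψ T (ω (T + 1)) - C.avg (ψ T) (ω T)) ^ 2 := by
      intro ω
      have : C.fluct ψ (T + 1) ω = C.fluct ψ T ω + (ψ T (ω (T + 1)) - C.avg (ψ T) (ω T)) := by
        simp only [fluct, Finset.sum_range_succ]
      rw [this, ← hFe]; ring
    have hd' : ∀ l l', (ψ T l - C.avg (ψ T) l') ^ 2 ≤ (2 * d T) ^ 2 := fun l l' => by
      have h1 := abs_sub (ψ T l) (C.avg (ψ T) l')
      have h2 := hd T l
      have h3 := C.abs_avg_le (hd T) l'
      rw [← sq_abs]
      exact pow_le_pow_left₀ (abs_nonneg _) (by linarith) 2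
    have i1 : Integrable (fun ω => C.fluct ψ T ω ^ 2) C.runMeasure := by
      refine Integrable.of_bound (by fun_prop) (c ^ 2) (ae_of_all _ fun ω => ?_)
      rw [Real.norm_eq_abs, abs_pow]
      exact pow_le_pow_left₀ (abs_nonneg _) (hsb ω) 2
    have hb : ∀ (g : (ℕ → L) → ℝ), Measurable g → (∀ ω, |g ω| ≤ d T) →
        Integrable (fun ω => F (frestrictLe T ω) * g ω) C.runMeasure := by
      intro g hg hgb
      refine Integrable.of_bound (by fun_prop) (c * d T) (ae_of_all _ fun ω => ?_)
      rw [norm_mul]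
      exact mul_le_mul (hFb _) (hgb _) (norm_nonneg _)
        ((abs_nonneg _).trans (hFb (frestrictLe T ω)))
    have i2 := hb (fun ω => ψ T (ω (T + 1))) (by fun_prop) fun ω => hd _ _
    have i3 := hb (fun ω => C.avg (ψ T) (ω T)) (by fun_prop) fun ω => C.abs_avg_le (hd T) _
    have i4 : Integrable (fun ω => (ψ T (ω (T + 1)) - C.avg (ψ T) (ω T)) ^ 2) C.runMeasure := by
      refine Integrable.of_bound (by fun_prop) ((2 * d T) ^ 2) (ae_of_all _ fun ω => ?_)
      rw [Real.norm_eq_abs, abs_of_nonneg (sq_nonneg _)]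
      exact hd' _ _
    have e2 : ∫ ω, C.fluct ψ (T + 1) ω ^ 2 ∂C.runMeasure = ∫ ω, C.fluct ψ T ω ^ 2 ∂C.runMeasure +
        ∫ ω, (ψ T (ω (T + 1)) - C.avg (ψ T) (ω T)) ^ 2 ∂C.runMeasure := by
      have i5 : Integrable (fun ω => 2 * (F (frestrictLe T ω) * ψ T (ω (T + 1)) -
          F (frestrictLe T ω) * C.avg (ψ T) (ω T))) C.runMeasure := (i2.sub i3).const_mul 2
      have i6 : Integrable (fun ω => C.fluct ψ T ω ^ 2 + 2 * (F (frestrictLe T ω) *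
          ψ T (ω (T + 1)) - F (frestrictLe T ω) * C.avg (ψ T) (ω T))) C.runMeasure := i1.add i5
      simp_rw [e1]
      rw [integral_add i6 i4, integral_add i1 i5, integral_const_mul, integral_sub i2 i3,
        C.integral_mul_next T hF hFb (hd T), sub_self, mul_zero, add_zero]
    have e3 : ∫ ω, (ψ T (ω (T + 1)) - C.avg (ψ T) (ω T)) ^ 2 ∂C.runMeasure ≤ (2 * d T) ^ 2 := by
      refine (integral_mono i4 (integrable_const _) fun ω => hd' _ _).trans ?_
      simp
    rw [Finset.sum_range_succ, e2]
    linarith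

lemma map_zero : C.runMeasure.map (fun ω => ω 0) = C.init.toMeasure := by
  have h : C.runMeasure.map (frestrictLe (π := fun _ => L) 0) =
      C.init.toMeasure.map (MeasurableEquiv.piUnique (fun _ : Finset.Iic 0 => L)).symm := by
    unfold runMeasure
    rw [Kernel.trajMeasure, Measure.map_comp _ _ (by fun_prop), Kernel.traj_map_frestrictLe,
      Kernel.partialTraj_self, Measure.id_comp]
  have h2 := congrArg (Measure.map fun x : (i : Finset.Iic 0) → L =>
    x ⟨0, Finset.mem_Iic.2 le_rfl⟩) h
  rw [Measure.map_map (by fun_prop) (by fun_prop),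
    Measure.map_map (by fun_prop) (by fun_prop)] at h2
  exact h2.trans Measure.map_id

lemma ae_trans [Countable L] :
    ∀ᵐ ω ∂C.runMeasure, ∀ t, ω (t + 1) ∈ (C.trans (ω t)).support := by
  rw [ae_all_iff]
  intro t
  have hr : Measurable fun ω : ℕ → L => (frestrictLe (π := fun _ => L) t ω, ω (t + 1)) := by
    fun_prop
  have hs : MeasurableSet {q : ((i : Finset.Iic t) → L) × L |
      q.2 ∈ (C.trans (q.1 ⟨t, Finset.mem_Iic.2 le_rfl⟩)).support} := by
    have : Measurable fun q : ((i : Finset.Iic t) → L) × L =>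
      (q.1 ⟨t, Finset.mem_Iic.2 le_rfl⟩, q.2) := by fun_prop
    exact this (MeasurableSet.of_discrete (s := {r : L × L | r.2 ∈ (C.trans r.1).support}))
  have h := ae_map_iff (μ := C.runMeasure) hr.aemeasurable hs
  have : IsProbabilityMeasure (C.runMeasure.map (frestrictLe (π := fun _ => L) t)) :=
    Measure.isProbabilityMeasure_map (by fun_prop)
  refine h.1 ?_
  rw [← map_frestrictLe_compProd, Measure.ae_compProd_iff hs]
  refine ae_of_all _ fun x => ?_
  change ∀ᵐ l ∂(C.trans (x ⟨t, _⟩)).toMeasure, l ∈ (C.trans (x ⟨t, _⟩)).support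
  rw [ae_iff, PMF.toMeasure_apply_eq_zero_iff _ MeasurableSet.of_discrete]
  exact Set.disjoint_left.2 fun l h1 h2 => h2 h1

lemma ae_init : ∀ᵐ ω ∂C.runMeasure, ω 0 ∈ C.init.support := by
  have hs : MeasurableSet {l | l ∈ C.init.support} := MeasurableSet.of_discrete
  refine (ae_map_iff (μ := C.runMeasure) (f := fun ω => ω 0)
    (measurable_pi_apply 0).aemeasurable hs).1 ?_
  rw [map_zero, ae_iff, PMF.toMeasure_apply_eq_zero_iff _ MeasurableSet.of_discrete]
  exact Set.disjoint_left.2 fun l h1 h2 => h2 h1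

end MarkovChain

/-! ### Cylinders, the Markov property and Borel–Cantelli -/

namespace MarkovChain

open Preorder

variable {L : Type*} [MeasurableSpace L] [DiscreteMeasurableSpace L]

/-- On a countable set the finite-dimensional marginals are determined by their atoms, and they
determine the measure as a projective limit. -/
lemma measure_ext_of_cylinders [Countable L] {μ ν : Measure (ℕ → L)} [IsFiniteMeasure μ]
    [IsFiniteMeasure ν] (h : ∀ (ls : ℕ → L) (k : ℕ),
      μ {ω | ∀ i ≤ k, ω i = ls i} = ν {ω | ∀ i ≤ k, ω i = ls i}) : μ = ν := by
  classical
  rcases isEmpty_or_nonempty L with hL | ⟨⟨l₀⟩⟩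
  · have : IsEmpty (ℕ → L) := ⟨fun f => hL.elim (f 0)⟩
    exact Measure.ext fun s _ => by simp [Set.eq_empty_of_isEmpty s]
  have hp : ∀ n, μ.map (frestrictLe (π := fun _ => L) n) =
      ν.map (frestrictLe (π := fun _ => L) n) := by
    intro n
    refine Measure.ext_of_singleton fun x => ?_
    rw [Measure.map_apply (by fun_prop) (measurableSet_singleton x),
      Measure.map_apply (by fun_prop) (measurableSet_singleton x)]
    have e : frestrictLe (π := fun _ => L) n ⁻¹' {x} = {ω | ∀ i ≤ n, ω i =
        (fun i => if h : i ≤ n then x ⟨i, Finset.mem_Iic.2 h⟩ else l₀) i} := by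
      ext ω
      simp only [Set.mem_preimage, Set.mem_singleton_iff, Set.mem_ofPred_eq, funext_iff]
      constructor
      · intro hx i hi
        simp [hi, ← hx]
      · rintro hx ⟨i, hi⟩
        have := hx i (Finset.mem_Iic.1 hi)
        simpa [Finset.mem_Iic.1 hi] using this
    rw [e, h]
  have hfam := isProjectiveMeasureFamily_map_restrict (P := ν) (X := fun n (ω : ℕ → L) => ω n)
    fun t => (measurable_pi_apply t).aemeasurable
  have h1 : IsProjectiveLimit ν (fun I : Finset ℕ => ν.map fun ω (i : I) => ω i) :=
    fun I => rfl
  have h2 : IsProjectiveLimit μ (fun I : Finset ℕ => ν.map fun ω (i : I) => ω i) :=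
    (isProjectiveLimit_nat_iff hfam μ).2 fun n => hp n
  exact h2.unique h1

variable (C : MarkovChain L)

/-- The product formula is stated from an arbitrary time `t`, because this shifted form contains the
Markov property. -/
lemma measure_cylinder (t : ℕ) (ls : ℕ → L) (k : ℕ) :
    C.runMeasure {ω | ∀ i ≤ k, ω (t + i) = ls i} =
      C.runMeasure {ω | ω t = ls 0} * ∏ i ∈ Finset.range k, C.trans (ls i) (ls (i + 1)) := by
  induction k with
  | zero => simp
  | succ k ih =>
    let E : Set ((i : Finset.Iic (t + k)) → L) :=
      {x | ∀ i, ∀ h : i ≤ k, x ⟨t + i, Finset.mem_Iic.2 (by lia)⟩ = ls i}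
    have hE : MeasurableSet E := by
      have : E = ⋂ i, ⋂ h : i ≤ k, (fun x : (i : Finset.Iic (t + k)) → L =>
          x ⟨t + i, Finset.mem_Iic.2 (by lia)⟩) ⁻¹' {ls i} := by
        ext x; simp [E]
      rw [this]
      exact MeasurableSet.iInter fun i => MeasurableSet.iInter fun h =>
        measurable_pi_apply _ (measurableSet_singleton _)
    have hEe : frestrictLe (π := fun _ => L) (t + k) ⁻¹' E = {ω | ∀ i ≤ k, ω (t + i) = ls i} := by
      ext ω; simp [E]
    have h1 := C.measure_path_succ (t + k) hE (l := ls k)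
      (fun ω hω => by
        have : ω ∈ frestrictLe (π := fun _ => L) (t + k) ⁻¹' E := hω
        rw [hEe] at this
        exact this k le_rfl) {ls (k + 1)}
    rw [hEe, PMF.toMeasure_apply_singleton _ _ (measurableSet_singleton _), ih] at h1
    rw [Finset.prod_range_succ, ← mul_assoc, ← h1]
    congr 1
    ext ω
    simp only [Set.mem_ofPred_eq, Set.mem_inter_iff, Set.mem_singleton_iff]
    constructor
    · intro h
      exact ⟨fun i hi => h i (by lia), h (k + 1) le_rfl⟩
    · rintro ⟨h, h'⟩ i hi
      rcases Nat.lt_or_ge k i with hk | hk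
      · obtain rfl : i = k + 1 := by lia
        exact h'
      · exact h i hk

lemma measure_zero_eq (l : L) : C.runMeasure {ω | ω 0 = l} = C.init l := by
  have := congrArg (fun m => m {l}) C.map_zero
  rwa [Measure.map_apply (by fun_prop) (measurableSet_singleton _),
    PMF.toMeasure_apply_singleton _ _ (measurableSet_singleton _)] at this

lemma eq_runMeasure [Countable L] {μ : Measure (ℕ → L)} [IsFiniteMeasure μ]
    (h : ∀ (ls : ℕ → L) (k : ℕ), μ {ω | ∀ i ≤ k, ω i = ls i} =
      C.init (ls 0) * ∏ i ∈ Finset.range k, C.trans (ls i) (ls (i + 1))) :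
    μ = C.runMeasure := by
  refine measure_ext_of_cylinders fun ls k => ?_
  have := C.measure_cylinder 0 ls k
  simp only [zero_add] at this
  rw [h, this, measure_zero_eq]

/-- The chain with the same transitions started in `l`. -/
noncomputable def startAt (l : L) : MarkovChain L := ⟨C.trans, PMF.pure l⟩

/-- The Markov property. -/
lemma measure_shift [Countable L] (t : ℕ) (l : L) {E : Set (ℕ → L)} (hE : MeasurableSet E) :
    C.runMeasure ({ω | ω t = l} ∩ {ω | (fun i => ω (t + i)) ∈ E}) =
      C.runMeasure {ω | ω t = l} * (C.startAt l).runMeasure E := by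
  classical
  have hsh : Measurable fun (ω : ℕ → L) i => ω (t + i) := by fun_prop
  have hml : MeasurableSet {ω : ℕ → L | ω t = l} :=
    measurableSet_eq_fun (measurable_pi_apply t) measurable_const
  -- Both finite measures have the same values on cylinders: the product formula if the cylinder
  -- starts in `l`, and 0 otherwise.
  have key : (C.runMeasure.restrict {ω | ω t = l}).map (fun ω i => ω (t + i)) =
      C.runMeasure {ω | ω t = l} • (C.startAt l).runMeasure := by
    have := Measure.smul_finite (C.startAt l).runMeasure
      (measure_ne_top C.runMeasure {ω | ω t = l})
    refine measure_ext_of_cylinders fun ls k => ?_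
    have hc : MeasurableSet {ω : ℕ → L | ∀ i ≤ k, ω i = ls i} := by
      have : {ω : ℕ → L | ∀ i ≤ k, ω i = ls i} = ⋂ i, ⋂ _ : i ≤ k, (fun ω => ω i) ⁻¹' {ls i} := by
        ext; simp
      rw [this]
      exact MeasurableSet.iInter fun i => MeasurableSet.iInter fun h =>
        measurable_pi_apply _ (measurableSet_singleton _)
    rw [Measure.map_apply hsh hc, Measure.restrict_apply (hsh hc), Measure.smul_apply, smul_eq_mul]
    have h2 := (C.startAt l).measure_cylinder 0 ls k
    simp only [zero_add] at h2
    rw [h2, measure_zero_eq]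
    by_cases h0 : ls 0 = l
    · have : (fun (ω : ℕ → L) i => ω (t + i)) ⁻¹' {ω | ∀ i ≤ k, ω i = ls i} ∩ {ω | ω t = l} =
          {ω | ∀ i ≤ k, ω (t + i) = ls i} := by
        ext ω
        simp only [Set.mem_inter_iff, Set.mem_preimage, Set.mem_ofPred_eq, and_iff_left_iff_imp]
        intro h
        simpa [h0] using h 0 (Nat.zero_le _)
      rw [this, C.measure_cylinder, h0]
      simp [startAt]
    · have : (fun (ω : ℕ → L) i => ω (t + i)) ⁻¹' {ω | ∀ i ≤ k, ω i = ls i} ∩ {ω | ω t = l} =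
          ∅ := by
        ext ω
        simp only [Set.mem_inter_iff, Set.mem_preimage, Set.mem_ofPred_eq, Set.mem_empty_iff_false,
          iff_false, not_and]
        intro h h'
        exact h0 (by rw [← h', ← h 0 (Nat.zero_le _), add_zero])
      rw [this]
      simp [startAt, h0]
  have := congrArg (fun m => m E) key
  simp only [Measure.smul_apply, smul_eq_mul] at this
  rw [← this, Measure.map_apply hsh hE, Measure.restrict_apply (hsh hE), Set.inter_comm]
  rfl

/-- The future of a run is almost surely good if the chain started in the current location is. -/
lemma ae_shift [Countable L] {p : (ℕ → L) → Prop} (hp : MeasurableSet {ω | p ω}) (q : L → Prop)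
    (h : ∀ t l, q l → C.runMeasure {ω | ω t = l} ≠ 0 →
      ∀ᵐ ω ∂(C.startAt l).runMeasure, p ω) :
    ∀ᵐ ω ∂C.runMeasure, ∀ t, q (ω t) → p fun i => ω (t + i) := by
  rw [ae_all_iff]
  intro t
  -- There are countably many values of `ω t`; those of probability zero may be discarded, which is
  -- why `h` only concerns the others.
  have : ∀ᵐ ω ∂C.runMeasure, ∀ l, q l → ω t = l → p fun i => ω (t + i) := by
    rw [ae_all_iff]
    intro l
    by_cases hl : q l
    · have h1 := C.measure_shift t l hp.compl
      by_cases h0 : C.runMeasure {ω | ω t = l} = 0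
      · have : ∀ᵐ ω ∂C.runMeasure, ω t ≠ l := by
          rw [ae_iff]; simpa using h0
        filter_upwards [this] with ω hω _ h
        exact absurd h hω
      · have h2 := h t l hl h0
        rw [ae_iff] at h2 ⊢
        have h3 : (C.startAt l).runMeasure {ω | p ω}ᶜ = 0 := h2
        rw [h3, mul_zero] at h1
        refine measure_mono_null ?_ h1
        intro ω hω
        simpa [hl] using hω
    · exact ae_of_all _ fun ω h => absurd h hl
  filter_upwards [this] with ω hω hq
  exact hω _ hq rfl

/-- Conditioning on an initial location of positive probability keeps null events null. -/
lemma ae_startAt [Countable L] {p : (ℕ → L) → Prop} (hp : MeasurableSet {ω | p ω})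
    (h : ∀ᵐ ω ∂C.runMeasure, p ω) {l : L} (hl : l ∈ C.init.support) :
    ∀ᵐ ω ∂(C.startAt l).runMeasure, p ω := by
  have h1 := C.measure_shift 0 l hp.compl
  simp only [zero_add] at h1
  have h2 : C.runMeasure ({ω | ω 0 = l} ∩ {ω | (fun i => ω i) ∈ {ω | p ω}ᶜ}) = 0 :=
    measure_mono_null Set.inter_subset_right (ae_iff.1 h)
  rw [h2, measure_zero_eq] at h1
  exact (mul_eq_zero.1 h1.symm).resolve_left hl

/-- The image of a chain under an injective map that respects the transitions. -/
lemma map_startAt [Countable L] {L' : Type*} [MeasurableSpace L'] [DiscreteMeasurableSpace L']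
    [Countable L'] (C' : MarkovChain L') {f : L → L'} (hf : Function.Injective f)
    (h : ∀ l, C'.trans (f l) = (C.trans l).map f) (l : L) :
    (C'.startAt (f l)).runMeasure = (C.startAt l).runMeasure.map fun ω i => f (ω i) := by
  classical
  have hfm : Measurable f := Measurable.of_discrete
  have hm : Measurable fun (ω : ℕ → L) i => f (ω i) := by fun_prop
  symm
  refine eq_runMeasure _ fun ls k => ?_
  have hc : MeasurableSet {ω : ℕ → L' | ∀ i ≤ k, ω i = ls i} := by
    have : {ω : ℕ → L' | ∀ i ≤ k, ω i = ls i} = ⋂ i, ⋂ _ : i ≤ k, (fun ω => ω i) ⁻¹' {ls i} := by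
      ext; simp
    rw [this]
    exact MeasurableSet.iInter fun i => MeasurableSet.iInter fun h =>
      measurable_pi_apply _ (measurableSet_singleton _)
  rw [Measure.map_apply hm hc]
  have hmap : ∀ u v, ((C.trans u).map f) (f v) = C.trans u v := by
    intro u v
    rw [PMF.map_apply, tsum_eq_single v]
    · simp
    · intro w hw
      simp [hf.ne hw.symm]
  by_cases hex : ∀ i ≤ k, ∃ u, f u = ls i
  · choose g hg using hex
    let ls' : ℕ → L := fun i => if h : i ≤ k then g i h else l
    have hls : ∀ i ≤ k, ls i = f (ls' i) := fun i hi => by simp [ls', hi, hg]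
    have e : (fun (ω : ℕ → L) i => f (ω i)) ⁻¹' {ω | ∀ i ≤ k, ω i = ls i} =
        {ω | ∀ i ≤ k, ω i = ls' i} := by
      ext ω
      simp only [Set.mem_preimage, Set.mem_ofPred_eq]
      exact forall₂_congr fun i hi => by rw [hls i hi, hf.eq_iff]
    have h2 := (C.startAt l).measure_cylinder 0 ls' k
    simp only [zero_add] at h2
    rw [e, h2, measure_zero_eq]
    congr 1
    · simp [startAt, hls 0 (Nat.zero_le _), hf.eq_iff]
    · refine Finset.prod_congr rfl fun i hi => ?_
      rw [Finset.mem_range] at hi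
      rw [hls i hi.le, hls (i + 1) hi]
      simp only [startAt]
      rw [h, hmap]
  · push Not at hex
    have e : (fun (ω : ℕ → L) i => f (ω i)) ⁻¹' {ω | ∀ i ≤ k, ω i = ls i} = ∅ := by
      obtain ⟨i, hi, hne⟩ := hex
      ext ω
      simp only [Set.mem_preimage, Set.mem_ofPred_eq, Set.mem_empty_iff_false, iff_false]
      exact fun hall => hne _ (hall i hi)
    rw [e, measure_empty]
    symm
    -- At the first coordinate outside the range of `f`, either the initial weight vanishes or the
    -- transition into it, which comes from the range, has weight zero.
    have hmin := Nat.find_spec hex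
    have hlt : ∀ m < Nat.find hex, ¬ (m ≤ k ∧ ∀ u, f u ≠ ls m) := fun m hm => Nat.find_min hex hm
    set i := Nat.find hex
    obtain ⟨hik, hi⟩ := hmin
    rcases Nat.eq_zero_or_pos i with h0 | h0
    · rw [h0] at hi
      have : ls 0 ≠ f l := fun h => hi l h.symm
      simp [startAt, this]
    · obtain ⟨j, hj⟩ := Nat.exists_eq_succ_of_ne_zero h0.ne'
      have h1 := hlt j (by lia)
      push Not at h1
      obtain ⟨u, hu⟩ := h1 (by lia)
      refine mul_eq_zero_of_right _ (Finset.prod_eq_zero (Finset.mem_range.2 (by lia : j < k)) ?_)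
      simp only [startAt]
      rw [← hu, h, PMF.map_apply]
      refine ENNReal.tsum_eq_zero.2 fun v => if_neg fun hv => ?_
      exact hi v (by rw [hj]; exact hv.symm)

/-- Lévy's Borel–Cantelli lemma for visits of a set of locations. -/
lemma ae_frequently_iff (B : Set L) : ∀ᵐ ω ∂C.runMeasure, (∃ᶠ t in atTop, ω t ∈ B) ↔
    Tendsto (fun n => ∑ k ∈ Finset.range n, C.avg (B.indicator 1) (ω k)) atTop atTop := by
  let ℱ : Filtration ℕ (inferInstance : MeasurableSpace (ℕ → L)) := Filtration.piLE
  have hB : Measurable (B.indicator (1 : L → ℝ)) := Measurable.of_discrete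
  have hb : ∀ l, |B.indicator (1 : L → ℝ) l| ≤ 1 := fun l => by
    by_cases h : l ∈ B <;> simp [h]
  have havg : Measurable (C.avg (B.indicator 1)) := Measurable.of_discrete
  have hℱ : ∀ k, ℱ k = MeasurableSpace.pi.comap (frestrictLe (π := fun _ => L) k) :=
    Filtration.piLE_eq_comap_frestrictLe
  have hcoord : ∀ k, Measurable[ℱ k] fun ω : ℕ → L => ω k := by
    intro k
    rw [hℱ]
    exact (measurable_pi_apply (⟨k, Finset.mem_Iic.2 le_rfl⟩ : Finset.Iic k)).comp
      (comap_measurable (frestrictLe (π := fun _ => L) k))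
  have hs : ∀ n, MeasurableSet[ℱ n] ((fun ω : ℕ → L => ω n) ⁻¹' B) := fun n =>
    hcoord n MeasurableSet.of_discrete
  -- Identifies the conditional probability in Lévy's lemma with the one-step average.
  have hce : ∀ k, (fun ω => C.avg (B.indicator 1) (ω k)) =ᵐ[C.runMeasure]
      C.runMeasure[((fun ω : ℕ → L => ω (k + 1)) ⁻¹' B).indicator (1 : (ℕ → L) → ℝ) | ℱ k] := by
    intro k
    refine ae_eq_condExp_of_forall_setIntegral_eq (ℱ.le k) ?_ ?_ ?_ ?_
    · exact (integrable_const 1).indicator (ℱ.le _ _ (hs (k + 1)))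
    · intro s _ _
      refine Integrable.integrableOn (Integrable.of_bound
        (havg.comp (measurable_pi_apply k)).aestronglyMeasurable 1 (ae_of_all _ fun ω => ?_))
      exact C.abs_avg_le hb _
    · intro s hs' _
      rw [hℱ] at hs'
      obtain ⟨E, hE, rfl⟩ := hs'
      have h1 := C.integral_mul_next k (F := E.indicator 1) (measurable_const.indicator hE) (c := 1)
        (fun x => by by_cases h : x ∈ E <;> simp [h]) hb
      have hEm : MeasurableSet (frestrictLe (π := fun _ => L) k ⁻¹' E) :=
        measurable_frestrictLe k hE
      rw [← integral_indicator hEm, ← integral_indicator hEm]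
      have e1 : ∀ ω : ℕ → L, (frestrictLe (π := fun _ => L) k ⁻¹' E).indicator
          (fun ω => C.avg (B.indicator 1) (ω k)) ω =
          E.indicator 1 (frestrictLe k ω) * C.avg (B.indicator 1) (ω k) := by
        intro ω
        by_cases h : frestrictLe (π := fun _ => L) k ω ∈ E
        · rw [Set.indicator_of_mem (by exact h), Set.indicator_of_mem h]; simp
        · rw [Set.indicator_of_notMem (by exact h), Set.indicator_of_notMem h]; simp
      have e2 : ∀ ω : ℕ → L, (frestrictLe (π := fun _ => L) k ⁻¹' E).indicator
          (((fun ω : ℕ → L => ω (k + 1)) ⁻¹' B).indicator (1 : (ℕ → L) → ℝ)) ω =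
          E.indicator 1 (frestrictLe k ω) * B.indicator 1 (ω (k + 1)) := by
        intro ω
        by_cases h : frestrictLe (π := fun _ => L) k ω ∈ E
        · rw [Set.indicator_of_mem (by exact h), Set.indicator_of_mem h]
          by_cases h' : ω (k + 1) ∈ B
          · rw [Set.indicator_of_mem (by exact h'), Set.indicator_of_mem h']; simp
          · rw [Set.indicator_of_notMem (by exact h'), Set.indicator_of_notMem h']; simp
        · rw [Set.indicator_of_notMem (by exact h), Set.indicator_of_notMem h]; simp
      simp_rw [e1, e2]
      exact h1.symm
    · exact (havg.comp (hcoord k)).aestronglyMeasurable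
  have h := ae_mem_limsup_atTop_iff (ℱ := ℱ) C.runMeasure hs
  filter_upwards [h, ae_all_iff.2 hce] with ω hω hω'
  rw [mem_limsup_iff_frequently_mem] at hω
  simp_rw [← hω'] at hω
  exact hω

end MarkovChain

/-! ### Linear algebra -/

/-- **Farkas' lemma** for finitely many linear functionals. -/
lemma farkas_dual {V ι : Type*} [AddCommGroup V] [Module ℝ V] (s : Finset ι)
    (α : ι → V →ₗ[ℝ] ℝ) (γ : V →ₗ[ℝ] ℝ) (h : ∀ v, (∀ i ∈ s, 0 ≤ α i v) → 0 ≤ γ v) :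
    ∃ c : ι → ℝ, (∀ i, 0 ≤ c i) ∧ γ = ∑ i ∈ s, c i • α i := by
  classical
  induction s using Finset.induction_on generalizing α γ with
  | empty =>
    refine ⟨0, fun _ => le_rfl, LinearMap.ext fun v => ?_⟩
    have h1 := h v (by simp)
    have h2 := h (-v) (by simp)
    simp only [map_neg] at h2
    simp; linarith
  | insert m s hm ih =>
    by_cases hs : ∀ v, (∀ i ∈ s, 0 ≤ α i v) → 0 ≤ γ v
    · obtain ⟨c, hc, e⟩ := ih α γ hs
      refine ⟨fun i => if i = m then 0 else c i, fun i => ?_, ?_⟩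
      · dsimp only; split_ifs <;> simp [hc]
      · rw [Finset.sum_insert hm, e]
        simp only [if_true, zero_smul, zero_add]
        refine Finset.sum_congr rfl fun i hi => ?_
        rw [if_neg (ne_of_mem_of_not_mem hi hm)]
    · push Not at hs
      obtain ⟨x, hx, hγ⟩ := hs
      have hmx : α m x < 0 := by
        by_contra hcon
        push Not at hcon
        exact absurd (h x fun i hi => by
          rcases Finset.mem_insert.1 hi with rfl | hi
          exacts [hcon, hx i hi]) (not_le.2 hγ)
      -- Normalised so that `α m y = -1`: then `v ↦ v + α m v • y` maps into the kernel of `α m`,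
      -- and the other functionals, pulled back along this map, satisfy the induction hypothesis.
      set y : V := (-(α m x))⁻¹ • x with hy
      have hpos : 0 < (-(α m x))⁻¹ := by rw [inv_pos]; linarith
      have hmy : α m y = -1 := by
        rw [hy, map_smul, smul_eq_mul, inv_neg, neg_mul, inv_mul_cancel₀ hmx.ne]
      have hyi : ∀ i ∈ s, 0 ≤ α i y := fun i hi => by
        rw [hy, map_smul]; exact mul_nonneg hpos.le (hx i hi)
      have hγy : γ y < 0 := by rw [hy, map_smul]; exact mul_neg_of_pos_of_neg hpos hγ
      obtain ⟨c, hc, e⟩ := ih (fun i => α i + α i y • α m) (γ + γ y • α m) (by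
        intro v hv
        have := h (v + α m v • y) fun i hi => by
          rcases Finset.mem_insert.1 hi with rfl | hi
          · simp [hmy]
          · have := hv i hi
            simp only [LinearMap.add_apply, LinearMap.smul_apply, smul_eq_mul] at this
            simp only [map_add, map_smul, smul_eq_mul]
            linarith
        simp only [map_add, map_smul, smul_eq_mul] at this
        simp only [LinearMap.add_apply, LinearMap.smul_apply, smul_eq_mul]
        linarith)
      -- Undoing the pullback collects all multiples of `α m`; their coefficient is nonnegative
      -- since `α j y ≥ 0` and `γ y < 0`.
      refine ⟨fun i => if i = m then ∑ j ∈ s, c j * α j y - γ y else c i, fun i => ?_, ?_⟩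
      · dsimp only
        split_ifs
        · have : 0 ≤ ∑ j ∈ s, c j * α j y :=
            Finset.sum_nonneg fun j hj => mul_nonneg (hc j) (hyi j hj)
          linarith
        · exact hc i
      · rw [Finset.sum_insert hm]
        have e2 : ∑ i ∈ s, (if i = m then ∑ j ∈ s, c j * α j y - γ y else c i) • α i =
            ∑ i ∈ s, c i • α i := Finset.sum_congr rfl fun i hi => by
          rw [if_neg (ne_of_mem_of_not_mem hi hm)]
        rw [e2]
        refine LinearMap.ext fun v => ?_
        have e3 := LinearMap.congr_fun e v
        simp only [LinearMap.add_apply, LinearMap.smul_apply, LinearMap.sum_apply, smul_eq_mul,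
          mul_add, Finset.sum_add_distrib] at e3
        simp only [if_true, LinearMap.add_apply, LinearMap.smul_apply, LinearMap.sum_apply,
          smul_eq_mul, sub_mul, Finset.sum_mul]
        simp only [← mul_assoc] at e3
        linarith

/-- **Farkas' lemma** for finitely many vectors. -/
lemma farkas {ι S : Type*} [Fintype S] (s : Finset ι) (v : ι → S → ℝ) (b : S → ℝ)
    (h : ∀ u : S → ℝ, (∀ i ∈ s, 0 ≤ ∑ j, u j * v i j) → 0 ≤ ∑ j, u j * b j) :
    ∃ c : ι → ℝ, (∀ i, 0 ≤ c i) ∧ ∀ j, b j = ∑ i ∈ s, c i * v i j := by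
  classical
  let φ : (S → ℝ) → (S → ℝ) →ₗ[ℝ] ℝ := fun w => ∑ j, w j • LinearMap.proj j
  have hφ : ∀ w u, φ w u = ∑ j, u j * w j := fun w u => by
    simp [φ, LinearMap.sum_apply, mul_comm]
  obtain ⟨c, hc, e⟩ := farkas_dual s (fun i => φ (v i)) (φ b) fun u hu => by
    rw [hφ]; exact h u fun i hi => by rw [← hφ]; exact hu i hi
  refine ⟨c, hc, fun j => ?_⟩
  have := LinearMap.congr_fun e (Pi.single j 1)
  simpa [LinearMap.sum_apply, hφ, Pi.single_apply] using this

/-! ### Stationary vectors and the Poisson equation -/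

section Perron

variable {ι : Type*} [Fintype ι] {Q : ι → ι → ℝ}

/-- Zeros of a nonnegative stationary vector propagate backwards. -/
lemma stationary_eq_zero (hQ : ∀ a b, 0 ≤ Q a b)
    (hirr : ∀ a b, Relation.ReflTransGen (fun a b => 0 < Q a b) a b) {d : ι → ℝ}
    (hd : ∀ a, 0 ≤ d a) (hst : ∀ b, d b = ∑ a, d a * Q a b) {b : ι} (hb : d b = 0) (a : ι) :
    d a = 0 := by
  induction hirr a b using Relation.ReflTransGen.head_induction_on with
  | refl => exact hb
  | @head a c hac _ ih =>
    have h0 := hst c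
    rw [ih] at h0
    have := (Finset.sum_eq_zero_iff_of_nonneg
      (fun a _ => mul_nonneg (hd a) (hQ a c))).1 h0.symm a (Finset.mem_univ a)
    exact (mul_eq_zero.1 this).resolve_right hac.ne'

/-- Uniqueness of stationary vectors of an irreducible matrix. -/
lemma stationary_unique (hQ : ∀ a b, 0 ≤ Q a b)
    (hirr : ∀ a b, Relation.ReflTransGen (fun a b => 0 < Q a b) a b) {x : ι → ℝ}
    (hx : ∀ a, 0 < x a) (hxs : ∀ b, x b = ∑ a, x a * Q a b) {μ : ι → ℝ}
    (hμ : ∀ b, μ b = ∑ a, μ a * Q a b) : ∃ c, ∀ a, μ a = c * x a := by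
  rcases isEmpty_or_nonempty ι with h | h
  · exact ⟨0, fun a => h.elim a⟩
  obtain ⟨m, -, hm⟩ := Finset.exists_min_image Finset.univ (fun a => μ a / x a)
    Finset.univ_nonempty
  -- With the minimal ratio at `m`, the vector `μ - (μ m / x m) x` is nonnegative, stationary and
  -- zero at `m`, hence zero everywhere.
  refine ⟨μ m / x m, fun a => ?_⟩
  have := stationary_eq_zero hQ hirr (d := fun a => μ a - μ m / x m * x a)
    (fun a => by
      have h1 := hm a (Finset.mem_univ a)
      have h2 : μ a / x a * x a = μ a := div_mul_cancel₀ _ (hx a).ne'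
      have h3 := mul_le_mul_of_nonneg_right h1 (hx a).le
      linarith)
    (fun b => by
      have e : ∑ a, (μ a - μ m / x m * x a) * Q a b =
          ∑ a, μ a * Q a b - μ m / x m * ∑ a, x a * Q a b := by
        rw [Finset.mul_sum, ← Finset.sum_sub_distrib]
        exact Finset.sum_congr rfl fun a _ => by ring
      rw [e, ← hμ, ← hxs])
    (b := m) (by rw [div_mul_cancel₀ _ (hx m).ne', sub_self]) a
  linarith

/-- The Poisson equation of an irreducible matrix. -/
lemma exists_poisson (hQ : ∀ a b, 0 ≤ Q a b)
    (hirr : ∀ a b, Relation.ReflTransGen (fun a b => 0 < Q a b) a b) {x : ι → ℝ}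
    (hx : ∀ a, 0 < x a) (hxs : ∀ b, x b = ∑ a, x a * Q a b) {g : ι → ℝ}
    (hg : ∑ a, x a * g a = 0) : ∃ h : ι → ℝ, ∀ a, h a - ∑ b, Q a b * h b = g a := by
  classical
  let w : ι → ι → ℝ := fun b a => (if a = b then 1 else 0) - Q a b
  -- Fredholm alternative: with both signs of every column of `1 - Q`, the cone is the range. The
  -- test vectors are then stationary, hence multiples of `x`, and `g` is orthogonal to `x`.
  obtain ⟨c, -, hc⟩ := farkas (Finset.univ : Finset (ι ⊕ ι))
    (Sum.elim w fun b a => -w b a) g (by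
      intro μ hμ
      have h0 : ∀ b, ∑ a, μ a * w b a = 0 := fun b => by
        have h1 := hμ (Sum.inl b) (Finset.mem_univ _)
        have h2 := hμ (Sum.inr b) (Finset.mem_univ _)
        simp only [Sum.elim_inl, Sum.elim_inr, mul_neg, Finset.sum_neg_distrib] at h1 h2
        linarith
      obtain ⟨k, hk⟩ := stationary_unique hQ hirr hx hxs (μ := μ) fun b => by
        have := h0 b
        simp only [w, mul_sub, Finset.sum_sub_distrib, mul_ite, mul_one, mul_zero,
          Finset.sum_ite_eq', Finset.mem_univ, if_true] at this
        linarith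
      refine le_of_eq ?_
      simp_rw [hk, mul_assoc]
      rw [← Finset.mul_sum, hg, mul_zero])
  refine ⟨fun b => c (Sum.inl b) - c (Sum.inr b), fun a => ?_⟩
  have e := hc a
  simp only [Fintype.sum_sum_type, Sum.elim_inl, Sum.elim_inr, w] at e
  rw [e, ← Finset.sum_add_distrib]
  have e1 : ∀ b, c (Sum.inl b) * ((if a = b then 1 else 0) - Q a b) +
      c (Sum.inr b) * -((if a = b then 1 else 0) - Q a b) =
      (if a = b then c (Sum.inl b) - c (Sum.inr b) else 0) -
        Q a b * (c (Sum.inl b) - c (Sum.inr b)) := by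
    intro b; split_ifs <;> ring
  simp_rw [e1]
  rw [Finset.sum_sub_distrib]
  simp

end Perron

/-! ### Transition probabilities of a Markov decision process -/

namespace MDP

variable {S A : Type*} (G : MDP S A)

/-- The state in which the action `a` is enabled. -/
noncomputable def st (a : A) : S := (G.act_partition a).choose

lemma mem_act {a : A} {s : S} : a ∈ G.act s ↔ G.st a = s :=
  ⟨fun h => ((G.act_partition a).choose_spec.2 s h).symm,
    fun h => h ▸ (G.act_partition a).choose_spec.1⟩

/-- The transition probability as a real number. -/
noncomputable def p (a : A) (s : S) : ℝ := (G.δ a s).toReal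

lemma p_nonneg (a : A) (s : S) : 0 ≤ G.p a s := ENNReal.toReal_nonneg

lemma p_pos_iff {a : A} {s : S} : 0 < G.p a s ↔ G.δ a s ≠ 0 := by
  rw [p, ENNReal.toReal_pos_iff]
  exact ⟨fun h => h.1.ne', fun h => ⟨pos_iff_ne_zero.2 h, (G.δ a).apply_lt_top s⟩⟩

lemma sum_p [Fintype S] (a : A) : ∑ s, G.p a s = 1 := by
  have := (G.δ a).tsum_coe
  rw [tsum_fintype] at this
  unfold p
  rw [← ENNReal.toReal_sum fun s _ => (G.δ a).apply_ne_top s, this, ENNReal.toReal_one]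

lemma exists_p_pos [Fintype S] (a : A) : ∃ s, 0 < G.p a s := by
  by_contra! h
  have := G.sum_p a
  rw [Finset.sum_eq_zero fun s _ => le_antisymm (h s) (G.p_nonneg a s)] at this
  exact zero_ne_one this

lemma p_le_one [Fintype S] (a : A) (s : S) : G.p a s ≤ 1 := by
  rw [← G.sum_p a]
  exact Finset.single_le_sum (fun s _ => G.p_nonneg a s) (Finset.mem_univ s)

open scoped Classical in
lemma sum_act [Fintype A] (s : S) (f : A → ℝ) :
    ∑ a ∈ G.act s, f a = ∑ a, if G.st a = s then f a else 0 := by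
  rw [← Finset.sum_filter]
  refine Finset.sum_congr ?_ fun _ _ => rfl
  ext a; simp [mem_act]

lemma sum_sum_act [Fintype S] [Fintype A] (f : A → ℝ) :
    ∑ s, ∑ a ∈ G.act s, f a = ∑ a, f a := by
  classical
  simp_rw [sum_act]
  rw [Finset.sum_comm]
  simp

/-! ### End components -/

variable {G}

lemma StepIn.mono {C D : Finset S × Finset A} (h : C ≤ D) {u v : S} (huv : G.StepIn C u v) :
    G.StepIn D u v := by
  obtain ⟨h1, h2, a, ha, h3⟩ := huv
  exact ⟨h.1 h1, h.1 h2, a, h.2 ha, h3⟩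

namespace IsEndComponent

variable {C D : Finset S × Finset A}

lemma st_mem (hC : G.IsEndComponent C) {a : A} (ha : a ∈ C.2) : G.st a ∈ C.1 := by
  obtain ⟨s, hs, h⟩ := hC.enabled a ha
  rwa [G.mem_act.1 h]

lemma succ_mem (hC : G.IsEndComponent C) {a : A} (ha : a ∈ C.2) {s : S} (hs : 0 < G.p a s) :
    s ∈ C.1 :=
  hC.closed a ha s (G.p_pos_iff.1 hs)

open scoped Classical in
-- Paths are routed through the common state. This makes distinct MECs disjoint.
lemma union (hC : G.IsEndComponent C) (hD : G.IsEndComponent D) {s : S} (hs : s ∈ C.1)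
    (hs' : s ∈ D.1) : G.IsEndComponent (C.1 ∪ D.1, C.2 ∪ D.2) := by
  have l1 : C ≤ (C.1 ∪ D.1, C.2 ∪ D.2) := ⟨Finset.subset_union_left, Finset.subset_union_left⟩
  have l2 : D ≤ (C.1 ∪ D.1, C.2 ∪ D.2) := ⟨Finset.subset_union_right, Finset.subset_union_right⟩
  refine ⟨⟨s, l1.1 hs⟩, fun a ha => ?_, fun a ha t ht => ?_, fun u hu v hv => ?_⟩
  · rcases Finset.mem_union.1 ha with h | h
    · obtain ⟨t, ht, h'⟩ := hC.enabled a h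
      exact ⟨t, l1.1 ht, h'⟩
    · obtain ⟨t, ht, h'⟩ := hD.enabled a h
      exact ⟨t, l2.1 ht, h'⟩
  · rcases Finset.mem_union.1 ha with h | h
    · exact l1.1 (hC.closed a h t ht)
    · exact l2.1 (hD.closed a h t ht)
  · have h1 : Relation.ReflTransGen (G.StepIn (C.1 ∪ D.1, C.2 ∪ D.2)) u s := by
      rcases Finset.mem_union.1 hu with h | h
      · exact Relation.ReflTransGen.mono (fun _ _ => StepIn.mono l1) _ _ (hC.connected u h s hs)
      · exact Relation.ReflTransGen.mono (fun _ _ => StepIn.mono l2) _ _ (hD.connected u h s hs')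
    have h2 : Relation.ReflTransGen (G.StepIn (C.1 ∪ D.1, C.2 ∪ D.2)) s v := by
      rcases Finset.mem_union.1 hv with h | h
      · exact Relation.ReflTransGen.mono (fun _ _ => StepIn.mono l1) _ _ (hC.connected s hs v h)
      · exact Relation.ReflTransGen.mono (fun _ _ => StepIn.mono l2) _ _ (hD.connected s hs' v h)
    exact h1.trans h2

lemma exists_action_of_ne (hC : G.IsEndComponent C) {s t : S} (hs : s ∈ C.1) (ht : t ∈ C.1)
    (h : s ≠ t) : ∃ a ∈ C.2, G.st a = s := by
  rcases (hC.connected s hs t ht).cases_head with h' | ⟨c, ⟨_, _, a, ha, h1, _⟩, _⟩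
  · exact absurd h' h
  · exact ⟨a, ha, G.mem_act.1 h1⟩

lemma exists_action (hC : G.IsEndComponent C) (hne : C.2.Nonempty) {s : S} (hs : s ∈ C.1) :
    ∃ a ∈ C.2, G.st a = s := by
  obtain ⟨b, hb⟩ := hne
  by_cases h : G.st b = s
  · exact ⟨b, hb, h⟩
  · exact hC.exists_action_of_ne hs (hC.st_mem hb) (Ne.symm h)

/-- Minimal values of superharmonic functions propagate to successors. -/
lemma eq_min_of_superharmonic [Fintype S] (hC : G.IsEndComponent C) {h : S → ℝ} {m : ℝ}
    (hm : ∀ s ∈ C.1, m ≤ h s) {a : A} (ha : a ∈ C.2) (hst : h (G.st a) = m)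
    (hsup : ∑ s, G.p a s * h s ≤ h (G.st a)) {v : S} (hv : 0 < G.p a v) : h v = m := by
  have h0 : ∀ s, 0 ≤ G.p a s * (h s - m) := fun s => by
    rcases (G.p_nonneg a s).eq_or_lt with hs | hs
    · rw [← hs, zero_mul]
    · exact mul_nonneg hs.le (sub_nonneg.2 (hm s (hC.succ_mem ha hs)))
  have h1 : ∑ s, G.p a s * (h s - m) = ∑ s, G.p a s * h s - m := by
    simp_rw [mul_sub]
    rw [Finset.sum_sub_distrib, ← Finset.sum_mul, G.sum_p, one_mul]
  have h2 : ∑ s, G.p a s * (h s - m) = 0 :=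
    le_antisymm (by rw [h1]; linarith) (Finset.sum_nonneg fun s _ => h0 s)
  have h3 := (Finset.sum_eq_zero_iff_of_nonneg fun s _ => h0 s).1 h2 v (Finset.mem_univ v)
  have := (mul_eq_zero.1 h3).resolve_left hv.ne'
  linarith

lemma sum_indicator_sub_mul [Fintype S] [DecidableEq S] (u : S → ℝ) (a : A) :
    ∑ s, u s * ((if G.st a = s then 1 else 0) - G.p a s) =
      u (G.st a) - ∑ s, G.p a s * u s := by
  simp_rw [mul_sub]
  rw [Finset.sum_sub_distrib]
  simp [mul_comm]

/-- An end component carries a circulation that is positive on all its actions. -/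
lemma exists_pos_circulation [Fintype S] [Fintype A] (hC : G.IsEndComponent C) :
    ∃ z : A → ℝ, (∀ a ∈ C.2, 0 < z a) ∧ (∀ a ∉ C.2, z a = 0) ∧
      ∀ s, ∑ a, z a * G.p a s = ∑ a ∈ G.act s, z a := by
  classical
  -- Farkas puts the negative of the sum of all columns into their cone, so that `c + 1` is a
  -- circulation. A test function `u` is superharmonic along the actions of `C`; its minimum spreads
  -- through `C`, so `u` is constant there and pairs to 0 with every column.
  obtain ⟨c, hc, e⟩ := farkas C.2 (fun a s => (if G.st a = s then 1 else 0) - G.p a s)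
    (fun s => -∑ a ∈ C.2, ((if G.st a = s then 1 else 0) - G.p a s)) (by
      intro u hu
      simp_rw [sum_indicator_sub_mul] at hu
      obtain ⟨s₀, hs₀, hmin⟩ := Finset.exists_min_image C.1 u hC.nonempty
      have hconst : ∀ s ∈ C.1, u s = u s₀ := by
        intro s hs
        induction hC.connected s₀ hs₀ s hs with
        | refl => rfl
        | tail _ hstep ih =>
          obtain ⟨h1, h2, a, ha, h3, h4⟩ := hstep
          have hsta := G.mem_act.1 h3
          exact hC.eq_min_of_superharmonic (m := u s₀) hmin ha (by rw [hsta]; exact ih h1)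
            (sub_nonneg.1 (hu a ha)) (G.p_pos_iff.2 h4)
      have hz : ∀ a ∈ C.2, ∑ s, u s * ((if G.st a = s then 1 else 0) - G.p a s) = 0 := by
        intro a ha
        rw [sum_indicator_sub_mul, hconst _ (hC.st_mem ha)]
        have : ∑ s, G.p a s * u s = ∑ s, G.p a s * u s₀ := Finset.sum_congr rfl fun s _ => by
          rcases (G.p_nonneg a s).eq_or_lt with hs | hs
          · rw [← hs, zero_mul, zero_mul]
          · rw [hconst s (hC.succ_mem ha hs)]
        rw [this, ← Finset.sum_mul, G.sum_p, one_mul, sub_self]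
      refine le_of_eq ?_
      simp_rw [mul_neg, Finset.mul_sum]
      rw [Finset.sum_neg_distrib, Finset.sum_comm, Finset.sum_eq_zero hz, neg_zero])
  refine ⟨fun a => if a ∈ C.2 then c a + 1 else 0, fun a ha => ?_, fun a ha => by simp [ha],
    fun s => ?_⟩
  · simp only [ha, if_true]
    have := hc a
    linarith
  · have h := e s
    rw [sum_act]
    have e1 : ∀ f : A → ℝ, ∑ a, (if a ∈ C.2 then c a + 1 else 0) * f a =
        ∑ a ∈ C.2, (c a + 1) * f a := fun f => by
      simp [ite_mul, Finset.sum_ite_mem]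
    have e2 : ∑ a, (if G.st a = s then if a ∈ C.2 then c a + 1 else 0 else 0) =
        ∑ a ∈ C.2, (c a + 1) * (if G.st a = s then 1 else 0) := by
      rw [← e1]
      refine Finset.sum_congr rfl fun a _ => ?_
      split_ifs <;> simp
    rw [e1, e2]
    have e3 : ∑ a ∈ C.2, (c a + 1) * ((if G.st a = s then 1 else 0) - G.p a s) = 0 := by
      simp_rw [add_mul, one_mul]
      rw [Finset.sum_add_distrib, ← h, neg_add_cancel]
    simp_rw [mul_sub] at e3
    rw [Finset.sum_sub_distrib] at e3
    linarith

open scoped Classical in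
/-- Inside an end component, one unit of flow can be sent from `s` to `t`. -/
lemma exists_unit_flow [Fintype S] [Fintype A] (hC : G.IsEndComponent C) {s t : S} (hs : s ∈ C.1)
    (ht : t ∈ C.1) : ∃ w : A → ℝ, (∀ a, 0 ≤ w a) ∧ (∀ a, w a ≠ 0 → a ∈ C.2 ∧ G.st a ≠ t) ∧
      ∀ v, (if v = s then 1 else 0) + ∑ a, w a * G.p a v =
        ∑ a ∈ G.act v, w a + if v = t then 1 else 0 := by
  -- Actions in `t` are excluded, so the flow stops on arrival. A test function is superharmonic off
  -- `t`, hence its minimum over `C` spreads until `t` is met; thus `u t` is that minimum and `u t ≤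
  -- u s`.
  obtain ⟨c, hc, e⟩ := farkas (C.2.filter fun a => G.st a ≠ t)
    (fun a s => (if G.st a = s then 1 else 0) - G.p a s)
    (fun v => (if v = s then 1 else 0) - if v = t then 1 else 0) (by
      intro u hu
      simp_rw [sum_indicator_sub_mul] at hu
      obtain ⟨s₀, hs₀, hmin⟩ := Finset.exists_min_image C.1 u hC.nonempty
      have hreach : ∀ v, Relation.ReflTransGen (G.StepIn C) s₀ v → u v = u s₀ ∨ u t = u s₀ := by
        intro v hv
        induction hv with
        | refl => exact Or.inl rfl
        | @tail v v' _ hstep ih =>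
          obtain ⟨h1, h2, a, ha, h3, h4⟩ := hstep
          have hsta := G.mem_act.1 h3
          rcases ih with ih | ih
          · by_cases hvt : v = t
            · exact Or.inr (hvt ▸ ih)
            · refine Or.inl (hC.eq_min_of_superharmonic (m := u s₀) hmin ha (by rw [hsta]; exact ih)
                (sub_nonneg.1 (hu a ?_)) (G.p_pos_iff.2 h4))
              rw [Finset.mem_filter, hsta]
              exact ⟨ha, hvt⟩
          · exact Or.inr ih
      have hut : u t = u s₀ := by
        rcases hreach t (hC.connected s₀ hs₀ t ht) with h | h <;> exact h
      have := hmin s hs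
      simp_rw [mul_sub]
      rw [Finset.sum_sub_distrib]
      simp only [mul_ite, mul_one, mul_zero, Finset.sum_ite_eq', Finset.mem_univ, if_true]
      linarith)
  refine ⟨fun a => if a ∈ C.2 ∧ G.st a ≠ t then c a else 0, fun a => ?_, fun a ha => ?_,
    fun v => ?_⟩
  · dsimp only; split_ifs
    exacts [hc a, le_rfl]
  · by_contra h; exact ha (if_neg h)
  · have h := e v
    rw [sum_act]
    have e1 : ∀ f : A → ℝ, ∑ a, (if a ∈ C.2 ∧ G.st a ≠ t then c a else 0) * f a =
        ∑ a ∈ C.2.filter fun a => G.st a ≠ t, c a * f a := fun f => by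
      have : C.2.filter (fun a => G.st a ≠ t) =
          Finset.univ.filter fun a => a ∈ C.2 ∧ G.st a ≠ t := by ext; simp
      rw [this, Finset.sum_filter]
      exact Finset.sum_congr rfl fun a _ => by split_ifs <;> simp
    have e2 : ∑ a, (if G.st a = v then if a ∈ C.2 ∧ G.st a ≠ t then c a else 0 else 0) =
        ∑ a ∈ C.2.filter fun a => G.st a ≠ t, c a * (if G.st a = v then 1 else 0) := by
      rw [← e1]
      exact Finset.sum_congr rfl fun a _ => by split_ifs <;> simp
    rw [e1, e2]
    simp_rw [mul_sub] at h
    rw [Finset.sum_sub_distrib] at h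
    linarith

/-- Positive move probabilities make the chain of actions of an end component irreducible. -/
lemma irreducible [Fintype S] (hC : G.IsEndComponent C) {q : A → ℝ} (hq : ∀ a ∈ C.2, 0 < q a)
    (a b : {a // a ∈ C.2}) :
    Relation.ReflTransGen (fun a b : {a // a ∈ C.2} => 0 < G.p a (G.st b) * q b) a b := by
  have key : ∀ u v, Relation.ReflTransGen (G.StepIn C) u v → ∀ a : {a // a ∈ C.2}, 0 < G.p a u →
      ∀ b : {a // a ∈ C.2}, G.st b = v →
      Relation.ReflTransGen (fun a b : {a // a ∈ C.2} => 0 < G.p a (G.st b) * q b) a b := by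
    intro u v huv
    induction huv using Relation.ReflTransGen.head_induction_on with
    | refl =>
      intro a ha b hb
      exact Relation.ReflTransGen.single (mul_pos (hb ▸ ha) (hq b b.2))
    | head hstep _ ih =>
      intro a ha b hb
      obtain ⟨_, _, c, hc, h3, h4⟩ := hstep
      refine Relation.ReflTransGen.head (b := ⟨c, hc⟩) ?_
        (ih ⟨c, hc⟩ (G.p_pos_iff.2 h4) b hb)
      exact mul_pos (by rw [G.mem_act.1 h3]; exact ha) (hq c hc)
  obtain ⟨s, hs⟩ := G.exists_p_pos a
  exact key s (G.st b) (hC.connected s (hC.succ_mem a.2 hs) _ (hC.st_mem b.2)) a hs b rfl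

end IsEndComponent

/-- End components without actions are allowed. Hence every state lies in a MEC, and `switching`
sums over all states. -/
lemma isEndComponent_singleton (s : S) : G.IsEndComponent ({s}, ∅) where
  nonempty := ⟨s, by simp⟩
  enabled := by simp
  closed := by simp
  connected := by simp [Relation.ReflTransGen.refl]

lemma IsEndComponent.exists_isMEC [Finite S] [Finite A] {C : Finset S × Finset A}
    (hC : G.IsEndComponent C) : ∃ D, G.IsMEC D ∧ C ≤ D := by
  obtain ⟨D, h1, h2⟩ := Finite.exists_le_maximal hC
  exact ⟨D, h2, h1⟩

lemma IsMEC.eq_of_mem {C D : Finset S × Finset A} (hC : G.IsMEC C) (hD : G.IsMEC D) {s : S}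
    (hs : s ∈ C.1) (hs' : s ∈ D.1) : C = D := by
  classical
  have h := hC.prop.union hD.prop hs hs'
  have l1 : C ≤ (C.1 ∪ D.1, C.2 ∪ D.2) := ⟨Finset.subset_union_left, Finset.subset_union_left⟩
  have l2 : D ≤ (C.1 ∪ D.1, C.2 ∪ D.2) := ⟨Finset.subset_union_right, Finset.subset_union_right⟩
  exact le_antisymm (l1.trans (hD.le_of_ge h l2)) (l2.trans (hC.le_of_ge h l1))

section Mec

variable [Fintype S] [Fintype A]

variable (G) in
lemma exists_mec (s : S) : ∃ C, G.IsMEC C ∧ s ∈ C.1 := by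
  obtain ⟨D, h1, h2⟩ := (isEndComponent_singleton (G := G) s).exists_isMEC
  exact ⟨D, h1, h2.1 (by simp)⟩

variable (G) in
/-- The maximal end component of a state (which may be trivial). -/
noncomputable def mec (s : S) : Finset S × Finset A := (G.exists_mec s).choose

lemma isMEC_mec (s : S) : G.IsMEC (G.mec s) := (G.exists_mec s).choose_spec.1

lemma mem_mec (s : S) : s ∈ (G.mec s).1 := (G.exists_mec s).choose_spec.2

lemma IsMEC.mec_eq {C : Finset S × Finset A} (hC : G.IsMEC C) {s : S} (hs : s ∈ C.1) :
    G.mec s = C :=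
  (isMEC_mec s).eq_of_mem hC (mem_mec s) hs

lemma IsMEC.mem_iff {C : Finset S × Finset A} (hC : G.IsMEC C) {s : S} :
    s ∈ C.1 ↔ G.mec s = C :=
  ⟨hC.mec_eq, fun h => h ▸ mem_mec s⟩

lemma IsMEC.mem_snd_iff {C : Finset S × Finset A} (hC : G.IsMEC C) {a : A} :
    a ∈ C.2 ↔ a ∈ (G.mec (G.st a)).2 ∧ G.mec (G.st a) = C := by
  constructor
  · intro h
    have := hC.mec_eq (hC.prop.st_mem h)
    exact ⟨this ▸ h, this⟩
  · rintro ⟨h1, h2⟩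
    exact h2 ▸ h1

end Mec

/-- A set of states that the support of a circulation does not leave is not entered either. -/
lemma st_mem_of_circulation [Fintype S] [Fintype A] {x : A → ℝ} (hx : ∀ a, 0 ≤ x a)
    (hst : ∀ s, ∑ a, x a * G.p a s = ∑ a ∈ G.act s, x a) {D : Set S}
    (hD : ∀ a s, 0 < x a → G.st a ∈ D → 0 < G.p a s → s ∈ D) {a : A} {s : S} (ha : 0 < x a)
    (hs : s ∈ D) (hp : 0 < G.p a s) : G.st a ∈ D := by
  classical
  by_contra hcon
  let g : A → ℝ := fun a => ∑ s with s ∈ D, G.p a s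
  have hg : ∀ a, 0 ≤ g a := fun a => Finset.sum_nonneg fun s _ => G.p_nonneg a s
  -- Conservation summed over `D`: the weight entering states of `D` equals the weight of actions
  -- taken in `D`. Actions of the support taken in `D` stay there, so every term is nonnegative and
  -- thus zero.
  have e : ∑ a, x a * (g a - if G.st a ∈ D then 1 else 0) = 0 := by
    simp_rw [mul_sub]
    rw [Finset.sum_sub_distrib, sub_eq_zero]
    simp_rw [g, Finset.mul_sum]
    rw [Finset.sum_comm]
    simp_rw [hst, sum_act]
    rw [Finset.sum_comm]
    refine Finset.sum_congr rfl fun a _ => ?_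
    simp [Finset.sum_ite_eq]
  have h0 : ∀ a, 0 ≤ x a * (g a - if G.st a ∈ D then 1 else 0) := by
    intro a
    rcases (hx a).eq_or_lt with h | h
    · rw [← h, zero_mul]
    · by_cases hm : G.st a ∈ D
      · have : g a = 1 := by
          rw [← G.sum_p a]
          refine Finset.sum_subset (Finset.subset_univ _) fun s _ hs => ?_
          by_contra hne
          exact hs (Finset.mem_filter.2 ⟨Finset.mem_univ _,
            hD a s h hm ((G.p_nonneg a s).lt_of_ne' hne)⟩)
        simp [hm, this]
      · simpa [hm] using mul_nonneg h.le (hg a)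
  have h1 := (Finset.sum_eq_zero_iff_of_nonneg fun a _ => h0 a).1 e a (Finset.mem_univ a)
  rw [if_neg hcon, sub_zero] at h1
  have h2 := (mul_eq_zero.1 h1).resolve_left ha.ne'
  have h3 := (Finset.sum_eq_zero_iff_of_nonneg fun s _ => G.p_nonneg a s).1 h2 s
    (Finset.mem_filter.2 ⟨Finset.mem_univ _, hs⟩)
  exact hp.ne' h3

/-- Circulations live on maximal end components. -/
lemma mem_mec_of_circulation [Fintype S] [Fintype A] {x : A → ℝ} (hx : ∀ a, 0 ≤ x a)
    (hst : ∀ s, ∑ a, x a * G.p a s = ∑ a ∈ G.act s, x a) {a : A} (ha : 0 < x a) :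
    a ∈ (G.mec (G.st a)).2 := by
  classical
  let R : S → S → Prop := fun u v => ∃ b, 0 < x b ∧ G.st b = u ∧ 0 < G.p b v
  -- Nothing enters a closed set from outside, so the source of an edge `v → w` belongs to the set
  -- of states reachable from `w`: reachability along the support is symmetric, and its classes are
  -- end components.
  have hsymm : ∀ u v, Relation.ReflTransGen R u v → Relation.ReflTransGen R v u := by
    intro u v h
    induction h with
    | refl => exact Relation.ReflTransGen.refl
    | @tail v w _ hR ih =>
      obtain ⟨b, hb, rfl, hp⟩ := hR
      refine Relation.ReflTransGen.trans ?_ ih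
      exact st_mem_of_circulation (D := {u | Relation.ReflTransGen R w u}) hx hst
        (fun a s h1 h2 h3 => Relation.ReflTransGen.tail h2 ⟨a, h1, rfl, h3⟩) hb
        Relation.ReflTransGen.refl hp
  let C : Finset S × Finset A :=
    (Finset.univ.filter fun v => Relation.ReflTransGen R (G.st a) v,
      Finset.univ.filter fun b => 0 < x b ∧ Relation.ReflTransGen R (G.st a) (G.st b))
  have hC1 : ∀ v, v ∈ C.1 ↔ Relation.ReflTransGen R (G.st a) v := by simp [C]
  have hC2 : ∀ b, b ∈ C.2 ↔ 0 < x b ∧ Relation.ReflTransGen R (G.st a) (G.st b) := by simp [C]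
  have hEC : G.IsEndComponent C := by
    refine ⟨⟨G.st a, (hC1 _).2 Relation.ReflTransGen.refl⟩, fun b hb => ?_, fun b hb s hs => ?_,
      fun u hu v hv => ?_⟩
    · exact ⟨G.st b, (hC1 _).2 ((hC2 b).1 hb).2, G.mem_act.2 rfl⟩
    · have := (hC2 b).1 hb
      exact (hC1 s).2 (this.2.tail ⟨b, this.1, rfl, G.p_pos_iff.2 hs⟩)
    · rw [hC1] at hu hv
      have huv := (hsymm _ _ hu).trans hv
      clear hv
      induction huv using Relation.ReflTransGen.head_induction_on with
      | refl => exact Relation.ReflTransGen.refl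
      | head hR _ ih =>
        obtain ⟨b, hb, rfl, hp⟩ := hR
        have hw := hu.tail ⟨b, hb, rfl, hp⟩
        exact Relation.ReflTransGen.head ⟨(hC1 _).2 hu, (hC1 _).2 hw, b, (hC2 b).2 ⟨hb, hu⟩,
          G.mem_act.2 rfl, G.p_pos_iff.1 hp⟩ (ih hw)
  obtain ⟨D, hD, hle⟩ := hEC.exists_isMEC
  have h1 : a ∈ D.2 := hle.2 ((hC2 a).2 ⟨ha, Relation.ReflTransGen.refl⟩)
  exact ((hD.mem_snd_iff).1 h1).1

end MDP

open scoped Topology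

/-! ### Long-run averages -/

instance Loc.countable {S M A : Type*} [Countable S] [Countable M] [Countable A] :
    Countable (Loc S M A) :=
  Function.Injective.countable (f := fun l : Loc S M A => (l.state, l.mem, l.act)) (by
    rintro ⟨s, m, a⟩ ⟨s', m', a'⟩ h
    simpa using h)

section LongRun

variable {S M A : Type*}

/-- The average of `f` along the first `T` actions of a run. -/
noncomputable def runAverage (f : A → ℝ) (ω : ℕ → Loc S M A) (T : ℕ) : ℝ :=
  (∑ t ∈ Finset.range T, f (ω t).act) / (T : ℝ)

lemma lrInf_eq (f : A → ℝ) (ω : ℕ → Loc S M A) : lrInf f ω = liminf (runAverage f ω) atTop := rfl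

lemma measurable_apply (f : Loc S M A → ℝ) (t : ℕ) :
    Measurable fun ω : ℕ → Loc S M A => f (ω t) :=
  (Measurable.of_discrete (f := f)).comp (measurable_pi_apply t)

lemma measurable_runAverage (f : A → ℝ) (T : ℕ) :
    Measurable fun ω : ℕ → Loc S M A => runAverage f ω T := by
  unfold runAverage
  exact (Finset.measurable_sum _ fun t _ => measurable_apply (fun l => f l.act) t).div_const _

lemma measurable_lrInf (f : A → ℝ) : Measurable (lrInf f : (ℕ → Loc S M A) → ℝ) :=
  Measurable.liminf fun T => measurable_runAverage f T

lemma runAverage_add (f g : A → ℝ) (ω : ℕ → Loc S M A) (T : ℕ) :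
    runAverage (fun a => f a + g a) ω T = runAverage f ω T + runAverage g ω T := by
  simp only [runAverage, Finset.sum_add_distrib, add_div]

lemma runAverage_const {c : ℝ} (ω : ℕ → Loc S M A) {T : ℕ} (hT : 0 < T) :
    runAverage (fun _ => c) ω T = c := by
  have : (T : ℝ) ≠ 0 := by positivity
  simp [runAverage, this]

/-- A bound on the values of a reward function. -/
noncomputable def rewardBound [Fintype A] (f : A → ℝ) : ℝ := ∑ a, |f a|

variable [Fintype A]

lemma abs_le_rewardBound (f : A → ℝ) (a : A) : |f a| ≤ rewardBound f :=
  Finset.single_le_sum (f := fun a => |f a|) (fun _ _ => abs_nonneg _) (Finset.mem_univ a)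

lemma rewardBound_nonneg (f : A → ℝ) : 0 ≤ rewardBound f :=
  Finset.sum_nonneg fun _ _ => abs_nonneg _

lemma abs_runAverage_le (f : A → ℝ) (ω : ℕ → Loc S M A) (T : ℕ) :
    |runAverage f ω T| ≤ rewardBound f := by
  rcases Nat.eq_zero_or_pos T with rfl | hT
  · simpa [runAverage] using rewardBound_nonneg f
  · have hT' : (0 : ℝ) < T := by exact_mod_cast hT
    rw [runAverage, abs_div, Nat.abs_cast, div_le_iff₀ hT']
    refine (Finset.abs_sum_le_sum_abs _ _).trans
      ((Finset.sum_le_sum fun t _ => abs_le_rewardBound f _).trans ?_)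
    simp [mul_comm]

lemma runAverage_eq_sum [DecidableEq A] (f : A → ℝ) (ω : ℕ → Loc S M A) (T : ℕ) :
    runAverage f ω T = ∑ a, f a * runAverage (({a} : Set A).indicator 1) ω T := by
  have : ∀ b, f b = ∑ a, f a * ({a} : Set A).indicator 1 b := by
    intro b
    rw [Finset.sum_eq_single b]
    · simp
    · intro a _ hab; simp [hab.symm]
    · simp
  conv_lhs => rw [runAverage]
  simp_rw [runAverage, mul_div_assoc', Finset.mul_sum]
  rw [← Finset.sum_div, Finset.sum_comm]
  congr 1
  exact Finset.sum_congr rfl fun t _ => this _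

lemma bounded_runAverage (f : A → ℝ) (ω : ℕ → Loc S M A) :
    IsBoundedUnder (· ≤ ·) atTop (runAverage f ω) ∧ IsBoundedUnder (· ≥ ·) atTop (runAverage f ω) :=
  ⟨isBoundedUnder_of ⟨rewardBound f, fun T => (abs_le.1 (abs_runAverage_le f ω T)).2⟩,
    isBoundedUnder_of ⟨-rewardBound f, fun T => (abs_le.1 (abs_runAverage_le f ω T)).1⟩⟩

lemma le_lrInf_iff (f : A → ℝ) (ω : ℕ → Loc S M A) {c : ℝ} :
    c ≤ lrInf f ω ↔ ∀ b < c, ∀ᶠ T in atTop, b < runAverage f ω T := by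
  rw [lrInf_eq]
  exact le_liminf_iff (bounded_runAverage f ω).1.isCoboundedUnder_ge (bounded_runAverage f ω).2

lemma abs_lrInf_le (f : A → ℝ) (ω : ℕ → Loc S M A) : |lrInf f ω| ≤ rewardBound f := by
  rw [abs_le]
  constructor
  · refine (le_lrInf_iff f ω).2 fun b hb => Eventually.of_forall fun T => hb.trans_le ?_
    exact (abs_le.1 (abs_runAverage_le f ω T)).1
  · rw [lrInf_eq]
    refine (liminf_le_liminf (v := fun _ => rewardBound f)
      (Eventually.of_forall fun T => (abs_le.1 (abs_runAverage_le f ω T)).2)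
      (bounded_runAverage f ω).2 (isBoundedUnder_const.isCoboundedUnder_ge)).trans ?_
    rw [liminf_const]

omit [Fintype A] in
lemma lrInf_eq_of_tendsto {f : A → ℝ} {ω : ℕ → Loc S M A} {c : ℝ}
    (h : Tendsto (runAverage f ω) atTop (𝓝 c)) : lrInf f ω = c := h.liminf_eq

lemma integrable_lrInf (f : A → ℝ) (μ : Measure (ℕ → Loc S M A)) [IsFiniteMeasure μ] :
    Integrable (lrInf f) μ :=
  Integrable.of_bound (measurable_lrInf f).aestronglyMeasurable (rewardBound f)
    (ae_of_all _ fun ω => abs_lrInf_le f ω)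

omit [Fintype A] in
/-- Averages along eventually equal sequences have the same limits. -/
lemma tendsto_runAverage_sub {f g : A → ℝ} {ω : ℕ → Loc S M A}
    (h : ∀ᶠ t in atTop, f (ω t).act = g (ω t).act) :
    Tendsto (fun T => runAverage f ω T - runAverage g ω T) atTop (𝓝 0) := by
  have h0 : Tendsto (fun t => f (ω t).act - g (ω t).act) atTop (𝓝 0) :=
    tendsto_const_nhds.congr' (by filter_upwards [h] with t ht; rw [ht, sub_self])
  have := h0.cesaro
  refine this.congr fun T => ?_
  simp only [runAverage, Finset.sum_sub_distrib]
  ring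

/-- Every action `a` has the frequency `q a` on the run `ω`. -/
def HasFreq (q : A → ℝ) (ω : ℕ → Loc S M A) : Prop :=
  ∀ a, Tendsto (runAverage (({a} : Set A).indicator 1) ω) atTop (𝓝 (q a))

lemma HasFreq.lrInf_eq {q : A → ℝ} {ω : ℕ → Loc S M A} (h : HasFreq q ω) (f : A → ℝ) :
    lrInf f ω = ∑ a, f a * q a := by
  classical
  refine lrInf_eq_of_tendsto ?_
  have e : runAverage f ω = fun T => ∑ a, f a * runAverage (({a} : Set A).indicator 1) ω T :=
    funext fun T => runAverage_eq_sum f ω T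
  rw [e]
  exact tendsto_finsetSum _ fun a _ => (h a).const_mul _

omit [Fintype A] in
lemma HasFreq.of_shift {q : A → ℝ} {ω : ℕ → Loc S M A} (t : ℕ)
    (h : HasFreq q fun i => ω (t + i)) : HasFreq q ω := by
  intro a
  rw [← tendsto_add_atTop_iff_nat t]
  set g : A → ℝ := ({a} : Set A).indicator 1
  have e : ∀ᶠ T : ℕ in atTop, (∑ i ∈ Finset.range t, g (ω i).act) / ((T + t : ℕ) : ℝ) +
      runAverage g (fun i => ω (t + i)) T * ((T : ℝ) / ((T + t : ℕ) : ℝ)) =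
        runAverage g ω (T + t) := by
    filter_upwards [eventually_gt_atTop 0] with T hT
    have h1 : (T : ℝ) ≠ 0 := by positivity
    have h2 : ((T + t : ℕ) : ℝ) ≠ 0 := by positivity
    rw [runAverage, runAverage, add_comm T t, Finset.sum_range_add]
    rw [add_comm t T]
    field_simp
  refine Tendsto.congr' e ?_
  have h1 : Tendsto (fun T : ℕ => ((T + t : ℕ) : ℝ)) atTop atTop :=
    tendsto_natCast_atTop_atTop.comp (tendsto_add_atTop_nat t)
  have h2 : Tendsto (fun T : ℕ => (T : ℝ) / ((T + t : ℕ) : ℝ)) atTop (𝓝 1) := by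
    have : Tendsto (fun T : ℕ => 1 - (t : ℝ) / ((T + t : ℕ) : ℝ)) atTop (𝓝 (1 - 0)) :=
      tendsto_const_nhds.sub (h1.const_div_atTop _)
    rw [sub_zero] at this
    refine this.congr' ?_
    filter_upwards [eventually_gt_atTop 0] with T hT
    have h2 : ((T + t : ℕ) : ℝ) ≠ 0 := by positivity
    rw [eq_div_iff h2, sub_mul, div_mul_cancel₀ _ h2]
    push_cast; ring
  have := (h1.const_div_atTop (∑ i ∈ Finset.range t, g (ω i).act)).add ((h a).mul h2)
  rwa [zero_add, mul_one] at this

/-- Frequencies of sum one determine the frequencies of all actions. -/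
lemma hasFreq_of_freq {B : Finset A} {q : A → ℝ} (hq0 : ∀ a ∉ B, q a = 0)
    (hq : ∑ a ∈ B, q a = 1) {ω : ℕ → Loc S M A} (h : ∀ a ∈ B, freq a ω = q a) : HasFreq q ω := by
  classical
  set u : A → ℕ → ℝ := fun a => runAverage (({a} : Set A).indicator 1) ω
  have hu0 : ∀ a T, 0 ≤ u a T := fun a T => div_nonneg
    (Finset.sum_nonneg fun t _ => Set.indicator_nonneg (fun _ _ => zero_le_one) _)
    (Nat.cast_nonneg T)
  have hu1 : ∀ᶠ T in atTop, ∑ a, u a T = 1 := by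
    filter_upwards [eventually_gt_atTop 0] with T hT
    have := runAverage_eq_sum (fun _ => (1 : ℝ)) ω T
    rw [runAverage_const ω hT] at this
    simp only [one_mul] at this
    exact this.symm
  have hlow : ∀ a, ∀ b < q a, ∀ᶠ T in atTop, b < u a T := by
    intro a
    by_cases ha : a ∈ B
    · exact (le_lrInf_iff _ ω).1 (h a ha).ge
    · intro b hb
      rw [hq0 a ha] at hb
      exact Eventually.of_forall fun T => hb.trans_le (hu0 a T)
  have hq1 : ∑ a, q a = 1 := by
    rw [← hq]
    exact (Finset.sum_subset (Finset.subset_univ B) fun a _ ha => hq0 a ha).symm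
  intro a
  refine tendsto_order.2 ⟨hlow a, fun c hc => ?_⟩
  set n : ℝ := (Fintype.card A : ℝ)
  have hn : 0 < n := by
    have : Nonempty A := ⟨a⟩
    simp only [n]; exact_mod_cast Fintype.card_pos
  -- The averages sum to 1, so lower bounds for the other actions bound the average of `a` from
  -- above. The slack `(c - q a) / n` per action is lost at most `n - 1` times, which stays below `c
  -- - q a`.
  have hall : ∀ᶠ T in atTop, ∀ b, q b - (c - q a) / n < u b T := by
    rw [eventually_all]
    intro b
    exact hlow b _ (by have := div_pos (sub_pos.2 hc) hn; linarith)
  filter_upwards [hall, hu1] with T h1 h2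
  have h3 : ∑ b ∈ Finset.univ.erase a, (q b - (c - q a) / n) ≤ ∑ b ∈ Finset.univ.erase a, u b T :=
    Finset.sum_le_sum fun b _ => (h1 b).le
  have h4 := Finset.add_sum_erase Finset.univ (fun b => u b T) (Finset.mem_univ a)
  have h5 := Finset.add_sum_erase Finset.univ (fun b => q b) (Finset.mem_univ a)
  have h6 : ((Finset.univ.erase a).card : ℝ) = n - 1 := by
    rw [Finset.card_erase_of_mem (Finset.mem_univ a), Finset.card_univ,
      Nat.cast_sub (Fintype.card_pos_iff.2 ⟨a⟩)]
    simp [n]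
  rw [Finset.sum_sub_distrib, Finset.sum_const, nsmul_eq_mul, h6] at h3
  have h7 : (n - 1) * ((c - q a) / n) < c - q a := by
    rw [mul_div_assoc', div_lt_iff₀ hn]
    nlinarith
  linarith

end LongRun

/-! ### Plays -/

lemma integral_comp_pmf {L X : Type*} [MeasurableSpace L] [DiscreteMeasurableSpace L] [Fintype X]
    (q : PMF L) (f : L → X) (h : X → ℝ) :
    ∫ l, h (f l) ∂q.toMeasure = ∑ x, (q.map f x).toReal * h x := by
  let _ : MeasurableSpace X := ⊤
  have hf : Measurable f := Measurable.of_discrete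
  rw [← integral_map (φ := f) (f := h) hf.aemeasurable
    (Measurable.of_discrete (f := h)).aestronglyMeasurable, PMF.toMeasure_map f q hf,
    PMF.integral_eq_sum]
  rfl

namespace Strategy

variable {S A M : Type*} {G : MDP S A} (σ : Strategy G M)

instance (s : S) : IsProbabilityMeasure (σ.measureFrom s) :=
  inferInstanceAs (IsProbabilityMeasure (σ.play s).runMeasure)

instance : IsProbabilityMeasure σ.measure :=
  inferInstanceAs (IsProbabilityMeasure (σ.play G.init).runMeasure)

lemma map_state_trans (s : S) (l : Loc S M A) :
    ((σ.play s).trans l).map Loc.state = G.δ l.act := by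
  simp only [play, PMF.map_bind, PMF.map_comp]
  have : ∀ s' m', PMF.map (Loc.state ∘ fun a' : A => (⟨s', m', a'⟩ : Loc S M A)) (σ.next s' m') =
      PMF.pure s' := fun s' m' => PMF.map_const _ _
  simp only [this, PMF.bind_const, PMF.bind_pure]

lemma avg_state [Fintype S] (s : S) (h : S → ℝ) (l : Loc S M A) :
    (σ.play s).avg (fun l => h l.state) l = ∑ s', G.p l.act s' * h s' := by
  rw [MarkovChain.avg, integral_comp_pmf _ Loc.state, map_state_trans]
  rfl

lemma mem_support_trans {s : S} {l l' : Loc S M A} :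
    l' ∈ ((σ.play s).trans l).support ↔ G.δ l.act l'.state ≠ 0 ∧
      l'.mem ∈ (σ.update l.act l'.state l.mem).support ∧
      l'.act ∈ (σ.next l'.state l'.mem).support := by
  obtain ⟨s', m', a'⟩ := l'
  simp only [play, PMF.mem_support_bind_iff, PMF.mem_support_map_iff, Loc.mk.injEq]
  constructor
  · rintro ⟨_, h1, _, h2, _, h3, rfl, rfl, rfl⟩
    exact ⟨h1, h2, h3⟩
  · rintro ⟨h1, h2, h3⟩
    exact ⟨_, h1, _, h2, _, h3, rfl, rfl, rfl⟩

lemma mem_support_init {s : S} {l : Loc S M A} :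
    l ∈ (σ.play s).init.support ↔ l.state = s ∧ l.mem ∈ σ.init.support ∧
      l.act ∈ (σ.next s l.mem).support := by
  obtain ⟨s', m', a'⟩ := l
  simp only [play, PMF.mem_support_bind_iff, PMF.mem_support_map_iff, Loc.mk.injEq]
  constructor
  · rintro ⟨_, h1, _, h2, rfl, rfl, rfl⟩
    exact ⟨rfl, h1, h2⟩
  · rintro ⟨rfl, h2, h3⟩
    exact ⟨_, h2, _, h3, rfl, rfl, rfl⟩

variable [Countable S] [Countable A] [Countable M]

lemma ae_step (s : S) : ∀ᵐ ω ∂σ.measureFrom s, ∀ t, 0 < G.p (ω t).act (ω (t + 1)).state ∧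
    (ω (t + 1)).mem ∈ (σ.update (ω t).act (ω (t + 1)).state (ω t).mem).support ∧
    (ω (t + 1)).act ∈ (σ.next (ω (t + 1)).state (ω (t + 1)).mem).support := by
  filter_upwards [(σ.play s).ae_trans] with ω hω t
  have := σ.mem_support_trans.1 (hω t)
  exact ⟨G.p_pos_iff.2 this.1, this.2⟩

omit [Countable S] [Countable A] [Countable M] in
lemma ae_start (s : S) : ∀ᵐ ω ∂σ.measureFrom s, (ω 0).state = s ∧ (ω 0).mem ∈ σ.init.support ∧
    (ω 0).act ∈ (σ.next s (ω 0).mem).support := by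
  filter_upwards [(σ.play s).ae_init] with ω hω
  exact σ.mem_support_init.1 hω

lemma ae_act_mem_support (s : S) : ∀ᵐ ω ∂σ.measureFrom s, ∀ t,
    (ω t).act ∈ (σ.next (ω t).state (ω t).mem).support := by
  filter_upwards [σ.ae_step s, σ.ae_start s] with ω h1 h2 t
  rcases t with _ | t
  · rw [h2.1]; exact h2.2.2
  · exact (h1 t).2.2

lemma ae_st_act (s : S) : ∀ᵐ ω ∂σ.measureFrom s, ∀ t, G.st (ω t).act = (ω t).state := by
  filter_upwards [σ.ae_act_mem_support s] with ω h t
  exact G.mem_act.1 (σ.next_enabled _ _ (h t))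

end Strategy

/-! ### Runs are trapped in maximal end components -/

namespace Strategy

variable {S A M : Type*} [Fintype S] [Fintype A] [Countable M] {G : MDP S A} (σ : Strategy G M)

omit [Fintype A] [Countable M] in
lemma ae_frequently_state (s : S) : ∀ᵐ ω ∂σ.measureFrom s, ∀ a v, 0 < G.p a v →
    (∃ᶠ t in atTop, (ω t).act = a) → ∃ᶠ t in atTop, (ω t).state = v := by
  classical
  have h := fun v : S => (σ.play s).ae_frequently_iff {l | l.state = v}
  filter_upwards [ae_all_iff.2 h] with ω hω a v hp hf
  refine (hω v).2 ?_
  have e : ∀ l : Loc S M A, (σ.play s).avg ({l | l.state = v}.indicator 1) l = G.p l.act v := by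
    intro l
    have e1 : ({l : Loc S M A | l.state = v}.indicator 1 : Loc S M A → ℝ) =
        fun l => if l.state = v then (1 : ℝ) else 0 := by
      ext l; simp [Set.indicator]
    rw [e1, σ.avg_state s (fun u => if u = v then 1 else 0)]
    simp
  simp_rw [e]
  -- If the conditional probabilities of `v` were summable they would tend to 0, against infinitely
  -- many terms equal to `G.p a v`.
  refine (not_summable_iff_tendsto_nat_atTop_of_nonneg fun t => G.p_nonneg _ _).1 fun hs => ?_
  have hlt : ∀ᶠ t in atTop, G.p (ω t).act v < G.p a v :=
    hs.tendsto_atTop_zero.eventually (gt_mem_nhds hp)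
  obtain ⟨t, h1, h2⟩ := (hf.and_eventually hlt).exists
  rw [h1] at h2
  exact lt_irrefl _ h2

/-- Almost surely, a run eventually only plays actions of one maximal end component. -/
lemma ae_trapped (s : S) : ∀ᵐ ω ∂σ.measureFrom s, ∃ C, G.IsMEC C ∧
    ∀ᶠ t in atTop, (ω t).act ∈ C.2 := by
  classical
  filter_upwards [σ.ae_frequently_state s, σ.ae_step s, σ.ae_st_act s] with ω hfreq hstep hst
  -- The states and actions occurring infinitely often form an end component: successors recur by
  -- Borel–Cantelli, and the run itself provides the connecting paths once it has settled in them.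
  let T : Finset S := Finset.univ.filter fun v => ∃ᶠ t in atTop, (ω t).state = v
  let B : Finset A := Finset.univ.filter fun a => ∃ᶠ t in atTop, (ω t).act = a
  have hT : ∀ v, v ∈ T ↔ ∃ᶠ t in atTop, (ω t).state = v := by simp [T]
  have hB : ∀ a, a ∈ B ↔ ∃ᶠ t in atTop, (ω t).act = a := by simp [B]
  have evT : ∀ᶠ t in atTop, (ω t).state ∈ T := by
    have : ∀ᶠ t in atTop, ∀ v, v ∉ T → (ω t).state ≠ v := by
      rw [eventually_all]
      intro v
      by_cases h : v ∈ T
      · simp [h]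
      · rw [hT, not_frequently] at h
        filter_upwards [h] with t ht _ using ht
    filter_upwards [this] with t ht
    by_contra hcon
    exact ht _ hcon rfl
  have evB : ∀ᶠ t in atTop, (ω t).act ∈ B := by
    have : ∀ᶠ t in atTop, ∀ a, a ∉ B → (ω t).act ≠ a := by
      rw [eventually_all]
      intro a
      by_cases h : a ∈ B
      · simp [h]
      · rw [hB, not_frequently] at h
        filter_upwards [h] with t ht _ using ht
    filter_upwards [this] with t ht
    by_contra hcon
    exact ht _ hcon rfl
  have hEC : G.IsEndComponent (T, B) := by
    refine ⟨?_, fun a ha => ?_, fun a ha v hv => ?_, fun u hu v hv => ?_⟩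
    · obtain ⟨t, ht⟩ := evT.exists
      exact ⟨_, ht⟩
    · refine ⟨G.st a, (hT _).2 (((hB a).1 ha).mono fun t ht => ?_), G.mem_act.2 rfl⟩
      rw [← hst, ht]
    · exact (hT v).2 (hfreq a v (G.p_pos_iff.2 hv) ((hB a).1 ha))
    · obtain ⟨t₀, ht₀⟩ := eventually_atTop.1 (evT.and evB)
      obtain ⟨t₁, h1, h1'⟩ := (frequently_atTop.1 ((hT u).1 hu)) t₀
      obtain ⟨t₂, h2, h2'⟩ := (frequently_atTop.1 ((hT v).1 hv)) t₁
      have hpath : ∀ k, Relation.ReflTransGen (G.StepIn (T, B)) (ω t₁).state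
          (ω (t₁ + k)).state := by
        intro k
        induction k with
        | zero => exact Relation.ReflTransGen.refl
        | succ k ih =>
          refine ih.tail ⟨(ht₀ _ (by lia)).1, (ht₀ _ (by lia)).1, (ω (t₁ + k)).act,
            (ht₀ _ (by lia)).2, G.mem_act.2 (hst _), G.p_pos_iff.1 (hstep (t₁ + k)).1⟩
      have := hpath (t₂ - t₁)
      rwa [Nat.add_sub_cancel' h2, h1', h2'] at this
  obtain ⟨C, hC, hle⟩ := hEC.exists_isMEC
  exact ⟨C, hC, evB.mono fun t ht => hle.2 ht⟩

end Strategy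

/-! ### Expected frequencies on an event -/

lemma setIntegral_comp_fintype {Ω X : Type*} [MeasurableSpace Ω] [Fintype X] (μ : Measure Ω)
    [IsFiniteMeasure μ] {Y : Ω → X} (hY : ∀ x, MeasurableSet {ω | Y ω = x}) (E : Set Ω)
    (h : X → ℝ) : ∫ ω in E, h (Y ω) ∂μ = ∑ x, h x * μ.real ({ω | Y ω = x} ∩ E) := by
  classical
  have e : ∀ ω, h (Y ω) = ∑ x, ({ω | Y ω = x}.indicator (fun _ => h x)) ω := by
    intro ω
    rw [Finset.sum_eq_single (Y ω)]
    · simp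
    · intro x _ hx; simp [hx.symm]
    · simp
  simp_rw [e]
  rw [integral_finsetSum _ fun x _ => (integrable_const _).indicator (hY x)]
  refine Finset.sum_congr rfl fun x _ => ?_
  rw [integral_indicator (hY x), setIntegral_const, smul_eq_mul, mul_comm,
    measureReal_restrict_apply (hY x), Set.inter_comm]

namespace MarkovChain

variable {L : Type*} [MeasurableSpace L] [DiscreteMeasurableSpace L] (C : MarkovChain L)

/-- On every event, the averaged fluctuations vanish. -/
lemma tendsto_setIntegral_fluct {ψ : ℕ → L → ℝ} (hψ : ∀ t l, |ψ t l| ≤ 1) (E : Set (ℕ → L)) :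
    Tendsto (fun T : ℕ => (∫ ω in E, C.fluct ψ T ω ∂C.runMeasure) / T) atTop (𝓝 0) := by
  -- The second moment is at most `4 T`. With `|F| ≤ F² / (2√T) + √T / 2` the first moment is at
  -- most `2√T + √T / 2`, on whatever event.
  have hb : ∀ᶠ T : ℕ in atTop,
      ‖(∫ ω in E, C.fluct ψ T ω ∂C.runMeasure) / T‖ ≤ 5 / 2 * (√T)⁻¹ := by
    filter_upwards [eventually_gt_atTop 0] with T hT
    have hT' : (0 : ℝ) < T := by exact_mod_cast hT
    have hs : 0 < √(T : ℝ) := Real.sqrt_pos.2 hT'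
    have hss : √(T : ℝ) * √T = T := Real.mul_self_sqrt hT'.le
    have hm := C.measurable_fluct ψ T
    have hbd := C.abs_fluct_le hψ T
    have i1 : Integrable (C.fluct ψ T) C.runMeasure :=
      Integrable.of_bound hm.aestronglyMeasurable _ (ae_of_all _ hbd)
    have i2 : Integrable (fun ω => C.fluct ψ T ω ^ 2) C.runMeasure := by
      refine Integrable.of_bound (by fun_prop) ((∑ t ∈ Finset.range T, 2 * 1) ^ 2)
        (ae_of_all _ fun ω => ?_)
      rw [Real.norm_eq_abs, abs_pow]
      exact pow_le_pow_left₀ (abs_nonneg _) (hbd ω) 2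
    have h1 : |∫ ω in E, C.fluct ψ T ω ∂C.runMeasure| ≤ ∫ ω, |C.fluct ψ T ω| ∂C.runMeasure :=
      (abs_integral_le_integral_abs).trans
        (setIntegral_le_integral i1.abs (ae_of_all _ fun ω => abs_nonneg _))
    have h2 : ∫ ω, |C.fluct ψ T ω| ∂C.runMeasure ≤
        ∫ ω, (C.fluct ψ T ω ^ 2 * (2 * √T)⁻¹ + √T / 2) ∂C.runMeasure := by
      refine integral_mono i1.abs ((i2.mul_const _).add (integrable_const _)) fun ω => ?_
      have : 0 ≤ (|C.fluct ψ T ω| - √T) ^ 2 := sq_nonneg _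
      rw [sub_sq, sq_abs] at this
      have e : C.fluct ψ T ω ^ 2 * (2 * √T)⁻¹ + √T / 2 =
          (C.fluct ψ T ω ^ 2 + √T ^ 2) / (2 * √T) := by
        field_simp
      simp only
      rw [e, le_div_iff₀ (by positivity)]
      linarith
    have h3 := C.integral_fluct_sq_le hψ T
    rw [integral_add (i2.mul_const _) (integrable_const _), integral_mul_const] at h2
    simp only [integral_const, probReal_univ, smul_eq_mul, one_mul] at h2
    simp only [mul_one, Finset.sum_const, Finset.card_range, nsmul_eq_mul] at h3
    rw [norm_div, Real.norm_eq_abs, RCLike.norm_natCast, div_le_iff₀ hT']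
    have h4 : (∫ ω, C.fluct ψ T ω ^ 2 ∂C.runMeasure) * (2 * √T)⁻¹ ≤ T * 2 ^ 2 * (2 * √T)⁻¹ :=
      mul_le_mul_of_nonneg_right h3 (by positivity)
    have h5 : (T : ℝ) * 2 ^ 2 * (2 * √T)⁻¹ = 2 * √T := by
      rw [← div_eq_mul_inv, div_eq_iff (by positivity)]
      nlinarith
    have h6 : 5 / 2 * (√(T : ℝ))⁻¹ * T = 5 / 2 * √T := by
      rw [mul_assoc]
      congr 1
      rw [inv_mul_eq_div, div_eq_iff hs.ne', hss]
    linarith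
  refine squeeze_zero_norm' hb ?_
  have : Tendsto (fun T : ℕ => (√(T : ℝ))⁻¹) atTop (𝓝 0) :=
    tendsto_inv_atTop_zero.comp (Real.tendsto_sqrt_atTop.comp tendsto_natCast_atTop_atTop)
  simpa using this.const_mul (5 / 2)

end MarkovChain

namespace Strategy

variable {S A M : Type*} [Fintype S] [Fintype A] {G : MDP S A} (σ : Strategy G M)

/-- The expected frequency of the action `a` on the event `E` up to time `T`. -/
noncomputable def meanAct (E : Set (ℕ → Loc S M A)) (T : ℕ) (a : A) : ℝ :=
  (∑ t ∈ Finset.range T, σ.measure.real ({ω | (ω t).act = a} ∩ E)) / T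

/-- The probability of the state `s` at time `T` on the event `E`. -/
noncomputable def probState (E : Set (ℕ → Loc S M A)) (T : ℕ) (s : S) : ℝ :=
  σ.measure.real ({ω | (ω T).state = s} ∩ E)

omit [Fintype S] [Fintype A] in
lemma measurableSet_loc (P : Loc S M A → Prop) (t : ℕ) :
    MeasurableSet {ω : ℕ → Loc S M A | P (ω t)} :=
  measurable_pi_apply t (MeasurableSet.of_discrete (s := {l | P l}))

omit [Fintype S] in
lemma setIntegral_act (E : Set (ℕ → Loc S M A)) (t : ℕ) (f : A → ℝ) :
    ∫ ω in E, f (ω t).act ∂σ.measure = ∑ a, f a * σ.measure.real ({ω | (ω t).act = a} ∩ E) :=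
  setIntegral_comp_fintype _ (fun a => measurableSet_loc (fun l => l.act = a) t) E f

omit [Fintype A] in
lemma setIntegral_state (E : Set (ℕ → Loc S M A)) (t : ℕ) (f : S → ℝ) :
    ∫ ω in E, f (ω t).state ∂σ.measure = ∑ s, f s * σ.probState E t s :=
  setIntegral_comp_fintype _ (fun a => measurableSet_loc (fun l => l.state = a) t) E f

omit [Fintype S] [Fintype A] in
lemma integrable_of_fintype (f : Loc S M A → ℝ) {c : ℝ} (hc : ∀ l, |f l| ≤ c) (t : ℕ)
    (μ : Measure (ℕ → Loc S M A)) [IsFiniteMeasure μ] : Integrable (fun ω => f (ω t)) μ :=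
  Integrable.of_bound (measurable_apply f t).aestronglyMeasurable c (ae_of_all _ fun _ => hc _)

omit [Fintype S] in
lemma sum_mul_meanAct (E : Set (ℕ → Loc S M A)) (T : ℕ) (f : A → ℝ) :
    ∑ a, f a * σ.meanAct E T a = (∑ t ∈ Finset.range T, ∫ ω in E, f (ω t).act ∂σ.measure) / T := by
  simp_rw [setIntegral_act, meanAct, mul_div_assoc', Finset.mul_sum]
  rw [← Finset.sum_div, Finset.sum_comm]

omit [Fintype S] in
lemma setIntegral_runAverage (E : Set (ℕ → Loc S M A)) (T : ℕ) (f : A → ℝ) :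
    ∫ ω in E, runAverage f ω T ∂σ.measure = ∑ a, f a * σ.meanAct E T a := by
  rw [sum_mul_meanAct]
  simp_rw [runAverage]
  rw [integral_div, integral_finsetSum]
  exact fun t _ => integrable_of_fintype (fun l => f l.act)
    (fun l => abs_le_rewardBound f l.act) t _

omit [Fintype S] [Fintype A] in
lemma meanAct_mem_Icc (E : Set (ℕ → Loc S M A)) (T : ℕ) (a : A) :
    σ.meanAct E T a ∈ Set.Icc (0 : ℝ) 1 := by
  constructor
  · exact div_nonneg (Finset.sum_nonneg fun _ _ => measureReal_nonneg) (Nat.cast_nonneg _)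
  · refine div_le_one_of_le₀ ?_ (Nat.cast_nonneg _)
    refine (Finset.sum_le_sum fun t _ => measureReal_le_one).trans ?_
    simp

omit [Fintype S] in
lemma sum_meanAct (E : Set (ℕ → Loc S M A)) {T : ℕ} (hT : 0 < T) :
    ∑ a, σ.meanAct E T a = σ.measure.real E := by
  have := σ.sum_mul_meanAct E T fun _ => 1
  have hT' : (T : ℝ) ≠ 0 := by positivity
  simpa [hT'] using this

omit [Fintype A] in
lemma sum_probState (E : Set (ℕ → Loc S M A)) (T : ℕ) :
    ∑ s, σ.probState E T s = σ.measure.real E := by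
  have := σ.setIntegral_state E T fun _ => 1
  simpa using this.symm

omit [Fintype S] in
/-- Fatou's lemma along a subsequence of times. -/
lemma setIntegral_lrInf_le {E : Set (ℕ → Loc S M A)} {φ : ℕ → ℕ} (hφ : Tendsto φ atTop atTop)
    {x : A → ℝ} (hx : ∀ a, Tendsto (fun k => σ.meanAct E (φ k) a) atTop (𝓝 (x a))) (f : A → ℝ) :
    ∫ ω in E, lrInf f ω ∂σ.measure ≤ ∑ a, f a * x a := by
  -- Adding `K` makes the averages nonnegative, so that Fatou's lemma applies to their `ENNReal`
  -- versions.
  set K := rewardBound f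
  have hK : ∀ (ω : ℕ → Loc S M A) T, 0 ≤ runAverage f ω T + K := fun ω T => by
    have := (abs_le.1 (abs_runAverage_le f ω T)).1
    linarith
  have hlim : Tendsto (fun k => ∑ a, f a * σ.meanAct E (φ k) a + K * σ.measure.real E) atTop
      (𝓝 (∑ a, f a * x a + K * σ.measure.real E)) :=
    (tendsto_finsetSum _ fun a _ => (hx a).const_mul _).add_const _
  have hint : ∀ T, ∫ ω in E, (runAverage f ω T + K) ∂σ.measure =
      ∑ a, f a * σ.meanAct E T a + K * σ.measure.real E := by
    intro T
    rw [integral_add _ (integrable_const _), setIntegral_runAverage, setIntegral_const, smul_eq_mul,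
      mul_comm K]
    exact Integrable.of_bound (measurable_runAverage f T).aestronglyMeasurable K
      (ae_of_all _ fun ω => abs_runAverage_le f ω T)
  have hlim0 : 0 ≤ ∑ a, f a * x a + K * σ.measure.real E := by
    refine ge_of_tendsto' hlim fun k => ?_
    rw [← hint]
    exact integral_nonneg fun ω => hK ω _
  have hpt : ∀ ω : ℕ → Loc S M A, ENNReal.ofReal (lrInf f ω + K) ≤
      liminf (fun k => ENNReal.ofReal (runAverage f ω (φ k) + K)) atTop := by
    intro ω
    refine le_of_forall_lt fun c hc => ?_
    obtain ⟨d, hcd, hd⟩ := exists_between hc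
    have hd' : d.toReal < lrInf f ω + K := by
      have := ENNReal.toReal_lt_of_lt_ofReal hd
      exact this
    refine hcd.trans_le (le_liminf_of_le (f := atTop) (by isBoundedDefault) ?_)
    have := hφ.eventually ((le_lrInf_iff f ω).1 le_rfl (d.toReal - K) (by linarith))
    filter_upwards [this] with k hk
    rw [← ENNReal.ofReal_toReal hd.ne_top]
    exact ENNReal.ofReal_le_ofReal (by linarith)
  have hfat := lintegral_liminf_le (u := atTop) (μ := σ.measure.restrict E)
    (f := fun k (ω : ℕ → Loc S M A) => ENNReal.ofReal (runAverage f ω (φ k) + K))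
    fun k => ((measurable_runAverage f (φ k)).add_const K).ennreal_ofReal
  have h1 := (lintegral_mono hpt).trans hfat
  have hlr : ∫⁻ ω in E, ENNReal.ofReal (lrInf f ω + K) ∂σ.measure =
      ENNReal.ofReal (∫ ω in E, (lrInf f ω + K) ∂σ.measure) := by
    have hi : Integrable (fun ω => lrInf f ω + K) (σ.measure.restrict E) :=
      (integrable_lrInf f _).add (integrable_const _)
    rw [ofReal_integral_eq_lintegral_ofReal hi]
    refine ae_of_all _ fun ω => ?_
    have := (abs_le.1 (abs_lrInf_le f ω)).1
    simp only [Pi.zero_apply]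
    linarith
  have hav : ∀ k, ∫⁻ ω in E, ENNReal.ofReal (runAverage f ω (φ k) + K) ∂σ.measure =
      ENNReal.ofReal (∑ a, f a * σ.meanAct E (φ k) a + K * σ.measure.real E) := by
    intro k
    rw [← hint, ofReal_integral_eq_lintegral_ofReal]
    · exact (Integrable.of_bound (measurable_runAverage f _).aestronglyMeasurable K
        (ae_of_all _ fun ω => abs_runAverage_le f ω _)).add (integrable_const _)
    · exact ae_of_all _ fun ω => hK ω _
  rw [hlr] at h1
  simp_rw [hav] at h1
  have hlim' : Tendsto (fun k => ENNReal.ofReal (∑ a, f a * σ.meanAct E (φ k) a +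
      K * σ.measure.real E)) atTop (𝓝 (ENNReal.ofReal (∑ a, f a * x a + K * σ.measure.real E))) :=
    (ENNReal.continuous_ofReal.tendsto _).comp hlim
  rw [hlim'.liminf_eq] at h1
  rw [ENNReal.ofReal_le_ofReal_iff hlim0, integral_add (integrable_lrInf f _) (integrable_const _),
    setIntegral_const, smul_eq_mul, mul_comm _ K] at h1
  linarith

variable [Countable M]

open scoped Classical in
/-- On every event, the expected frequencies satisfy flow conservation in the limit. -/
lemma tendsto_meanAct_flow (E : Set (ℕ → Loc S M A)) (s : S) :
    Tendsto (fun T => ∑ a, σ.meanAct E T a * G.p a s - ∑ a ∈ G.act s, σ.meanAct E T a) atTop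
      (𝓝 0) := by
  let ψ : Loc S M A → ℝ := fun l => if l.state = s then 1 else 0
  have hψ : ∀ l, |ψ l| ≤ 1 := fun l => by simp only [ψ]; split_ifs <;> simp
  have hfl := (σ.play G.init).tendsto_setIntegral_fluct (ψ := fun _ => ψ) (fun _ => hψ) E
  have hbd : Tendsto (fun T : ℕ => (∫ ω in E, (ψ (ω 0) - ψ (ω T)) ∂σ.measure) / T) atTop
      (𝓝 0) := by
    refine squeeze_zero_norm (a := fun T : ℕ => 2 / (T : ℝ)) (fun T => ?_)
      (tendsto_const_div_atTop_nhds_zero_nat 2)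
    rw [norm_div, RCLike.norm_natCast]
    refine div_le_div_of_nonneg_right ?_ (Nat.cast_nonneg _)
    refine (norm_setIntegral_le_of_norm_le_const (C := 2) (measure_lt_top _ _)
      fun ω _ => ?_).trans ?_
    · refine (norm_sub_le _ _).trans ?_
      have h1 := hψ (ω 0)
      have h2 := hψ (ω T)
      simp only [Real.norm_eq_abs]
      linarith
    · have := measureReal_le_one (μ := σ.measure) (s := E)
      linarith
  have hsum := (hfl.add hbd).neg
  rw [add_zero, neg_zero] at hsum
  refine hsum.congr fun T => ?_
  have hav : ∀ l, (σ.play G.init).avg ψ l = G.p l.act s := by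
    intro l
    have := σ.avg_state G.init (fun u : S => if u = s then (1 : ℝ) else 0) l
    simpa using this
  have hint : ∀ t, Integrable (fun ω => ψ (ω t)) (σ.measure.restrict E) := fun t =>
    integrable_of_fintype ψ hψ t _
  have hint' : ∀ t, Integrable (fun ω : ℕ → Loc S M A => G.p (ω t).act s)
      (σ.measure.restrict E) := fun t =>
    integrable_of_fintype (fun l => G.p l.act s) (c := 1)
      (fun l => by rw [abs_of_nonneg (G.p_nonneg _ _)]; exact G.p_le_one _ _) t _
  have e1 : ∑ a, σ.meanAct E T a * G.p a s =
      (∑ t ∈ Finset.range T, ∫ ω in E, G.p (ω t).act s ∂σ.measure) / T := by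
    rw [← σ.sum_mul_meanAct E T fun a => G.p a s]
    exact Finset.sum_congr rfl fun a _ => mul_comm _ _
  have e2 : ∑ a ∈ G.act s, σ.meanAct E T a =
      (∑ t ∈ Finset.range T, ∫ ω in E, ψ (ω t) ∂σ.measure) / T := by
    have h1 : ∀ t, ∫ ω in E, ψ (ω t) ∂σ.measure =
        ∫ ω in E, (fun a => if G.st a = s then (1 : ℝ) else 0) (ω t).act ∂σ.measure := by
      intro t
      refine integral_congr_ae (ae_restrict_of_ae ?_)
      filter_upwards [σ.ae_st_act G.init] with ω hω
      simp only [ψ, hω]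
    rw [Finset.sum_congr rfl fun t _ => h1 t,
      ← σ.sum_mul_meanAct E T fun a => if G.st a = s then (1 : ℝ) else 0, G.sum_act]
    exact Finset.sum_congr rfl fun a _ => by split_ifs <;> simp
  rw [e1, e2, ← sub_div, ← add_div, ← neg_div]
  congr 1
  -- The fluctuation compares `ψ (ω (t + 1))` with its prediction at time `t`; the boundary term
  -- shifts the index back to `t`. Both vanish after division by `T`.
  have e3 : ∀ ω : ℕ → Loc S M A, (σ.play G.init).fluct (fun _ => ψ) T ω + (ψ (ω 0) - ψ (ω T)) =
      ∑ t ∈ Finset.range T, (ψ (ω t) - G.p (ω t).act s) := by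
    intro ω
    have h1 := Finset.sum_range_sub (fun t => ψ (ω t)) T
    rw [Finset.sum_sub_distrib] at h1
    simp only [MarkovChain.fluct, hav, Finset.sum_sub_distrib]
    linarith
  have i1 : Integrable ((σ.play G.init).fluct (fun _ => ψ) T)
      (σ.measure.restrict E) :=
    Integrable.of_bound ((σ.play G.init).measurable_fluct _ T).aestronglyMeasurable _
      (ae_of_all _ ((σ.play G.init).abs_fluct_le (fun _ => hψ) T))
  change -(∫ ω in E, (σ.play G.init).fluct (fun _ => ψ) T ω ∂σ.measure +
    ∫ ω in E, (ψ (ω 0) - ψ (ω T)) ∂σ.measure) = _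
  have i2 : Integrable (fun ω => ψ (ω 0) - ψ (ω T)) (σ.measure.restrict E) := (hint 0).sub (hint T)
  rw [← integral_add i1 i2]
  simp_rw [e3]
  have i3 : ∀ t, Integrable (fun ω => ψ (ω t) - G.p (ω t).act s) (σ.measure.restrict E) :=
    fun t => (hint t).sub (hint' t)
  rw [integral_finsetSum _ fun t _ => i3 t, ← Finset.sum_sub_distrib,
    ← Finset.sum_neg_distrib]
  refine Finset.sum_congr rfl fun t _ => ?_
  rw [integral_sub (hint t) (hint' t), neg_sub]

end Strategy

/-! ### From a witness to a solution of the linear program -/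

namespace Strategy

variable {S A M : Type*} [Fintype S] [Fintype A] [Countable M] {G : MDP S A} (σ : Strategy G M)

omit [Countable M] in
lemma eventually_iff_of_trapped {ω : ℕ → Loc S M A} {C D : Finset S × Finset A} (hC : G.IsMEC C)
    (hD : G.IsMEC D) (h : ∀ᶠ t in atTop, (ω t).act ∈ D.2)
    (hst : ∀ t, G.st (ω t).act = (ω t).state) :
    ∀ᶠ t in atTop, ((ω t).act ∈ C.2 ↔ D = C) ∧ ((ω t).state ∈ C.1 ↔ D = C) := by
  filter_upwards [h] with t ht
  have h1 := hD.mem_snd_iff.1 ht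
  have hs : G.mec (ω t).state = D := by rw [← hst, h1.2]
  refine ⟨⟨fun h => ?_, fun h => h ▸ ht⟩, by rw [hC.mem_iff, hs]⟩
  rw [← h1.2, (hC.mem_snd_iff.1 h).2]

open scoped Classical in
/-- The probability of being in a maximal end component `C` converges on every event. -/
lemma exists_tendsto_trap {C : Finset S × Finset A} (hC : G.IsMEC C) (E : Set (ℕ → Loc S M A)) :
    ∃ q, Tendsto (fun T => ∑ a ∈ C.2, σ.meanAct E T a) atTop (𝓝 q) ∧
      Tendsto (fun T => ∑ s ∈ C.1, σ.probState E T s) atTop (𝓝 q) := by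
  -- `F` indicates that the run is trapped in `C`. The indicators of an action in `C` and of a state
  -- in `C` are both eventually equal to it, so both limits are the integral of `F` over `E`; for
  -- actions a Cesàro mean is taken as well.
  let F : (ℕ → Loc S M A) → ℝ := fun ω => if ∀ᶠ t in atTop, (ω t).act ∈ C.2 then 1 else 0
  have hlim : ∀ᵐ ω ∂(σ.measure.restrict E),
      ∀ᶠ t in atTop, (if (ω t).act ∈ C.2 then (1 : ℝ) else 0) = F ω ∧
        (if (ω t).state ∈ C.1 then (1 : ℝ) else 0) = F ω := by
    refine ae_restrict_of_ae ?_
    filter_upwards [σ.ae_trapped G.init, σ.ae_st_act G.init] with ω ⟨D, hD, hω⟩ hst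
    have hev := eventually_iff_of_trapped hC hD hω hst
    have hF : F ω = if D = C then 1 else 0 := by
      by_cases h : D = C
      · subst h
        simp only [F]
        rw [if_pos hω, if_pos trivial]
      · have : ¬ ∀ᶠ t in atTop, (ω t).act ∈ C.2 := fun hcon => by
          obtain ⟨t, h1, h2⟩ := (hcon.and hev).exists
          exact h (h2.1.1 h1)
        simp only [F]
        rw [if_neg this, if_neg h]
    filter_upwards [hev] with t ht
    rw [hF]
    simp only [ht.1, ht.2, and_self]
  refine ⟨∫ ω in E, F ω ∂σ.measure, ?_, ?_⟩
  · have h1 : Tendsto (fun t => ∫ ω in E, (if (ω t).act ∈ C.2 then (1 : ℝ) else 0) ∂σ.measure)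
        atTop (𝓝 (∫ ω in E, F ω ∂σ.measure)) := by
      refine tendsto_integral_of_dominated_convergence (fun _ => 1)
        (fun t => (measurable_apply (fun l => if l.act ∈ C.2 then (1 : ℝ) else 0)
          t).aestronglyMeasurable) (integrable_const _) (fun t => ae_of_all _ fun ω => ?_) ?_
      · split_ifs <;> simp
      · filter_upwards [hlim] with ω hω
        exact tendsto_const_nhds.congr' (hω.mono fun t ht => ht.1.symm)
    refine h1.cesaro.congr fun T => ?_
    have := σ.sum_mul_meanAct E T fun a => if a ∈ C.2 then 1 else 0
    rw [inv_mul_eq_div, ← this]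
    simp [ite_mul, Finset.sum_ite_mem]
  · have h1 : Tendsto (fun t => ∫ ω in E, (if (ω t).state ∈ C.1 then (1 : ℝ) else 0) ∂σ.measure)
        atTop (𝓝 (∫ ω in E, F ω ∂σ.measure)) := by
      refine tendsto_integral_of_dominated_convergence (fun _ => 1)
        (fun t => (measurable_apply (fun l => if l.state ∈ C.1 then (1 : ℝ) else 0)
          t).aestronglyMeasurable) (integrable_const _) (fun t => ae_of_all _ fun ω => ?_) ?_
      · split_ifs <;> simp
      · filter_upwards [hlim] with ω hω
        exact tendsto_const_nhds.congr' (hω.mono fun t ht => ht.2.symm)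
    refine h1.congr fun T => ?_
    have := σ.setIntegral_state E T fun s => if s ∈ C.1 then 1 else 0
    rw [this]
    simp [ite_mul, Finset.sum_ite_mem]

/-- Superharmonic functions decrease in expectation along a play. -/
lemma sum_mul_probState_le {u : S → ℝ} (hu : ∀ a, ∑ s, G.p a s * u s ≤ u (G.st a)) (T : ℕ) :
    ∑ s, u s * σ.probState Set.univ T s ≤ u G.init := by
  have hub : ∀ s, |u s| ≤ ∑ s, |u s| := fun s =>
    Finset.single_le_sum (f := fun s => |u s|) (fun _ _ => abs_nonneg _) (Finset.mem_univ s)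
  have e : ∀ T, ∑ s, u s * σ.probState Set.univ T s = ∫ ω, u (ω T).state ∂σ.measure := fun T => by
    rw [← σ.setIntegral_state, Measure.restrict_univ]
  rw [e]
  induction T with
  | zero =>
    have : ∫ ω, u (ω 0).state ∂σ.measure = ∫ ω, u G.init ∂σ.measure := by
      refine integral_congr_ae ?_
      filter_upwards [σ.ae_start G.init] with ω hω
      simp only [hω.1]
    rw [this]
    simp
  | succ T ih =>
    refine le_trans ?_ ih
    have h := (σ.play G.init).integral_mul_next T (F := fun _ => 1) measurable_const (c := 1)
      (by simp) (ψ := fun l => u l.state) (fun l => hub l.state)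
    simp only [one_mul] at h
    have e1 : ∫ ω, u (ω (T + 1)).state ∂σ.measure =
        ∫ ω, ∑ s', G.p (ω T).act s' * u s' ∂σ.measure := by
      simp_rw [← σ.avg_state G.init u]
      exact h
    rw [e1]
    refine integral_mono_ae (integrable_of_fintype (fun l => ∑ s', G.p l.act s' * u s')
      (fun l => abs_le_rewardBound (fun a => ∑ s', G.p a s' * u s') l.act) T _)
      (integrable_of_fintype (fun l => u l.state) (fun l => hub l.state) T _) ?_
    filter_upwards [σ.ae_st_act G.init] with ω hω
    exact (hu _).trans_eq (by rw [hω])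

open scoped Classical in
/-- A limit of the distributions of the state at late times is reached by a transient flow. -/
lemma exists_transient_flow {φ : ℕ → ℕ} {y : S → ℝ}
    (hy : ∀ s, Tendsto (fun k => σ.probState Set.univ (φ k) s) atTop (𝓝 (y s))) :
    ∃ c : A → ℝ, (∀ a, 0 ≤ c a) ∧ ∀ s, (if s = G.init then 1 else 0) + ∑ a, c a * G.p a s =
      ∑ a ∈ G.act s, c a + y s := by
  -- Expected numbers of visits may be infinite, so the flow is obtained by duality. The test
  -- functions are superharmonic, and such a function has expectation at most its initial value at
  -- all times, hence also in the limit.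
  obtain ⟨c, hc, e⟩ := farkas Finset.univ
    (fun (a : A) s => (if G.st a = s then 1 else 0) - G.p a s)
    (fun s => (if s = G.init then 1 else 0) - y s) (by
      intro u hu
      simp_rw [MDP.IsEndComponent.sum_indicator_sub_mul] at hu
      have h1 : ∑ s, u s * y s ≤ u G.init := by
        refine le_of_tendsto' (f := fun k => ∑ s, u s * σ.probState Set.univ (φ k) s)
          (tendsto_finsetSum _ fun s _ => (hy s).const_mul _) fun k => ?_
        exact σ.sum_mul_probState_le (fun a => sub_nonneg.1 (hu a (Finset.mem_univ a))) _
      simp_rw [mul_sub]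
      rw [Finset.sum_sub_distrib]
      simpa using h1)
  refine ⟨c, hc, fun s => ?_⟩
  have := e s
  simp_rw [mul_sub] at this
  rw [Finset.sum_sub_distrib] at this
  rw [G.sum_act]
  simp only [mul_ite, mul_one, mul_zero] at this
  linarith

variable {n : ℕ} {𝒩 : Finset (Finset (Fin n))}

/-- A strategy whose runs are classified by commitments induces a solution of the linear
program. -/
theorem exists_isFlow {r : A → Fin n → ℝ} {exp sat : Fin n → ℝ} (hexp : σ.SatisfiesExp r exp)
    (κ : (ℕ → Loc S M A) → 𝒩) (hκm : ∀ N, MeasurableSet {ω | κ ω = N})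
    (hκ : ∀ ω, ∀ i ∈ (κ ω).1, sat i ≤ lrInf (fun a => r a i) ω) :
    ∃ v : LPVars S A 𝒩, v.IsFlow G r exp sat ∧
      ∀ N, ∑ a, v.x a N = σ.measure.real {ω | κ ω = N} := by
  classical
  let E : 𝒩 → Set (ℕ → Loc S M A) := fun N => {ω | κ ω = N}
  let w : ℕ → (A × 𝒩) ⊕ (S × 𝒩) → ℝ := fun T => Sum.elim (fun q => σ.meanAct (E q.2) T q.1)
    fun q => σ.probState (E q.2) T q.1
  have hw : ∀ T, w T ∈ Set.pi Set.univ fun _ : (A × 𝒩) ⊕ (S × 𝒩) => Set.Icc (0 : ℝ) 1 := by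
    intro T q _
    rcases q with q | q
    · exact σ.meanAct_mem_Icc _ _ _
    · exact ⟨measureReal_nonneg, measureReal_le_one⟩
  -- One subsequence of times serves all frequencies and all state distributions at once.
  obtain ⟨lim, hlim, φ, hφ, hconv⟩ := (isCompact_univ_pi fun _ => isCompact_Icc).tendsto_subseq hw
  rw [tendsto_pi_nhds] at hconv
  have hφt := hφ.tendsto_atTop
  let x : A → 𝒩 → ℝ := fun a N => lim (Sum.inl (a, N))
  let ys : S → 𝒩 → ℝ := fun s N => lim (Sum.inr (s, N))
  have hx : ∀ a N, Tendsto (fun k => σ.meanAct (E N) (φ k) a) atTop (𝓝 (x a N)) :=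
    fun a N => hconv (Sum.inl (a, N))
  have hys : ∀ s N, Tendsto (fun k => σ.probState (E N) (φ k) s) atTop (𝓝 (ys s N)) :=
    fun s N => hconv (Sum.inr (s, N))
  have hsumE : ∀ P : Set (ℕ → Loc S M A), MeasurableSet P →
      ∑ N, σ.measure.real (P ∩ E N) = σ.measure.real P := by
    intro P hP
    have hu : P = ⋃ N, P ∩ E N := by ext ω; simp [E]
    conv_rhs => rw [hu]
    rw [measureReal_iUnion_fintype]
    · intro N N' hne
      refine Set.disjoint_left.2 fun ω h1 h2 => hne ?_
      have e1 : κ ω = N := h1.2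
      have e2 : κ ω = N' := h2.2
      rw [← e1, e2]
    · exact fun N => hP.inter (hκm N)
  have hst : ∀ T s, ∑ N, σ.probState (E N) T s = σ.probState Set.univ T s := by
    intro T s
    have := hsumE {ω | (ω T).state = s} (measurableSet_loc (fun l => l.state = s) T)
    simpa [probState] using this
  have hysum : ∀ s, Tendsto (fun k => σ.probState Set.univ (φ k) s) atTop
      (𝓝 (∑ N, ys s N)) := by
    intro s
    simp_rw [← hst]
    exact tendsto_finsetSum _ fun N _ => hys s N
  obtain ⟨c, hc, hflow⟩ := σ.exists_transient_flow hysum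
  refine ⟨⟨x, c, ys⟩, ⟨fun a N => (hlim (Sum.inl (a, N)) trivial).1, hc,
    fun s N => (hlim (Sum.inr (s, N)) trivial).1, fun s => ?_, ?_, fun C hC N => ?_,
    fun s N => ?_, fun i => ?_, fun C hC N i hi => ?_⟩, fun N => ?_⟩
  · convert hflow s; rfl
  · have hall : (Finset.univ.filter fun s => ∃ C, G.IsMEC C ∧ s ∈ C.1) = Finset.univ := by
      ext s; simpa using G.exists_mec s
    rw [hall]
    have h1 : Tendsto (fun k => ∑ s, σ.probState Set.univ (φ k) s) atTop
        (𝓝 (∑ s, ∑ N, ys s N)) := tendsto_finsetSum _ fun s _ => hysum s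
    simp_rw [sum_probState, probReal_univ] at h1
    exact tendsto_nhds_unique h1 tendsto_const_nhds
  · obtain ⟨q, h1, h2⟩ := σ.exists_tendsto_trap hC (E N)
    have h3 := tendsto_nhds_unique (h1.comp hφt) (tendsto_finsetSum C.2 fun a _ => hx a N)
    have h4 := tendsto_nhds_unique (h2.comp hφt) (tendsto_finsetSum C.1 fun s _ => hys s N)
    exact h4.symm.trans h3
  · have h1 : Tendsto (fun k => ∑ a, σ.meanAct (E N) (φ k) a * G.p a s -
        ∑ a ∈ G.act s, σ.meanAct (E N) (φ k) a) atTop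
        (𝓝 (∑ a, x a N * G.p a s - ∑ a ∈ G.act s, x a N)) :=
      (tendsto_finsetSum _ fun a _ => (hx a N).mul_const _).sub
        (tendsto_finsetSum _ fun a _ => hx a N)
    exact sub_eq_zero.1 (tendsto_nhds_unique h1 ((σ.tendsto_meanAct_flow (E N) s).comp hφt))
  · refine (hexp i).trans ?_
    have hun : ∫ ω, lrInf (fun a => r a i) ω ∂σ.measure =
        ∑ N, ∫ ω in E N, lrInf (fun a => r a i) ω ∂σ.measure := by
      have hu : (⋃ N, E N) = Set.univ := by ext ω; simp [E]
      rw [← setIntegral_univ, ← hu, integral_iUnion_fintype hκm]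
      · intro N N' hne
        refine Set.disjoint_left.2 fun ω h1 h2 => hne ?_
        have e1 : κ ω = N := h1
        have e2 : κ ω = N' := h2
        rw [← e1, e2]
      · exact fun N => (integrable_lrInf _ _).integrableOn
    rw [hun]
    simp only
    rw [Finset.sum_comm]
    refine Finset.sum_le_sum fun N _ => ?_
    refine (σ.setIntegral_lrInf_le hφt (fun a => hx a N) fun a => r a i).trans_eq ?_
    exact Finset.sum_congr rfl fun a _ => mul_comm _ _
  -- Fatou is applied to the reward `r - sat` cut off outside `C`. On runs of `E N` trapped in `C`
  -- its long-run value is at least 0 by the threshold; on all other runs it is 0.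
  · have h1 := σ.setIntegral_lrInf_le hφt (fun a => hx a N)
      fun a => if a ∈ C.2 then r a i - sat i else 0
    have h2 : 0 ≤ ∫ ω in E N, lrInf (fun a => if a ∈ C.2 then r a i - sat i else 0) ω
        ∂σ.measure := by
      refine integral_nonneg_of_ae ?_
      have hmem : ∀ᵐ ω ∂(σ.measure.restrict (E N)), ω ∈ E N := ae_restrict_mem (hκm N)
      filter_upwards [ae_restrict_of_ae (σ.ae_trapped G.init),
        ae_restrict_of_ae (σ.ae_st_act G.init), hmem] with ω ⟨D, hD, hω⟩ hstω hωN
      have hev := eventually_iff_of_trapped hC hD hω hstω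
      simp only [Pi.zero_apply]
      by_cases hDC : D = C
      · have hsat : sat i ≤ lrInf (fun a => r a i) ω := by
          refine hκ ω i ?_
          have : κ ω = N := hωN
          rw [this]; exact hi
        have hdiff := tendsto_runAverage_sub (ω := ω) (f := fun a => if a ∈ C.2 then r a i - sat i
          else 0) (g := fun a => r a i + (-sat i)) (by
            filter_upwards [hev] with t ht
            rw [if_pos (ht.1.2 hDC), sub_eq_add_neg])
        refine (le_lrInf_iff _ ω).2 fun b hb => ?_
        have h3 := (le_lrInf_iff _ ω).1 hsat (sat i + b / 2) (by linarith)
        have h4 := hdiff.eventually (lt_mem_nhds (show b / 2 < 0 by linarith))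
        filter_upwards [h3, h4, eventually_gt_atTop 0] with T h3 h4 hT
        rw [runAverage_add, runAverage_const ω hT] at h4
        linarith
      · refine ge_of_eq (lrInf_eq_of_tendsto ?_)
        have hdiff := tendsto_runAverage_sub (ω := ω) (f := fun a => if a ∈ C.2 then r a i - sat i
          else 0) (g := fun _ => 0) (by
            filter_upwards [hev] with t ht
            rw [if_neg fun h => hDC (ht.1.1 h)])
        have h0 : ∀ T, runAverage (fun _ : A => (0 : ℝ)) ω T = 0 := by simp [runAverage]
        simpa only [h0, sub_zero] using hdiff
    have h3 := h2.trans h1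
    simp only [ite_mul, zero_mul, Finset.sum_ite_mem, Finset.univ_inter, sub_mul,
      Finset.sum_sub_distrib] at h3
    simp only [mul_comm (x _ _)]
    linarith
  · have h1 : Tendsto (fun k => ∑ a, σ.meanAct (E N) (φ k) a) atTop (𝓝 (∑ a, x a N)) :=
      tendsto_finsetSum _ fun a _ => hx a N
    refine tendsto_nhds_unique h1 (tendsto_const_nhds.congr' ?_)
    filter_upwards [hφt.eventually (eventually_gt_atTop 0)] with k hk
    exact (σ.sum_meanAct (E N) hk).symm

open scoped Classical in
-- Runs are classified by the set of all coordinates whose threshold they meet, so that meeting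
-- threshold `i` is the disjoint union of the classes containing `i`.
theorem IsConjWitness.exists_isConjSolution {σ : Strategy G M} {r : A → Fin n → ℝ}
    {exp sat pr : Fin n → ℝ} (h : σ.IsConjWitness r exp sat pr) :
    ∃ v : LPVars S A (allSubsets n), v.IsConjSolution G r exp sat pr := by
  let κ : (ℕ → Loc S M A) → allSubsets n := fun ω =>
    ⟨Finset.univ.filter fun i => sat i ≤ lrInf (fun a => r a i) ω, Finset.mem_univ _⟩
  have hm : ∀ i, MeasurableSet {ω : ℕ → Loc S M A | sat i ≤ lrInf (fun a => r a i) ω} :=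
    fun i => measurableSet_le measurable_const (measurable_lrInf _)
  have hκm : ∀ N, MeasurableSet {ω | κ ω = N} := by
    intro N
    have : {ω | κ ω = N} = ⋂ i, {ω | sat i ≤ lrInf (fun a => r a i) ω ↔ i ∈ N.1} := by
      ext ω
      simp [κ, Subtype.ext_iff, Finset.ext_iff]
    rw [this]
    refine MeasurableSet.iInter fun i => ?_
    by_cases hi : i ∈ N.1
    · simpa [hi] using hm i
    · have : {ω : ℕ → Loc S M A | sat i ≤ lrInf (fun a => r a i) ω ↔ i ∈ N.1} =
          {ω | sat i ≤ lrInf (fun a => r a i) ω}ᶜ := by ext ω; simp [hi]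
      exact this ▸ (hm i).compl
  obtain ⟨v, hv, hsum⟩ := σ.exists_isFlow h.1 κ hκm fun ω i hi => (Finset.mem_filter.1 hi).2
  refine ⟨v, hv, fun i => (h.2 i).trans_eq ?_⟩
  have : {ω : ℕ → Loc S M A | sat i ≤ lrInf (fun a => r a i) ω} =
      ⋃ N ∈ Finset.univ.filter (fun N : allSubsets n => i ∈ N.1), {ω | κ ω = N} := by
    ext ω
    simp [κ]
  rw [this, measureReal_biUnion_finset]
  · simp only [hsum]
  · intro N _ N' _ hne
    exact Set.disjoint_left.2 fun ω h1 h2 => hne (h1.symm.trans h2)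
  · exact fun N _ => hκm N

open scoped Classical in
theorem IsJointWitness.exists_isJointSolution {σ : Strategy G M} {r : A → Fin n → ℝ}
    {exp sat : Fin n → ℝ} {pr : ℝ} (h : σ.IsJointWitness r exp sat pr) :
    ∃ v : LPVars S A (jointSubsets n), v.IsJointSolution G r exp sat pr := by
  let P : (ℕ → Loc S M A) → Prop := fun ω => ∀ i, sat i ≤ lrInf (fun a => r a i) ω
  have hP : MeasurableSet {ω | P ω} := by
    have : {ω | P ω} = ⋂ i, {ω | sat i ≤ lrInf (fun a => r a i) ω} := by ext; simp [P]
    rw [this]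
    exact MeasurableSet.iInter fun i => measurableSet_le measurable_const (measurable_lrInf _)
  let κ : (ℕ → Loc S M A) → jointSubsets n := fun ω =>
    if P ω then ⟨Finset.univ, by simp⟩ else ⟨∅, by simp⟩
  have hκm : ∀ N, MeasurableSet {ω | κ ω = N} := fun N =>
    measurableSet_preimage (mβ := ⊤) (f := κ)
      (Measurable.ite hP measurable_const measurable_const) (t := {N}) trivial
  obtain ⟨v, hv, hsum⟩ := σ.exists_isFlow h.1 κ hκm fun ω i hi => by
    by_cases hω : P ω
    · exact hω i
    · simp [κ, hω] at hi
  refine ⟨v, hv, h.2.trans ?_⟩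
  have hN : (⟨Finset.univ, by simp⟩ : jointSubsets n) ∈
      Finset.univ.filter fun N : jointSubsets n => N.1 = Finset.univ := by simp
  refine le_trans ?_ (Finset.single_le_sum (f := fun N => ∑ a, v.x a N)
    (fun N _ => Finset.sum_nonneg fun a _ => hv.x_nonneg a N) hN)
  rw [hsum]
  refine measureReal_mono fun ω hω => ?_
  simp only [κ]
  exact if_pos hω

end Strategy

/-! ### Recurrent strategies -/

/-- The sum of the squares has finite expectation, so it is almost surely finite and its terms tend
to 0. -/
lemma ae_tendsto_zero_of_summable_sq {Ω : Type*} [MeasurableSpace Ω] {μ : Measure Ω}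
    {f : ℕ → Ω → ℝ} (hf : ∀ n, Measurable (f n)) (hi : ∀ n, Integrable (fun ω => f n ω ^ 2) μ)
    {c : ℕ → ℝ} (hc : ∀ n, ∫ ω, f n ω ^ 2 ∂μ ≤ c n) (hs : Summable c) :
    ∀ᵐ ω ∂μ, Tendsto (fun n => f n ω) atTop (𝓝 0) := by
  have hm : ∀ n, Measurable fun ω => ENNReal.ofReal (f n ω ^ 2) :=
    fun n => ((hf n).pow_const 2).ennreal_ofReal
  have hlt : ∫⁻ ω, ∑' n, ENNReal.ofReal (f n ω ^ 2) ∂μ ≠ ⊤ := by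
    rw [lintegral_tsum fun n => (hm n).aemeasurable]
    refine ne_top_of_le_ne_top hs.tsum_ofReal_ne_top (ENNReal.tsum_le_tsum fun n => ?_)
    rw [← ofReal_integral_eq_lintegral_ofReal (hi n) (ae_of_all _ fun ω => sq_nonneg _)]
    exact ENNReal.ofReal_le_ofReal (hc n)
  filter_upwards [ae_lt_top (Measurable.tsum hm) hlt] with ω hω
  have h1 := ENNReal.tendsto_atTop_zero_of_tsum_ne_top hω.ne
  have h2 := (ENNReal.tendsto_toReal ENNReal.zero_ne_top).comp h1
  simp only [Function.comp_def, ENNReal.toReal_zero, ENNReal.toReal_ofReal (sq_nonneg _)] at h2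
  have h3 := h2.sqrt
  simp only [Real.sqrt_sq_eq_abs, Real.sqrt_zero] at h3
  exact (tendsto_zero_iff_abs_tendsto_zero _).2 h3

/-- Every growth rate is dominated along a sufficiently slow reparametrisation. -/
lemma exists_slow (B : ℕ → ℕ) : ∃ J : ℕ → ℕ, Monotone J ∧ Tendsto J atTop atTop ∧
    ∀ k, B (J k) ≤ B 0 + k := by
  -- `J k` is the largest `j ≤ k` with `B j ≤ B 0 + k`; the value `j = 0` always qualifies.
  refine ⟨fun k => Nat.findGreatest (fun j => B j ≤ B 0 + k) k, fun k l h => ?_, ?_, fun k => ?_⟩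
  · exact Nat.findGreatest_mono (fun j (hj : B j ≤ B 0 + k) => hj.trans (by omega)) h
  · refine tendsto_atTop.2 fun j => ?_
    filter_upwards [eventually_ge_atTop (max j (B j))] with k hk
    exact Nat.le_findGreatest ((le_max_left _ _).trans hk)
      (((le_max_right _ _).trans hk).trans (by omega))
  · exact Nat.findGreatest_spec (P := fun j => B j ≤ B 0 + k) (Nat.zero_le k) (by omega)

/-- Summation by parts leaves two boundary terms and the changes of `h (J t)`. A change costs at
most `2 * B (J T)` and happens only when `J` jumps, thus at most `J T` times. -/
lemma abs_sum_telescope_le {X : Type*} {h : ℕ → X → ℝ} {B : ℕ → ℝ} (hB : Monotone B)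
    (hh : ∀ j a, |h j a| ≤ B j) {J : ℕ → ℕ} (hJ : Monotone J) (α : ℕ → X) (T : ℕ) :
    |∑ t ∈ Finset.range T, (h (J (t + 1)) (α t) - h (J (t + 1)) (α (t + 1)))| ≤
      2 * B (J T) * (1 + J T) := by
  by_cases hX : Nonempty X
  swap
  · exact (hX ⟨α 0⟩).elim
  have hB0 : ∀ j, 0 ≤ B j := fun j => (abs_nonneg _).trans (hh j hX.some)
  have e : ∀ T, ∑ t ∈ Finset.range T, (h (J (t + 1)) (α t) - h (J (t + 1)) (α (t + 1))) =
      h (J 0) (α 0) - h (J T) (α T) +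
        ∑ t ∈ Finset.range T, (h (J (t + 1)) (α t) - h (J t) (α t)) := by
    intro T
    induction T with
    | zero => simp
    | succ T ih => rw [Finset.sum_range_succ, ih, Finset.sum_range_succ]; ring
  have h1 : ∀ t ≤ T, ∀ a, |h (J t) a| ≤ B (J T) := fun t ht a => (hh _ a).trans (hB (hJ ht))
  have h2 : ∑ t ∈ Finset.range T, |h (J (t + 1)) (α t) - h (J t) (α t)| ≤
      ∑ t ∈ Finset.range T, 2 * B (J T) * ((J (t + 1) : ℝ) - J t) := by
    refine Finset.sum_le_sum fun t ht => ?_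
    have ht := Finset.mem_range.1 ht
    rcases (hJ (Nat.le_succ t)).eq_or_lt with hj | hj
    · simp [hj]
    · have h3 : (1 : ℝ) ≤ (J (t + 1) : ℝ) - J t := by
        have : J t + 1 ≤ J (t + 1) := hj
        have : (J t : ℝ) + 1 ≤ J (t + 1) := by exact_mod_cast this
        linarith
      calc _ ≤ |h (J (t + 1)) (α t)| + |h (J t) (α t)| := abs_sub _ _
        _ ≤ 2 * B (J T) * 1 := by linarith [h1 (t + 1) ht (α t), h1 t ht.le (α t)]
        _ ≤ _ := mul_le_mul_of_nonneg_left h3 (by linarith [hB0 (J T)])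
  rw [← Finset.mul_sum, Finset.sum_range_sub (fun t => (J t : ℝ))] at h2
  have h3 := Finset.abs_sum_le_sum_abs (fun t => h (J (t + 1)) (α t) - h (J t) (α t))
    (Finset.range T)
  have h4 : 2 * B (J T) * ((J T : ℝ) - J 0) ≤ 2 * B (J T) * J T :=
    mul_le_mul_of_nonneg_left (by linarith [Nat.cast_nonneg (α := ℝ) (J 0)])
      (by linarith [hB0 (J T)])
  rw [e]
  have h5 := abs_le.1 (h1 0 (Nat.zero_le _) (α 0))
  have h6 := abs_le.1 (h1 T le_rfl (α T))
  have h7 := abs_le.1 (h3.trans (h2.trans h4))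
  rw [abs_le]
  constructor <;> nlinarith

/-- For monotone `u` the ratio can be interpolated between consecutive fourth powers, since `(n + 1)
^ 4 / n ^ 4` tends to 1. -/
lemma tendsto_div_of_subseq_pow_four {u : ℕ → ℝ} (hu : Monotone u) {l : ℝ}
    (h : Tendsto (fun n : ℕ => u (n ^ 4) / ((n ^ 4 : ℕ) : ℝ)) atTop (𝓝 l)) :
    Tendsto (fun n => u n / n) atTop (𝓝 l) := by
  refine tendsto_div_of_monotone_of_exists_subseq_tendsto_div u l hu fun a ha =>
    ⟨fun n => n ^ 4, ?_, tendsto_pow_atTop (by norm_num), h⟩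
  have h1 : Tendsto (fun n : ℕ => (1 + 1 / (n : ℝ)) ^ 4) atTop (𝓝 ((1 + 0) ^ 4)) :=
    (tendsto_one_div_atTop_nhds_zero_nat.const_add 1).pow 4
  filter_upwards [h1.eventually (gt_mem_nhds (show ((1 : ℝ) + 0) ^ 4 < a by simpa using ha)),
    eventually_gt_atTop 0] with n hn hn0
  have : (n : ℝ) ≠ 0 := by positivity
  have e : ((n + 1 : ℕ) : ℝ) = (1 + 1 / (n : ℝ)) * n := by push_cast; field_simp
  rw [Nat.cast_pow, Nat.cast_pow, e, mul_pow]
  exact mul_le_mul_of_nonneg_right hn.le (by positivity)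

/-! ### Moves proportional to a circulation -/

namespace MDP

variable {S A : Type*} [Fintype S] [Fintype A] (G : MDP S A)

open scoped Classical in
/-- Choose an action of the state `s` with probability proportional to `w`. -/
noncomputable def pick (w : A → ℝ) (s : S) : PMF A :=
  if h : ∑' a, (if a ∈ G.act s then ENNReal.ofReal (w a) else 0) ≠ 0 then
    PMF.normalize _ h (by
      rw [tsum_fintype]
      exact ENNReal.sum_ne_top.2 fun a _ => by split_ifs <;> simp)
  else PMF.pure (G.act_nonempty s).choose

omit [Fintype S] in
lemma st_eq_of_mem_support_pick {w : A → ℝ} {s : S} {a : A} (h : a ∈ (G.pick w s).support) :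
    G.st a = s := by
  classical
  refine G.mem_act.1 ?_
  unfold pick at h
  split_ifs at h with hs
  · rw [PMF.mem_support_normalize_iff] at h
    by_contra hcon
    exact h (if_neg hcon)
  · rw [PMF.support_pure, Set.mem_singleton_iff] at h
    exact h ▸ (G.act_nonempty s).choose_spec

omit [Fintype S] in
-- The product form also holds in states of total weight zero, where `pick` takes a default action.
lemma pick_mul {w : A → ℝ} (hw : ∀ a, 0 ≤ w a) (a : A) :
    (G.pick w (G.st a) a).toReal * ∑ b ∈ G.act (G.st a), w b = w a := by
  classical
  have hsum : ∑' b, (if b ∈ G.act (G.st a) then ENNReal.ofReal (w b) else 0) =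
      ENNReal.ofReal (∑ b ∈ G.act (G.st a), w b) := by
    rw [tsum_fintype, ENNReal.ofReal_sum_of_nonneg fun b _ => hw b, Finset.sum_ite_mem,
      Finset.univ_inter]
  unfold pick
  split_ifs with hs
  · rw [PMF.normalize_apply, hsum, if_pos (G.mem_act.2 rfl), ENNReal.toReal_mul,
      ENNReal.toReal_inv, ENNReal.toReal_ofReal (hw a),
      ENNReal.toReal_ofReal (Finset.sum_nonneg fun b _ => hw b)]
    rw [hsum, ENNReal.ofReal_ne_zero_iff] at hs
    field_simp
  · rw [not_not, hsum, ENNReal.ofReal_eq_zero] at hs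
    have h0 := le_antisymm hs (Finset.sum_nonneg fun b _ => hw b)
    rw [h0, mul_zero]
    exact ((Finset.sum_eq_zero_iff_of_nonneg fun b _ => hw b).1 h0 a (G.mem_act.2 rfl)).symm

omit [Fintype S] in
lemma pos_of_mem_support_pick {w : A → ℝ} (hw : ∀ a, 0 ≤ w a) {s : S}
    (hs : 0 < ∑ b ∈ G.act s, w b) {a : A} (h : a ∈ (G.pick w s).support) : 0 < w a := by
  obtain rfl := G.st_eq_of_mem_support_pick h
  rw [← G.pick_mul hw a]
  exact mul_pos (ENNReal.toReal_pos h ((G.pick w _).apply_ne_top a)) hs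

variable {G}

/-- There is a circulation which is positive on exactly the actions of the MECs. -/
lemma exists_mec_circulation : ∃ z : A → ℝ, (∀ a, 0 ≤ z a) ∧
    (∀ a, 0 < z a ↔ a ∈ (G.mec (G.st a)).2) ∧
    ∀ s, ∑ a, z a * G.p a s = ∑ a ∈ G.act s, z a := by
  have hex : ∀ C, ∃ z : A → ℝ, G.IsMEC C → (∀ a ∈ C.2, 0 < z a) ∧ (∀ a ∉ C.2, z a = 0) ∧
      ∀ s, ∑ a, z a * G.p a s = ∑ a ∈ G.act s, z a := by
    intro C
    by_cases hC : G.IsMEC C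
    · exact hC.prop.exists_pos_circulation.imp fun z hz _ => hz
    · exact ⟨0, fun h => (hC h).elim⟩
  choose z hz using hex
  have hpos := fun s => (hz _ (isMEC_mec s)).1
  have hzero := fun s => (hz _ (isMEC_mec s)).2.1
  have hcirc := fun s => (hz _ (isMEC_mec s)).2.2
  refine ⟨fun a => z (G.mec (G.st a)) a, fun a => ?_, fun a => ?_, fun s => ?_⟩
  · by_cases h : a ∈ (G.mec (G.st a)).2
    · exact (hpos _ a h).le
    · exact (hzero _ a h).ge
  · refine ⟨fun h => ?_, hpos _ a⟩
    by_contra hcon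
    exact h.ne' (hzero _ a hcon)
  · have h1 : ∀ a, z (G.mec (G.st a)) a * G.p a s = z (G.mec s) a * G.p a s := by
      intro a
      by_cases hp : 0 < G.p a s
      swap
      · rw [le_antisymm (not_lt.1 hp) (G.p_nonneg a s), mul_zero, mul_zero]
      by_cases h : a ∈ (G.mec (G.st a)).2
      · rw [(isMEC_mec (G.st a)).mec_eq ((isMEC_mec (G.st a)).prop.succ_mem h hp)]
      · rw [hzero _ a h]
        by_cases h' : a ∈ (G.mec s).2
        · exact absurd ((isMEC_mec s).mem_snd_iff.1 h').1 h
        · rw [hzero _ a h']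
    simp_rw [h1]
    rw [hcirc s s]
    exact Finset.sum_congr rfl fun a ha => by rw [G.mem_act.1 ha]

/-- The chain of actions obtained by choosing actions proportionally to a circulation. -/
noncomputable def actStep (G : MDP S A) (w : A → ℝ) (a b : A) : ℝ :=
  G.p a (G.st b) * (G.pick w (G.st b) b).toReal

lemma sum_pick_mul_eq (w h : A → ℝ) (a : A) :
    ∑ s, G.p a s * ∑ b, (G.pick w s b).toReal * h b = ∑ b, G.actStep w a b * h b := by
  classical
  simp_rw [Finset.mul_sum]
  rw [Finset.sum_comm]
  refine Finset.sum_congr rfl fun b _ => ?_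
  rw [Finset.sum_eq_single (G.st b) (fun s _ hs => ?_) (by simp), actStep, mul_assoc]
  have : G.pick w s b = 0 := by
    by_contra hcon
    exact hs (G.st_eq_of_mem_support_pick ((PMF.mem_support_iff _ _).2 hcon)).symm
  rw [this]
  simp

section Circulation

variable {w : A → ℝ} {C : Finset S × Finset A} (hw : ∀ a, 0 < w a ↔ a ∈ (G.mec (G.st a)).2)
  (hw0 : ∀ a, 0 ≤ w a) (hcirc : ∀ s, ∑ a, w a * G.p a s = ∑ a ∈ G.act s, w a) (hC : G.IsMEC C)

include hw hC in
lemma pos_of_mem_mec {a : A} (ha : a ∈ C.2) : 0 < w a := (hw a).2 (hC.mem_snd_iff.1 ha).1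

include hw hw0 hC in
lemma sum_act_pos {s : S} (hs : s ∈ C.1) (hne : C.2.Nonempty) : 0 < ∑ b ∈ G.act s, w b := by
  obtain ⟨a, ha, has⟩ := hC.prop.exists_action hne hs
  exact Finset.sum_pos' (fun _ _ => hw0 _) ⟨a, G.mem_act.2 has, pos_of_mem_mec hw hC ha⟩

include hw hw0 hC in
lemma pick_pos {a : A} (ha : a ∈ C.2) : 0 < (G.pick w (G.st a) a).toReal := by
  refine pos_of_mul_pos_left ?_ (sum_act_pos hw hw0 hC (hC.prop.st_mem ha) ⟨a, ha⟩).le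
  rw [G.pick_mul hw0]
  exact pos_of_mem_mec hw hC ha

include hw hw0 hC in
lemma actStep_eq_zero {a b : A} (ha : a ∈ C.2) (hb : b ∉ C.2) : G.actStep w a b = 0 := by
  by_contra hcon
  have hp : 0 < G.p a (G.st b) :=
    (G.p_nonneg _ _).lt_of_ne fun h => hcon (by rw [actStep, ← h, zero_mul])
  have hst := hC.prop.succ_mem ha hp
  refine hb (hC.mem_snd_iff.2 ⟨(hw b).1 ?_, hC.mec_eq hst⟩)
  refine G.pos_of_mem_support_pick hw0 (sum_act_pos hw hw0 hC hst ⟨a, ha⟩) (s := G.st b) ?_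
  rw [PMF.mem_support_iff]
  exact fun h => hcon (by rw [actStep, h]; simp)

include hw hw0 hcirc hC in
-- Conservation at `G.st b`, distributed over its actions by `pick_mul`. Actions outside `C` do not
-- contribute: a positive weight puts them in another MEC, which they cannot leave.
lemma sum_mul_actStep {b : A} (hb : b ∈ C.2) : ∑ a ∈ C.2, w a * G.actStep w a b = w b := by
  rw [Finset.sum_subset (Finset.subset_univ _)]
  · simp_rw [actStep, ← mul_assoc]
    rw [← Finset.sum_mul, hcirc, mul_comm, G.pick_mul hw0]
  · intro a _ ha
    by_contra hcon
    have h1 : 0 < w a := (hw0 a).lt_of_ne fun h => hcon (by rw [← h, zero_mul])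
    have hp : 0 < G.p a (G.st b) :=
      (G.p_nonneg _ _).lt_of_ne fun h => hcon (by rw [actStep, ← h, zero_mul, mul_zero])
    have h2 := (hw a).1 h1
    have h3 := (isMEC_mec (G.st a)).prop.succ_mem h2 hp
    refine ha (hC.mem_snd_iff.2 ⟨h2, ?_⟩)
    exact (isMEC_mec _).eq_of_mem hC h3 (hC.prop.st_mem hb)

include hw hw0 hcirc hC in
open scoped Classical in
/-- A Poisson equation for the frequency of the action `b`. -/
lemma exists_poisson_action {b : A} (hb : b ∈ C.2) : ∃ h : A → ℝ, ∀ a ∈ C.2,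
    h a - ∑ b, G.actStep w a b * h b = (if a = b then 1 else 0) - w b / ∑ a ∈ C.2, w a := by
  have hpos : 0 < ∑ a ∈ C.2, w a :=
    Finset.sum_pos (fun a ha => pos_of_mem_mec hw hC ha) ⟨b, hb⟩
  have hext : ∀ f : A → ℝ, ∑ a : {a // a ∈ C.2}, f a = ∑ a ∈ C.2, f a :=
    fun f => Finset.sum_coe_sort C.2 f
  obtain ⟨h, hh⟩ := exists_poisson (ι := {a // a ∈ C.2}) (Q := fun a b => G.actStep w a b)
    (fun a b => mul_nonneg (G.p_nonneg _ _) ENNReal.toReal_nonneg)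
    (hC.prop.irreducible (q := fun b => (G.pick w (G.st b) b).toReal)
      fun a ha => pick_pos hw hw0 hC ha)
    (x := fun a => w a) (fun a => pos_of_mem_mec hw hC a.2)
    (fun b => by
      rw [hext fun a => w a * G.actStep w a b]
      exact (sum_mul_actStep hw hw0 hcirc hC b.2).symm)
    (g := fun a => (if (a : A) = b then 1 else 0) - w b / ∑ a ∈ C.2, w a) (by
      rw [hext fun a => w a * ((if a = b then 1 else 0) - w b / ∑ a ∈ C.2, w a)]
      simp_rw [mul_sub]
      rw [Finset.sum_sub_distrib, ← Finset.sum_mul]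
      simp only [mul_ite, mul_one, mul_zero, Finset.sum_ite_eq', hb, if_true]
      field_simp
      simp)
  -- The values outside `C` are irrelevant, because the chain of actions never leaves `C`.
  refine ⟨fun a => if ha : a ∈ C.2 then h ⟨a, ha⟩ else 0, fun a ha => ?_⟩
  beta_reduce
  rw [← hh ⟨a, ha⟩, dif_pos ha]
  congr 1
  rw [← Finset.sum_subset (Finset.subset_univ C.2), ← Finset.sum_coe_sort]
  · exact Finset.sum_congr rfl fun c _ => by rw [dif_pos c.2]
  · intro c _ hc
    rw [actStep_eq_zero hw hw0 hC ha hc, zero_mul]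

end Circulation

end MDP

/-! ### Frequencies of proportional strategies with slowly changing weights -/

namespace Strategy

variable {S A : Type*} [Fintype S] [Fintype A] {G : MDP S A}

lemma toReal_bind_apply {X Y : Type*} [Fintype X] (q : PMF X) (f : X → PMF Y) (y : Y) :
    (q.bind f y).toReal = ∑ x, (q x).toReal * (f x y).toReal := by
  rw [PMF.bind_apply, tsum_fintype, ENNReal.toReal_sum fun x _ =>
    ENNReal.mul_ne_top (q.apply_ne_top x) ((f x).apply_ne_top y)]
  simp_rw [ENNReal.toReal_mul]

/-- The expectation of a function of the next action of a strategy with a step counter. -/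
lemma avg_act {σ : Strategy G ℕ} (hσ : σ.IsMarkov) (s : S) (h : A → ℝ) (l : Loc S ℕ A) :
    (σ.play s).avg (fun l => h l.act) l =
      ∑ s', G.p l.act s' * ∑ a, (σ.next s' (l.mem + 1) a).toReal * h a := by
  have e : ((σ.play s).trans l).map Loc.act =
      (G.δ l.act).bind fun s' => σ.next s' (l.mem + 1) := by
    simp only [play, hσ.2, PMF.pure_bind, PMF.map_bind, PMF.map_comp]
    congr 1
    funext s'
    exact PMF.map_id _
  rw [MarkovChain.avg, integral_comp_pmf _ Loc.act h, e]
  simp_rw [toReal_bind_apply, Finset.sum_mul, Finset.mul_sum]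
  rw [Finset.sum_comm]
  simp_rw [mul_assoc]
  rfl

/-- The step counter of a Markov strategy. -/
lemma IsMarkov.ae_mem {σ : Strategy G ℕ} (hσ : σ.IsMarkov) (s : S) :
    ∀ᵐ ω ∂σ.measureFrom s, ∀ t, (ω t).mem = t := by
  filter_upwards [σ.ae_start s, σ.ae_step s] with ω h0 h t
  induction t with
  | zero => simpa [hσ.1] using h0.2.1
  | succ t ih => simpa [hσ.2, ih] using (h t).2.1

/-- The Markov strategy which chooses actions proportionally to `w k` in step `k`. -/
noncomputable def proportional (G : MDP S A) (w : ℕ → A → ℝ) : Strategy G ℕ where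
  update _ _ k := PMF.pure (k + 1)
  next s k := G.pick (w k) s
  next_enabled _ _ _ h := G.mem_act.2 (G.st_eq_of_mem_support_pick h)
  init := PMF.pure 0

omit [Fintype S] in
lemma isMarkov_proportional (w : ℕ → A → ℝ) : (proportional G w).IsMarkov :=
  ⟨rfl, fun _ _ _ => rfl⟩

section Convergence

variable {w : ℕ → A → ℝ} (hw : ∀ k a, 0 < w k a ↔ a ∈ (G.mec (G.st a)).2)
  (hw0 : ∀ k a, 0 ≤ w k a)

include hw hw0 in
lemma support_proportional {C : Finset S × Finset A} (hC : G.IsMEC C) (hne : C.2.Nonempty) {s : S}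
    (hs : s ∈ C.1) (k : ℕ) : ((proportional G w).next s k).support ⊆ (C.2 : Set A) := by
  intro a ha
  have h1 := G.pos_of_mem_support_pick (hw0 k) (MDP.sum_act_pos (hw k) (hw0 k) hC hs hne) ha
  have h2 := G.st_eq_of_mem_support_pick ha
  exact hC.mem_snd_iff.2 ⟨(hw k a).1 h1, h2 ▸ hC.mec_eq hs⟩

include hw hw0 in
lemma ae_act_mem {C : Finset S × Finset A} (hC : G.IsMEC C) (hne : C.2.Nonempty) {s : S}
    (hs : s ∈ C.1) : ∀ᵐ ω ∂(proportional G w).measureFrom s, ∀ t, (ω t).act ∈ C.2 := by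
  filter_upwards [(proportional G w).ae_start s, (proportional G w).ae_step s] with ω h0 h t
  induction t with
  | zero => exact support_proportional hw hw0 hC hne hs _ h0.2.2
  | succ t ih =>
    exact support_proportional hw hw0 hC hne (hC.prop.succ_mem ih (h t).1) _ (h t).2.2

end Convergence

open scoped Classical in
/-- If the weights `W j` are circulations and change slowly enough along `J`, then the actions are
played with the limits of the normalised weights as frequencies. -/
lemma ae_tendsto_proportional {W : ℕ → A → ℝ} (hw : ∀ k a, 0 < W k a ↔ a ∈ (G.mec (G.st a)).2)
    (hw0 : ∀ k a, 0 ≤ W k a) {C : Finset S × Finset A} (hC : G.IsMEC C) {b : A} (hb : b ∈ C.2)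
    {H : ℕ → A → ℝ} (hH : ∀ j, ∀ a ∈ C.2, H j a - ∑ a', G.actStep (W j) a a' * H j a' =
      (if a = b then 1 else 0) - W j b / ∑ a ∈ C.2, W j a)
    {B : ℕ → ℕ} (hB : Monotone B) (hBH : ∀ j a, |H j a| ≤ B j) (hBj : ∀ j, j + 1 ≤ B j)
    {J : ℕ → ℕ} (hJ : Monotone J) (hJt : Tendsto J atTop atTop) {c : ℕ}
    (hBJ : ∀ k, B (J k) ^ 4 ≤ c + k) {q : ℝ}
    (hq : Tendsto (fun j => W j b / ∑ a ∈ C.2, W j a) atTop (𝓝 q)) {s : S} (hs : s ∈ C.1) :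
    ∀ᵐ ω ∂(proportional G fun k => W (J k)).measureFrom s,
      Tendsto (fun T : ℕ => (∑ t ∈ Finset.range T, ({b} : Set A).indicator (1 : A → ℝ) (ω t).act) /
        (T : ℝ)) atTop (𝓝 q) := by
  set σ := proportional G fun k => W (J k) with hσ
  have hmark : σ.IsMarkov := isMarkov_proportional _
  -- The action at time `t + 1` is chosen with the counter `t + 1`, hence the Poisson solution for
  -- the weights `W (J (t + 1))`.
  let ψ : ℕ → Loc S ℕ A → ℝ := fun t l => H (J (t + 1)) l.act
  have hψ : ∀ t l, |ψ t l| ≤ (fun t => (B (J (t + 1)) : ℝ)) t := fun t l => hBH _ _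
  have hBsq : ∀ n : ℕ, 0 < n → (B (J (n ^ 4)) : ℝ) ^ 2 ≤ (c + 1) * n ^ 2 := by
    intro n hn
    have h1 : ((B (J (n ^ 4)) : ℝ)) ^ 4 ≤ c + n ^ 4 := by exact_mod_cast hBJ (n ^ 4)
    have h2 : (1 : ℝ) ≤ (n : ℝ) ^ 4 := one_le_pow₀ (by exact_mod_cast hn)
    refine (pow_le_pow_iff_left₀ (by positivity) (by positivity) two_ne_zero).1 ?_
    nlinarith [Nat.cast_nonneg (α := ℝ) c, mul_nonneg (Nat.cast_nonneg (α := ℝ) c)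
      (sub_nonneg.2 h2)]
  have hfl : ∀ᵐ ω ∂σ.measureFrom s,
      Tendsto (fun n : ℕ => (σ.play s).fluct ψ (n ^ 4) ω / ((n ^ 4 : ℕ) : ℝ)) atTop (𝓝 0) := by
    -- There are `n ^ 4` differences with squares at most `4 (c + 1) n ^ 2`; division by `n ^ 8`
    -- leaves a multiple of `1 / n ^ 2`. The restriction to fourth powers makes this summable.
    refine ae_tendsto_zero_of_summable_sq (c := fun n => 4 * (c + 1) * (1 / (n : ℝ) ^ 2))
      (fun n => ((σ.play s).measurable_fluct ψ _).div_const _) (fun n => ?_) (fun n => ?_) ?_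
    · have hm : Measurable fun ω => ((σ.play s).fluct ψ (n ^ 4) ω / ((n ^ 4 : ℕ) : ℝ)) ^ 2 :=
        (((σ.play s).measurable_fluct ψ _).div_const _).pow_const 2
      refine Integrable.of_bound hm.aestronglyMeasurable
        (((∑ t ∈ Finset.range (n ^ 4), 2 * (B (J (t + 1)) : ℝ)) / ((n ^ 4 : ℕ) : ℝ)) ^ 2)
        (ae_of_all _ fun ω => ?_)
      rw [Real.norm_eq_abs, abs_pow, abs_div, abs_of_nonneg (Nat.cast_nonneg (α := ℝ) (n ^ 4))]
      gcongr
      exact (σ.play s).abs_fluct_le hψ (n ^ 4) ω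
    · simp_rw [div_pow]
      rw [integral_div]
      rcases Nat.eq_zero_or_pos n with rfl | hn
      · simp
      have h1 : ∑ t ∈ Finset.range (n ^ 4), (2 * (B (J (t + 1)) : ℝ)) ^ 2 ≤
          ∑ t ∈ Finset.range (n ^ 4), 4 * ((c + 1) * (n : ℝ) ^ 2) := by
        refine Finset.sum_le_sum fun t ht => ?_
        have h2 : (B (J (t + 1)) : ℝ) ≤ B (J (n ^ 4)) := by
          exact_mod_cast hB (hJ (Finset.mem_range.1 ht))
        have h3 := hBsq n hn
        have h4 : (B (J (t + 1)) : ℝ) ^ 2 ≤ (B (J (n ^ 4)) : ℝ) ^ 2 := by gcongr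
        nlinarith
      have h2 := ((σ.play s).integral_fluct_sq_le hψ (n ^ 4)).trans h1
      rw [Finset.sum_const, Finset.card_range, nsmul_eq_mul] at h2
      have hn' : (0 : ℝ) < n := by exact_mod_cast hn
      rw [div_le_iff₀ (by positivity)]
      refine h2.trans_eq ?_
      push_cast
      field_simp
    · exact (Real.summable_one_div_nat_pow.2 (by norm_num)).mul_left _
  filter_upwards [hfl, hmark.ae_mem s, ae_act_mem (fun k => hw (J k)) (fun k => hw0 (J k)) hC
    ⟨b, hb⟩ hs] with ω hω hmem hact
  refine tendsto_div_of_subseq_pow_four ?_ ?_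
  · refine monotone_nat_of_le_succ fun n => ?_
    rw [Finset.sum_range_succ]
    exact le_add_of_nonneg_right (Set.indicator_nonneg (fun _ _ => zero_le_one) _)
  -- The Poisson equation at time `t` writes the indicator of `b` as martingale difference plus
  -- telescoping term plus target frequency.
  have hid : ∀ T, ∑ t ∈ Finset.range T, ({b} : Set A).indicator (1 : A → ℝ) (ω t).act =
      (σ.play s).fluct ψ T ω +
        ∑ t ∈ Finset.range T, (H (J (t + 1)) (ω t).act - H (J (t + 1)) (ω (t + 1)).act) +
        ∑ t ∈ Finset.range T, W (J (t + 1)) b / ∑ a ∈ C.2, W (J (t + 1)) a := by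
    intro T
    rw [MarkovChain.fluct, ← Finset.sum_add_distrib, ← Finset.sum_add_distrib]
    refine Finset.sum_congr rfl fun t _ => ?_
    have h1 := hH (J (t + 1)) _ (hact t)
    have h2 : (σ.play s).avg (ψ t) (ω t) =
        ∑ a', G.actStep (W (J (t + 1))) (ω t).act a' * H (J (t + 1)) a' := by
      rw [← MDP.sum_pick_mul_eq, avg_act hmark, hmem]
      rfl
    rw [h2]
    simp only [ψ, Set.indicator_apply, Set.mem_singleton_iff, Pi.one_apply]
    linarith
  have herr : Tendsto (fun n : ℕ => (∑ t ∈ Finset.range (n ^ 4),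
      (H (J (t + 1)) (ω t).act - H (J (t + 1)) (ω (t + 1)).act)) / ((n ^ 4 : ℕ) : ℝ)) atTop
      (𝓝 0) := by
    -- The telescoping bound `2 B (1 + J)` is at most `2 B ^ 2` because `j + 1 ≤ B j`, thus of order
    -- `n ^ 2` against `n ^ 4`.
    refine squeeze_zero_norm' (a := fun n : ℕ => 2 * (c + 1) * (1 / (n : ℝ) ^ 2)) ?_ ?_
    · filter_upwards [eventually_gt_atTop 0] with n hn
      have h1 := abs_sum_telescope_le (h := H) (B := fun j => (B j : ℝ))
        (fun i j h => Nat.cast_le.2 (hB h)) hBH hJ (fun t => (ω t).act) (n ^ 4)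
      have h2 : (1 + J (n ^ 4) : ℝ) ≤ B (J (n ^ 4)) := by
        have := hBj (J (n ^ 4))
        rw [add_comm]
        exact_mod_cast this
      have h3 := hBsq n hn
      have hn' : (0 : ℝ) < n := by exact_mod_cast hn
      rw [Real.norm_eq_abs, abs_div, abs_of_nonneg (Nat.cast_nonneg (α := ℝ) (n ^ 4)),
        div_le_iff₀ (by positivity)]
      have h4 : 2 * (c + 1) * (1 / (n : ℝ) ^ 2) * ((n ^ 4 : ℕ) : ℝ) = 2 * ((c + 1) * n ^ 2) := by
        push_cast; field_simp
      rw [h4]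
      refine h1.trans ?_
      have : (0 : ℝ) ≤ B (J (n ^ 4)) := Nat.cast_nonneg _
      nlinarith
    · have := (tendsto_one_div_atTop_nhds_zero_nat (𝕜 := ℝ)).pow 2
      simp only [one_div, inv_pow, ne_eq, OfNat.ofNat_ne_zero, not_false_eq_true, zero_pow] at this
      simpa only [one_div, mul_zero] using this.const_mul (2 * ((c : ℝ) + 1))
  have hces : Tendsto (fun n : ℕ => (∑ t ∈ Finset.range (n ^ 4),
      W (J (t + 1)) b / ∑ a ∈ C.2, W (J (t + 1)) a) / ((n ^ 4 : ℕ) : ℝ)) atTop (𝓝 q) := by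
    have h1 := ((hq.comp (hJt.comp (tendsto_add_atTop_nat 1))).cesaro).comp
      (tendsto_pow_atTop (α := ℕ) (n := 4) (by norm_num))
    refine h1.congr fun n => ?_
    simp [Function.comp_def, inv_mul_eq_div]
  have := (hω.add herr).add hces
  simp only [zero_add] at this
  refine this.congr fun n => ?_
  rw [hid]
  ring

end Strategy

open scoped Classical in
/-- Every nonnegative circulation admits recurrent strategies. -/
theorem exists_areRecurrent {S A : Type*} [Fintype S] [Fintype A] {G : MDP S A} {n : ℕ}
    {𝒩 : Finset (Finset (Fin n))} {x : A → 𝒩 → ℝ} (hx : ∀ a N, 0 ≤ x a N)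
    (hcirc : ∀ s N, ∑ a, x a N * G.p a s = ∑ a ∈ G.act s, x a N) :
    ∃ ξ : 𝒩 → Strategy G ℕ, AreRecurrent x ξ := by
  obtain ⟨z, hz0, hz, hzc⟩ := MDP.exists_mec_circulation (G := G)
  suffices h : ∀ N, ∃ ξ : Strategy G ℕ, ξ.IsMarkov ∧ ∀ C, G.IsMEC C → 0 < ∑ b ∈ C.2, x b N →
      (∀ s ∈ C.1, ∀ k, (ξ.next s k).support ⊆ (C.2 : Set A)) ∧
      ∀ s ∈ C.1, ∀ᵐ ω ∂ξ.measureFrom s, ∀ a ∈ C.2, freq a ω = x a N / ∑ b ∈ C.2, x b N by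
    choose ξ hξ using h
    exact ⟨ξ, hξ⟩
  intro N
  -- The vanishing perturbation makes every action of a MEC possible, while the normalised weights
  -- still tend to those of `x`.
  let W : ℕ → A → ℝ := fun j a => x a N + z a * (1 / ((j : ℝ) + 1))
  have hε : ∀ j : ℕ, (0 : ℝ) < 1 / ((j : ℝ) + 1) := fun j => by positivity
  have hW0 : ∀ j a, 0 ≤ W j a := fun j a => add_nonneg (hx a N) (mul_nonneg (hz0 a) (hε j).le)
  have hW : ∀ j a, 0 < W j a ↔ a ∈ (G.mec (G.st a)).2 := by
    refine fun j a => ⟨fun h => ?_, fun h => ?_⟩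
    · by_contra hcon
      have h1 : z a = 0 := le_antisymm (not_lt.1 fun h => hcon ((hz a).1 h)) (hz0 a)
      have h2 : x a N = 0 := le_antisymm (not_lt.1 fun h => hcon
        (MDP.mem_mec_of_circulation (fun a => hx a N) (fun s => hcirc s N) h)) (hx a N)
      simp [W, h1, h2] at h
    · exact add_pos_of_nonneg_of_pos (hx a N) (mul_pos ((hz a).2 h) (hε j))
  have hWc : ∀ j s, ∑ a, W j a * G.p a s = ∑ a ∈ G.act s, W j a := by
    intro j s
    simp only [W, add_mul, Finset.sum_add_distrib, hcirc, mul_right_comm (z _)]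
    rw [← Finset.sum_mul, hzc, Finset.sum_mul]
  have hH : ∀ j b, ∃ h : A → ℝ, ∀ C, G.IsMEC C → b ∈ C.2 → ∀ a ∈ C.2,
      h a - ∑ a', G.actStep (W j) a a' * h a' =
        (if a = b then 1 else 0) - W j b / ∑ a ∈ C.2, W j a := by
    intro j b
    by_cases h : ∃ C, G.IsMEC C ∧ b ∈ C.2
    · obtain ⟨C, hC, hb⟩ := h
      obtain ⟨h, hh⟩ := MDP.exists_poisson_action (hW j) (hW0 j) (hWc j) hC hb
      refine ⟨h, fun D hD hbD => ?_⟩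
      have : D = C := by rw [← (hC.mem_snd_iff.1 hb).2, (hD.mem_snd_iff.1 hbD).2]
      rw [this]
      exact hh
    · exact ⟨0, fun C hC hb => (h ⟨C, hC, hb⟩).elim⟩
  choose H hH using hH
  -- The cumulative sum makes `B` monotone, the summand 1 gives `j + 1 ≤ B j`, and the ceiling
  -- dominates the Poisson solutions of all target actions.
  let B : ℕ → ℕ := fun j => ∑ i ∈ Finset.range (j + 1), (1 + ⌈∑ b, ∑ a, |H i b a|⌉₊)
  have hB : Monotone B := fun i j hij =>
    Finset.sum_le_sum_of_subset (Finset.range_mono (by omega))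
  have hBj : ∀ j, j + 1 ≤ B j := fun j => by
    have : ∑ i ∈ Finset.range (j + 1), 1 ≤ B j := Finset.sum_le_sum fun i _ => by omega
    simpa using this
  have hBH : ∀ b j a, |H j b a| ≤ B j := by
    intro b j a
    have h1 : |H j b a| ≤ ∑ b, ∑ a, |H j b a| :=
      (Finset.single_le_sum (f := fun a => |H j b a|) (fun _ _ => abs_nonneg _)
        (Finset.mem_univ a)).trans (Finset.single_le_sum (f := fun b => ∑ a, |H j b a|)
          (fun _ _ => Finset.sum_nonneg fun _ _ => abs_nonneg _) (Finset.mem_univ b))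
    have h2 : ⌈∑ b, ∑ a, |H j b a|⌉₊ ≤ B j :=
      (Nat.le_add_left _ 1).trans (Finset.single_le_sum
        (f := fun i => 1 + ⌈∑ b, ∑ a, |H i b a|⌉₊) (fun _ _ => Nat.zero_le _)
        (Finset.self_mem_range_succ j))
    exact (h1.trans (Nat.le_ceil _)).trans (by exact_mod_cast h2)
  obtain ⟨J, hJ, hJt, hBJ⟩ := exists_slow fun j => B j ^ 4
  refine ⟨Strategy.proportional G fun k => W (J k), Strategy.isMarkov_proportional _,
    fun C hC hpos => ?_⟩
  have hne : C.2.Nonempty := by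
    by_contra hcon
    rw [Finset.not_nonempty_iff_eq_empty.1 hcon, Finset.sum_empty] at hpos
    exact lt_irrefl _ hpos
  refine ⟨fun s hs k => Strategy.support_proportional (fun k => hW (J k)) (fun k => hW0 (J k))
    hC hne hs k, fun s hs => ?_⟩
  have hlim : ∀ a, Tendsto (fun j => W j a) atTop (𝓝 (x a N)) := fun a => by
    simpa [W] using (tendsto_one_div_add_atTop_nhds_zero_nat.const_mul (z a)).const_add (x a N)
  have hall : ∀ b ∈ C.2, ∀ᵐ ω ∂(Strategy.proportional G fun k => W (J k)).measureFrom s,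
      freq b ω = x b N / ∑ b ∈ C.2, x b N := by
    intro b hb
    filter_upwards [Strategy.ae_tendsto_proportional hW hW0 hC hb (fun j => hH j b C hC hb) hB
      (hBH b) hBj hJ hJt hBJ ((hlim b).div (tendsto_finsetSum _ fun a _ => hlim a) hpos.ne') hs]
      with ω hω
    exact lrInf_eq_of_tendsto hω
  rw [← Finset.eventually_all] at hall
  exact hall

/-! ### Switching strategies from lifted flows -/

namespace Strategy

variable {S A : Type*} {G : MDP S A} {n : ℕ} {𝒩 : Finset (Finset (Fin n))} {M₀ : Type*}

section Def

variable [Fintype A]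

/-- The strategy which moves proportionally to the flow `f` and updates its memory by `U`, until
`U` tells it to continue as some `ξ N`. -/
noncomputable def switching (U : A → M₀ → M₀ ⊕ 𝒩) (f : A → M₀ → ℝ) (m₀ : M₀)
    (ξ : 𝒩 → Strategy G ℕ) : Strategy G (M₀ ⊕ 𝒩 × ℕ) where
  update a s m := match m with
    | Sum.inl m => PMF.pure ((U a m).map id fun N => (N, 0))
    | Sum.inr (N, k) => ((ξ N).update a s k).map fun j => Sum.inr (N, j)
  next s m := match m with
    | Sum.inl m => G.pick (fun a => f a m) s
    | Sum.inr (N, k) => (ξ N).next s k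
  next_enabled s m := match m with
    | Sum.inl _ => fun _ h => G.mem_act.2 (G.st_eq_of_mem_support_pick h)
    | Sum.inr (N, k) => (ξ N).next_enabled s k
  init := PMF.pure (Sum.inl m₀)

variable {U : A → M₀ → M₀ ⊕ 𝒩} {f : A → M₀ → ℝ} {m₀ : M₀} {ξ : 𝒩 → Strategy G ℕ}

lemma isDeterministicUpdate_switching (hξ : ∀ N, (ξ N).IsMarkov) :
    (switching U f m₀ ξ).IsDeterministicUpdate := by
  refine ⟨⟨_, rfl⟩, fun a s m => ?_⟩
  rcases m with m | ⟨N, k⟩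
  · exact ⟨_, rfl⟩
  · refine ⟨Sum.inr (N, k + 1), ?_⟩
    simp [switching, (hξ N).2, PMF.pure_map]

end Def

variable [Fintype S] [Fintype A] [Fintype M₀] {U : A → M₀ → M₀ ⊕ 𝒩} {f : A → M₀ → ℝ} {m₀ : M₀}
  {ξ : 𝒩 → Strategy G ℕ}

/-- The probability that in step `t` the action `a` is played with memory `m`. -/
noncomputable def occ (ρ : Strategy G (M₀ ⊕ 𝒩 × ℕ)) (t : ℕ) (a : A) (m : M₀) : ℝ :=
  ρ.measure.real {ω | (ω t).act = a ∧ (ω t).mem = Sum.inl m}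

lemma ae_toMeasure_of_support {X : Type*} [MeasurableSpace X] [DiscreteMeasurableSpace X]
    (q : PMF X) {P : X → Prop} (h : ∀ x ∈ q.support, P x) : ∀ᵐ x ∂q.toMeasure, P x := by
  rw [ae_iff, PMF.toMeasure_apply_eq_zero_iff _ (MeasurableSet.of_discrete)]
  exact Set.disjoint_left.2 fun x hx hx' => hx' (h x hx)

open scoped Classical in
-- A copy of some ξ_N is never left again, so only pairs with memory in `M₀` lead to `(b, m)`.
-- Written as a matrix row, the formula integrates to `occ_succ`.
lemma avg_switching (s : S) (b : A) (m : M₀) (l : Loc S (M₀ ⊕ 𝒩 × ℕ) A) :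
    ((switching U f m₀ ξ).play s).avg
      (fun l => if l.act = b ∧ l.mem = Sum.inl m then 1 else 0) l =
    ∑ a, ∑ m', (if l.act = a ∧ l.mem = Sum.inl m' then 1 else 0) *
      (if U a m' = Sum.inl m then G.actStep (fun a => f a m) a b else 0) := by
  set ρ := switching U f m₀ ξ with hρ
  have hsupp := fun l' (h : l' ∈ ((ρ.play s).trans l).support) => ρ.mem_support_trans.1 h
  obtain ⟨s₁, m₁ | ⟨N, k⟩, a₁⟩ := l
  · have hmem : ∀ l' ∈ ((ρ.play s).trans ⟨s₁, Sum.inl m₁, a₁⟩).support,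
        l'.mem = (U a₁ m₁).map id fun N => (N, 0) := by
      intro l' h
      have h2 := (hsupp l' h).2.1
      simp only [hρ, switching, PMF.support_pure, Set.mem_singleton_iff] at h2
      exact h2
    rw [Finset.sum_eq_single a₁ (fun a _ ha => by simp [Ne.symm ha]) (by simp),
      Finset.sum_eq_single m₁ (fun a _ ha => by simp [Ne.symm ha]) (by simp)]
    simp only [and_self, if_true, one_mul]
    split_ifs with hU
    · have hae : ∀ᵐ l' ∂((ρ.play s).trans ⟨s₁, Sum.inl m₁, a₁⟩).toMeasure,
          (if l'.act = b ∧ l'.mem = Sum.inl m then (1 : ℝ) else 0) =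
            (fun a => if a = b then 1 else 0) l'.act := by
        refine ae_toMeasure_of_support _ fun l' h => ?_
        simp [hmem l' h, hU]
      have e : ((ρ.play s).trans ⟨s₁, Sum.inl m₁, a₁⟩).map Loc.act =
          (G.δ a₁).bind fun s' => G.pick (fun a => f a m) s' := by
        simp only [hρ, play, switching, hU, Sum.map_inl, id_eq, PMF.pure_bind, PMF.map_bind,
          PMF.map_comp]
        congr 1
        funext s'
        exact PMF.map_id _
      rw [MarkovChain.avg, integral_congr_ae hae,
        integral_comp_pmf _ Loc.act (fun a => if a = b then (1 : ℝ) else 0), e]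
      have h1 := MDP.sum_pick_mul_eq (G := G) (fun a => f a m) (fun a => if a = b then 1 else 0) a₁
      simp only [mul_ite, mul_one, mul_zero, Finset.sum_ite_eq', Finset.mem_univ, if_true] at h1 ⊢
      rw [← h1, toReal_bind_apply]
      rfl
    · have hae : ∀ᵐ l' ∂((ρ.play s).trans ⟨s₁, Sum.inl m₁, a₁⟩).toMeasure,
          (if l'.act = b ∧ l'.mem = Sum.inl m then (1 : ℝ) else 0) = 0 := by
        refine ae_toMeasure_of_support _ fun l' h => if_neg fun h' => hU ?_
        have h3 := (hmem l' h).symm.trans h'.2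
        cases hU' : U a₁ m₁ <;> simp_all
      rw [MarkovChain.avg, integral_congr_ae hae, integral_zero]
  · have hae : ∀ᵐ l' ∂((ρ.play s).trans ⟨s₁, Sum.inr (N, k), a₁⟩).toMeasure,
        (if l'.act = b ∧ l'.mem = Sum.inl m then (1 : ℝ) else 0) = 0 := by
      refine ae_toMeasure_of_support _ fun l' h => if_neg fun h' => ?_
      have h2 := (hsupp l' h).2.1
      simp only [hρ, switching, PMF.mem_support_map_iff] at h2
      obtain ⟨j, _, hj⟩ := h2
      rw [h'.2] at hj
      cases hj
    rw [MarkovChain.avg, integral_congr_ae hae, integral_zero]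
    simp

open scoped Classical in
lemma occ_succ (t : ℕ) (b : A) (m : M₀) : (switching U f m₀ ξ).occ (t + 1) b m =
    ∑ a, ∑ m', if U a m' = Sum.inl m then
      (switching U f m₀ ξ).occ t a m' * G.actStep (fun a => f a m) a b else 0 := by
  have e : ∀ t b m, (switching U f m₀ ξ).occ t b m =
      ∫ ω, (if (ω t).act = b ∧ (ω t).mem = Sum.inl m then (1 : ℝ) else 0)
        ∂(switching U f m₀ ξ).measure := by
    intro t b m
    have := integral_indicator_one (μ := (switching U f m₀ ξ).measure)
      (measurableSet_loc (fun l : Loc S (M₀ ⊕ 𝒩 × ℕ) A => l.act = b ∧ l.mem = Sum.inl m) t)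
    rw [occ, ← this]
    refine integral_congr_ae (ae_of_all _ fun ω => ?_)
    simp only [Set.indicator_apply, Pi.one_apply]
    rfl
  have hb : ∀ (b : A) (m : M₀) (l : Loc S (M₀ ⊕ 𝒩 × ℕ) A),
      |(if l.act = b ∧ l.mem = Sum.inl m then (1 : ℝ) else 0)| ≤ 1 := by
    intro b m l
    split_ifs <;> simp
  have h := ((switching U f m₀ ξ).play G.init).integral_mul_next t (F := fun _ => 1)
    measurable_const (c := 1) (by simp) (hb b m)
  simp only [one_mul] at h
  rw [e, measure, measureFrom, h]
  simp_rw [avg_switching]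
  have hi : ∀ a m', Integrable (fun ω : ℕ → Loc S (M₀ ⊕ 𝒩 × ℕ) A =>
      (if (ω t).act = a ∧ (ω t).mem = Sum.inl m' then (1 : ℝ) else 0) *
      (if U a m' = Sum.inl m then G.actStep (fun a => f a m) a b else 0))
      ((switching U f m₀ ξ).play G.init).runMeasure := fun a m' =>
    (integrable_of_fintype (fun l => if l.act = a ∧ l.mem = Sum.inl m' then (1 : ℝ) else 0)
      (hb a m') t _).mul_const _
  rw [integral_finsetSum _ fun a _ => integrable_finsetSum _ fun m' _ => hi a m']
  refine Finset.sum_congr rfl fun a _ => ?_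
  rw [integral_finsetSum _ fun m' _ => hi a m']
  refine Finset.sum_congr rfl fun m' _ => ?_
  rw [integral_mul_const, e, mul_ite, mul_zero]
  rfl

open scoped Classical in
lemma occ_zero (b : A) (m : M₀) : (switching U f m₀ ξ).occ 0 b m =
    (if G.st b = G.init ∧ m = m₀ then 1 else 0) * (G.pick (fun a => f a m) (G.st b) b).toReal := by
  set ρ := switching U f m₀ ξ with hρ
  have hst := ρ.ae_start G.init
  have hms : ∀ ω : ℕ → Loc S (M₀ ⊕ 𝒩 × ℕ) A, (ω 0).mem ∈ ρ.init.support →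
      (ω 0).mem = Sum.inl m₀ := fun ω h => by
    simpa [hρ, switching, PMF.support_pure] using h
  split_ifs with h
  · obtain ⟨h1, rfl⟩ := h
    have e : {ω : ℕ → Loc S (M₀ ⊕ 𝒩 × ℕ) A | (ω 0).act = b ∧ (ω 0).mem = Sum.inl m}
        =ᵐ[ρ.measure] {ω | ω 0 = ⟨G.init, Sum.inl m, b⟩} := by
      filter_upwards [hst] with ω hω
      refine propext ⟨fun h => ?_, fun h => ?_⟩
      · have h' : (ω 0).act = b ∧ (ω 0).mem = Sum.inl m := h
        change ω 0 = _
        rw [← hω.1, ← h'.1, ← h'.2]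
      · have h' : ω 0 = _ := h
        change (ω 0).act = b ∧ (ω 0).mem = Sum.inl m
        rw [h']
        exact ⟨rfl, rfl⟩
    have e2 : (ρ.play G.init).init ⟨G.init, Sum.inl m, b⟩ = G.pick (fun a => f a m) G.init b := by
      have hinj : Function.Injective fun a : A => (⟨G.init, Sum.inl m, a⟩ :
          Loc S (M₀ ⊕ 𝒩 × ℕ) A) := fun a a' h => by simpa using h
      simp only [hρ, play, switching, PMF.pure_bind]
      rw [PMF.map_apply, tsum_eq_single b fun a ha => if_neg fun h => ha (hinj h).symm, if_pos rfl]
    rw [occ, measureReal_congr e, one_mul, h1, ← e2, measureReal_def, measure, measureFrom,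
      MarkovChain.measure_zero_eq]
  · rw [zero_mul, occ, measureReal_def, ENNReal.toReal_eq_zero_iff]
    left
    rw [measure_eq_zero_iff_ae_notMem]
    filter_upwards [hst, ρ.ae_st_act G.init] with ω hω hs hcon
    obtain ⟨h1, h2⟩ : (ω 0).act = b ∧ (ω 0).mem = Sum.inl m := hcon
    refine h ⟨by rw [← h1, hs 0, hω.1], ?_⟩
    have := hms ω hω.2.1
    rw [h2] at this
    exact Sum.inl_injective this

end Strategy

lemma sum_comm_pairs {X Y Z W : Type*} [Fintype X] [Fintype Y] [Fintype Z] [Fintype W]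
    (F : X → Y → Z → W → ℝ) :
    ∑ x, ∑ y, ∑ z, ∑ w, F x y z w = ∑ z, ∑ w, ∑ y, ∑ x, F x y z w := by
  have h := Finset.sum_comm (s := (Finset.univ : Finset (X × Y)))
    (t := (Finset.univ : Finset (Z × W))) (f := fun p q => F p.1 p.2 q.1 q.2)
  simp only [Fintype.sum_prod_type] at h
  rw [h]
  exact Finset.sum_congr rfl fun z _ => Finset.sum_congr rfl fun w _ => Finset.sum_comm

lemma MDP.sum_actStep {S A : Type*} [Fintype S] [Fintype A] {G : MDP S A} (w : A → ℝ) (a : A) :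
    ∑ b, G.actStep w a b = 1 := by
  have h := G.sum_pick_mul_eq w (fun _ => 1) a
  have h1 : ∀ s, ∑ b, (G.pick w s b).toReal = 1 := fun s => by
    have := (G.pick w s).tsum_coe
    rw [tsum_fintype] at this
    rw [← ENNReal.toReal_sum fun b _ => (G.pick w s).apply_ne_top b, this, ENNReal.toReal_one]
  simp only [mul_one, h1, G.sum_p] at h
  exact h.symm

/-! ### Flows on actions with memory, and expected visits -/

section LiftedFlow

variable {S A : Type*} [Fintype S] [Fintype A] {n : ℕ} {𝒩 : Finset (Finset (Fin n))} {M₀ : Type*}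
  [Fintype M₀]

open scoped Classical in
/-- A flow on actions with memory, which starts with a unit in the initial state with memory `m₀`
and is lost where `U` leaves `M₀`. -/
structure IsLiftedFlow (G : MDP S A) (U : A → M₀ → M₀ ⊕ 𝒩) (m₀ : M₀) (f : A → M₀ → ℝ) :
    Prop where
  nonneg : ∀ a m, 0 ≤ f a m
  conservation : ∀ s m, (if s = G.init ∧ m = m₀ then 1 else 0) +
    ∑ a, ∑ m', (if U a m' = Sum.inl m then f a m' * G.p a s else 0) = ∑ a ∈ G.act s, f a m

namespace IsLiftedFlow

variable {G : MDP S A} {U : A → M₀ → M₀ ⊕ 𝒩} {f : A → M₀ → ℝ} {m₀ : M₀} {ξ : 𝒩 → Strategy G ℕ}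
  (hf : IsLiftedFlow G U m₀ f)

include hf

/-- The total loss of the flow. -/
lemma sum_loss : ∑ a, ∑ m, (if (U a m).isRight then f a m else 0) = 1 := by
  classical
  have h1 : ∑ s, ∑ m, ((if s = G.init ∧ m = m₀ then (1 : ℝ) else 0) +
      ∑ a, ∑ m', (if U a m' = Sum.inl m then f a m' * G.p a s else 0)) =
      ∑ s, ∑ m, ∑ a ∈ G.act s, f a m :=
    Finset.sum_congr rfl fun s _ => Finset.sum_congr rfl fun m _ => hf.conservation s m
  have h2 : ∑ s, ∑ m, (if s = G.init ∧ m = m₀ then (1 : ℝ) else 0) = 1 := by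
    rw [Finset.sum_eq_single G.init (fun s _ hs => by simp [hs]) (by simp)]
    simp
  have h3 : ∑ s, ∑ m, ∑ a ∈ G.act s, f a m = ∑ a, ∑ m, f a m := by
    simp_rw [Finset.sum_comm (s := Finset.univ) (t := G.act _)]
    exact G.sum_sum_act fun a => ∑ m, f a m
  -- Summed over all states and memories, a pair that stays in `M₀` returns its whole flow; only the
  -- lossy pairs balance the unit source.
  have h4 : ∑ s, ∑ m, ∑ a, ∑ m', (if U a m' = Sum.inl m then f a m' * G.p a s else 0) =
      ∑ a, ∑ m', (if (U a m').isRight then 0 else f a m') := by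
    rw [sum_comm_pairs]
    refine Finset.sum_congr rfl fun a _ => Finset.sum_congr rfl fun m' _ => ?_
    rcases hU : U a m' with m | N
    · simp [Sum.inl.injEq, ← Finset.mul_sum, G.sum_p]
    · simp
  simp_rw [Finset.sum_add_distrib] at h1
  rw [h2, h3, h4] at h1
  rw [eq_sub_of_add_eq h1, ← Finset.sum_sub_distrib]
  refine Finset.sum_congr rfl fun a _ => ?_
  rw [← Finset.sum_sub_distrib]
  refine Finset.sum_congr rfl fun m _ => ?_
  split_ifs <;> simp

open scoped Classical in
-- Multiplying conservation by the move probability makes `f` a fixed point of the recursion that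
-- generates the expected visits.
lemma eq_occ_zero_add (b : A) (m : M₀) : f b m = (Strategy.switching U f m₀ ξ).occ 0 b m +
    ∑ a, ∑ m', if U a m' = Sum.inl m then f a m' * G.actStep (fun a => f a m) a b else 0 := by
  rw [Strategy.occ_zero, ← G.pick_mul (w := fun a => f a m) (fun a => hf.nonneg a m) b,
    ← hf.conservation, mul_add, mul_comm]
  congr 1
  simp_rw [Finset.mul_sum]
  refine Finset.sum_congr rfl fun a _ => Finset.sum_congr rfl fun m' _ => ?_
  split_ifs
  · rw [MDP.actStep]; ring
  · simp

open scoped Classical in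
lemma sub_sum_occ_succ (T : ℕ) (b : A) (m : M₀) :
    f b m - ∑ t ∈ Finset.range (T + 1), (Strategy.switching U f m₀ ξ).occ t b m =
    ∑ a, ∑ m', if U a m' = Sum.inl m then
      (f a m' - ∑ t ∈ Finset.range T, (Strategy.switching U f m₀ ξ).occ t a m') *
        G.actStep (fun a => f a m) a b else 0 := by
  have h : ∑ t ∈ Finset.range T, (Strategy.switching U f m₀ ξ).occ (t + 1) b m =
      ∑ a, ∑ m', if U a m' = Sum.inl m then
      (∑ t ∈ Finset.range T, (Strategy.switching U f m₀ ξ).occ t a m') *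
        G.actStep (fun a => f a m) a b else 0 := by
    simp_rw [Strategy.occ_succ]
    rw [Finset.sum_comm]
    refine Finset.sum_congr rfl fun a _ => ?_
    rw [Finset.sum_comm]
    refine Finset.sum_congr rfl fun m' _ => ?_
    split_ifs
    · rw [Finset.sum_mul]
    · simp
  rw [Finset.sum_range_succ', h, hf.eq_occ_zero_add (ξ := ξ) b m]
  rw [add_comm (∑ a, _), add_sub_add_left_eq_sub, ← Finset.sum_sub_distrib]
  refine Finset.sum_congr rfl fun a _ => ?_
  rw [← Finset.sum_sub_distrib]
  refine Finset.sum_congr rfl fun m' _ => ?_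
  split_ifs
  · ring
  · simp

/-- The expected visits are the least nonnegative solution of this recursion. The inequality can be
strict, as `f` may contain cycles that are never entered. -/
lemma sum_occ_le (T : ℕ) (b : A) (m : M₀) :
    ∑ t ∈ Finset.range T, (Strategy.switching U f m₀ ξ).occ t b m ≤ f b m := by
  classical
  rw [← sub_nonneg]
  induction T generalizing b m with
  | zero => simpa using hf.nonneg b m
  | succ T ih =>
    rw [hf.sub_sum_occ_succ]
    refine Finset.sum_nonneg fun a _ => Finset.sum_nonneg fun m' _ => ?_
    split_ifs
    · exact mul_nonneg (ih a m') (mul_nonneg (G.p_nonneg _ _) ENNReal.toReal_nonneg)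
    · exact le_rfl

/-- Where the flow is lost, it is the expected number of visits. -/
lemma hasSum_occ {b : A} {m : M₀} (hU : (U b m).isRight) :
    HasSum (fun t => (Strategy.switching U f m₀ ξ).occ t b m) (f b m) := by
  classical
  set d : ℕ → A → M₀ → ℝ := fun T a m =>
    f a m - ∑ t ∈ Finset.range T, (Strategy.switching U f m₀ ξ).occ t a m with hd
  have hd0 : ∀ T a m, 0 ≤ d T a m := fun T a m => sub_nonneg.2 (hf.sum_occ_le T a m)
  have hD : ∀ T, ∑ a, ∑ m, d (T + 1) a m =
      ∑ a, ∑ m, d T a m - ∑ a, ∑ m, (if (U a m).isRight then d T a m else 0) := by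
    intro T
    have h1 : ∑ b, ∑ m, d (T + 1) b m = ∑ b, ∑ m, ∑ a, ∑ m', if U a m' = Sum.inl m then
        d T a m' * G.actStep (fun a => f a m) a b else 0 :=
      Finset.sum_congr rfl fun b _ => Finset.sum_congr rfl fun m _ => hf.sub_sum_occ_succ T b m
    rw [h1, sum_comm_pairs, ← Finset.sum_sub_distrib]
    refine Finset.sum_congr rfl fun a _ => ?_
    rw [← Finset.sum_sub_distrib]
    refine Finset.sum_congr rfl fun m' _ => ?_
    rcases hU : U a m' with m | N
    · simp [← Finset.mul_sum, MDP.sum_actStep]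
    · simp
  -- The total of `d` falls in each step by exactly its part on the lossy pairs, and it is bounded
  -- below; so that part tends to 0, and a strict inequality is impossible there.
  have hanti : Antitone fun T => ∑ a, ∑ m, d T a m := antitone_nat_of_succ_le fun T => by
    rw [hD, sub_le_self_iff]
    refine Finset.sum_nonneg fun a _ => Finset.sum_nonneg fun m _ => ?_
    split_ifs
    exacts [hd0 _ _ _, le_rfl]
  have hbdd : BddBelow (Set.range fun T => ∑ a, ∑ m, d T a m) :=
    ⟨0, by
      rintro _ ⟨T, rfl⟩
      exact Finset.sum_nonneg fun a _ => Finset.sum_nonneg fun m _ => hd0 _ _ _⟩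
  have hlim := tendsto_atTop_ciInf hanti hbdd
  have hdiff := hlim.sub (hlim.comp (tendsto_add_atTop_nat 1))
  rw [sub_self] at hdiff
  have hzero : Tendsto (fun T => d T b m) atTop (𝓝 0) := by
    refine squeeze_zero (fun T => hd0 T b m) (fun T => ?_) hdiff
    simp only [Function.comp_apply]
    rw [hD, sub_sub_cancel]
    have h1 : ∀ a m, 0 ≤ (if (U a m).isRight then d T a m else 0) := fun a m => by
      split_ifs
      exacts [hd0 _ _ _, le_rfl]
    calc d T b m = if (U b m).isRight then d T b m else 0 := by rw [if_pos hU]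
      _ ≤ ∑ m, (if (U b m).isRight then d T b m else 0) :=
        Finset.single_le_sum (f := fun m => if (U b m).isRight then d T b m else 0)
          (fun m _ => h1 b m) (Finset.mem_univ m)
      _ ≤ _ := Finset.single_le_sum
          (f := fun b => ∑ m, if (U b m).isRight then d T b m else 0)
          (fun b _ => Finset.sum_nonneg fun m _ => h1 b m) (Finset.mem_univ b)
  refine (hasSum_iff_tendsto_nat_of_nonneg (fun t => measureReal_nonneg) _).2 ?_
  have := hzero.const_sub (f b m)
  simp only [hd, sub_sub_cancel, sub_zero] at this
  exact this

end IsLiftedFlow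

end LiftedFlow

lemma measurableSet_hasFreq {S M A : Type*} [Countable A] (q : A → ℝ) :
    MeasurableSet {ω : ℕ → Loc S M A | HasFreq q ω} := by
  have : {ω : ℕ → Loc S M A | HasFreq q ω} = ⋂ a, {ω | Tendsto
      (fun T => runAverage (({a} : Set A).indicator 1) ω T) atTop (𝓝 (q a))} := by
    ext ω; simp [HasFreq]
  rw [this]
  exact MeasurableSet.iInter fun a => measurableSet_tendsto _ fun T => measurable_runAverage _ T

open scoped Classical in
/-- The frequencies `x_{a,N} / ∑_{b ∈ C} x_{b,N}` of the actions of `C`. -/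
noncomputable def normFreq {S A : Type*} {n : ℕ} {𝒩 : Finset (Finset (Fin n))} (x : A → 𝒩 → ℝ)
    (C : Finset S × Finset A) (N : 𝒩) (a : A) : ℝ :=
  if a ∈ C.2 then x a N / ∑ b ∈ C.2, x b N else 0

/-- The prescribed limit inferiors sum to 1, so they are genuine limits and determine all long-run
averages. -/
lemma AreRecurrent.ae_hasFreq {S A : Type*} [Fintype S] [Fintype A] {G : MDP S A} {n : ℕ}
    {𝒩 : Finset (Finset (Fin n))} {x : A → 𝒩 → ℝ} {ξ : 𝒩 → Strategy G ℕ} (h : AreRecurrent x ξ)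
    {N : 𝒩} {C : Finset S × Finset A} (hC : G.IsMEC C) (hpos : 0 < ∑ b ∈ C.2, x b N) {s : S}
    (hs : s ∈ C.1) : ∀ᵐ ω ∂(ξ N).measureFrom s, HasFreq (normFreq x C N) ω := by
  filter_upwards [((h N).2 C hC hpos).2 s hs] with ω hω
  refine hasFreq_of_freq (q := normFreq x C N) (B := C.2) (fun a ha => if_neg ha) ?_ fun a ha => ?_
  · have : ∑ a ∈ C.2, normFreq x C N a = ∑ a ∈ C.2, x a N / ∑ b ∈ C.2, x b N :=
      Finset.sum_congr rfl fun a ha => if_pos ha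
    rw [this, ← Finset.sum_div, div_self hpos.ne']
  · rw [hω a ha, normFreq, if_pos ha]

/-! ### Runs of a switching strategy -/

namespace IsLiftedFlow

variable {S A : Type*} [Fintype S] [Fintype A] {n : ℕ} {𝒩 : Finset (Finset (Fin n))} {M₀ : Type*}
  [Fintype M₀] {G : MDP S A} {U : A → M₀ → M₀ ⊕ 𝒩} {f : A → M₀ → ℝ} {m₀ : M₀}
  {ξ : 𝒩 → Strategy G ℕ}

/-- The action `a` is played at some time with memory `m`. -/
def Visits (a : A) (m : M₀) (ω : ℕ → Loc S (M₀ ⊕ 𝒩 × ℕ) A) : Prop :=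
  ∃ t, (ω t).act = a ∧ (ω t).mem = Sum.inl m

omit [Fintype S] [Fintype A] [Fintype M₀] in
lemma measurableSet_visits (a : A) (m : M₀) :
    MeasurableSet {ω : ℕ → Loc S (M₀ ⊕ 𝒩 × ℕ) A | Visits a m ω} := by
  have : {ω : ℕ → Loc S (M₀ ⊕ 𝒩 × ℕ) A | Visits a m ω} =
      ⋃ t, {ω | (ω t).act = a ∧ (ω t).mem = Sum.inl m} := by
    ext ω; simp [Visits]
  rw [this]
  exact MeasurableSet.iUnion fun t =>
    Strategy.measurableSet_loc (fun l => l.act = a ∧ l.mem = Sum.inl m) t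

/-- After the switch, the memory is the one of the chosen strategy. -/
lemma ae_switch : ∀ᵐ ω ∂(Strategy.switching U f m₀ ξ).measure, ∀ t m N,
    (ω t).mem = Sum.inl m → U (ω t).act m = Sum.inr N → (ω (t + 1)).mem = Sum.inr (N, 0) ∧
      ∀ i, ∃ k, (ω (t + 1 + i)).mem = Sum.inr (N, k) := by
  filter_upwards [(Strategy.switching U f m₀ ξ).ae_step G.init] with ω h t m N hm hU
  have h0 : (ω (t + 1)).mem = Sum.inr (N, 0) := by
    have := (h t).2.1
    rw [hm] at this
    simpa [Strategy.switching, hU, PMF.support_pure] using this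
  refine ⟨h0, fun i => ?_⟩
  induction i with
  | zero => exact ⟨0, h0⟩
  | succ i ih =>
    obtain ⟨k, hk⟩ := ih
    have := (h (t + 1 + i)).2.1
    rw [hk] at this
    simp only [Strategy.switching, PMF.mem_support_map_iff] at this
    obtain ⟨j, _, hj⟩ := this
    exact ⟨j, hj.symm⟩

/-- The flow is lost only once on a run. -/
lemma ae_visits_unique : ∀ᵐ ω ∂(Strategy.switching U f m₀ ξ).measure, ∀ t t' m m',
    (ω t).mem = Sum.inl m → (ω t').mem = Sum.inl m' → (U (ω t).act m).isRight →
      (U (ω t').act m').isRight → t = t' := by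
  filter_upwards [ae_switch (U := U) (f := f) (m₀ := m₀) (ξ := ξ)] with ω h
  have key : ∀ t t' m m', (ω t).mem = Sum.inl m → (ω t').mem = Sum.inl m' →
      (U (ω t).act m).isRight → t' ≤ t := by
    intro t t' m m' hm hm' hU
    obtain ⟨N, hN⟩ := Sum.isRight_iff.1 hU
    by_contra! hlt
    obtain ⟨i, rfl⟩ := Nat.exists_eq_add_of_lt hlt
    obtain ⟨k, hk⟩ := (h t m N hm hN).2 i
    rw [show t + i + 1 = t + 1 + i by ring, hk] at hm'
    cases hm'
  exact fun t t' m m' hm hm' hU hU' => le_antisymm (key _ _ _ _ hm' hm hU') (key _ _ _ _ hm hm' hU)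

variable (hf : IsLiftedFlow G U m₀ f)

include hf

/-- A lossy pair is visited at most once, so the probability of a visit is the expected number of
visits. -/
lemma measure_visits {a : A} {m : M₀} (hU : (U a m).isRight) :
    (Strategy.switching U f m₀ ξ).measure.real {ω | Visits a m ω} = f a m := by
  set μ := (Strategy.switching U f m₀ ξ).measure with hμ
  have : {ω : ℕ → Loc S (M₀ ⊕ 𝒩 × ℕ) A | Visits a m ω} =
      ⋃ t, {ω | (ω t).act = a ∧ (ω t).mem = Sum.inl m} := by
    ext ω; simp [Visits]
  rw [this, measureReal_def, measure_iUnion₀, ENNReal.tsum_toReal_eq fun t => measure_ne_top _ _]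
  · exact (hf.hasSum_occ (ξ := ξ) hU).tsum_eq
  · intro t t' hne
    change μ _ = 0
    rw [measure_eq_zero_iff_ae_notMem]
    filter_upwards [ae_visits_unique (U := U) (f := f) (m₀ := m₀) (ξ := ξ)] with ω h hcon
    obtain ⟨⟨h1, h2⟩, h3, h4⟩ := hcon
    exact hne (h t t' m m h2 h4 (by rw [h1]; exact hU) (by rw [h3]; exact hU))
  · exact fun t => (Strategy.measurableSet_loc
      (fun l => l.act = a ∧ l.mem = Sum.inl m) t).nullMeasurableSet

lemma ae_pos_of_visits : ∀ᵐ ω ∂(Strategy.switching U f m₀ ξ).measure,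
    ∀ a m, (U a m).isRight → Visits a m ω → 0 < f a m := by
  rw [ae_all_iff]
  intro a
  rw [ae_all_iff]
  intro m
  by_cases hU : (U a m).isRight
  swap
  · exact ae_of_all _ fun ω h => (hU h).elim
  rcases (hf.nonneg a m).eq_or_lt with h0 | h0
  · have h1 := hf.measure_visits (ξ := ξ) hU
    rw [← h0, measureReal_eq_zero_iff, measure_eq_zero_iff_ae_notMem] at h1
    filter_upwards [h1] with ω hω _ hv
    exact (hω hv).elim
  · exact ae_of_all _ fun _ _ _ => h0

/-- The flow is lost almost surely. -/
lemma ae_exists_visits : ∀ᵐ ω ∂(Strategy.switching U f m₀ ξ).measure,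
    ∃ a m, (U a m).isRight ∧ Visits a m ω := by
  classical
  set μ := (Strategy.switching U f m₀ ξ).measure with hμ
  let P : Finset (A × M₀) := Finset.univ.filter fun p => (U p.1 p.2).isRight
  let E : A × M₀ → Set (ℕ → Loc S (M₀ ⊕ 𝒩 × ℕ) A) := fun p => {ω | Visits p.1 p.2 ω}
  have hm : ∀ p, MeasurableSet (E p) := fun p => measurableSet_visits p.1 p.2
  have h1 : μ (⋃ p ∈ P, E p) = 1 := by
    have h2 : μ (⋃ p ∈ P, E p) = ∑ p ∈ P, μ (E p) := by
      refine measure_biUnion_finset₀ (fun p hp p' hp' hne => ?_) fun p _ => (hm p).nullMeasurableSet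
      change μ _ = 0
      rw [measure_eq_zero_iff_ae_notMem]
      filter_upwards [ae_visits_unique (U := U) (f := f) (m₀ := m₀) (ξ := ξ)] with ω h hcon
      obtain ⟨⟨t, h1, h2⟩, t', h3, h4⟩ := hcon
      have hp := (Finset.mem_filter.1 hp).2
      have hp' := (Finset.mem_filter.1 hp').2
      obtain rfl := h t t' _ _ h2 h4 (by rw [h1]; exact hp) (by rw [h3]; exact hp')
      exact hne (Prod.ext (h1.symm.trans h3) (Sum.inl_injective (h2.symm.trans h4)))
    have h3 : ∑ p ∈ P, μ.real (E p) = 1 := by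
      rw [← hf.sum_loss, ← Fintype.sum_prod_type', Finset.sum_filter]
      refine Finset.sum_congr rfl fun p _ => ?_
      split_ifs with hp
      · exact hf.measure_visits hp
      · rfl
    rw [h2, ← ENNReal.toReal_eq_one_iff, ENNReal.toReal_sum fun p _ => measure_ne_top _ _]
    exact h3
  have h2 := (prob_compl_eq_zero_iff (Finset.measurableSet_biUnion P fun p _ => hm p)).2 h1
  rw [measure_eq_zero_iff_ae_notMem] at h2
  filter_upwards [h2] with ω hω
  rw [Set.mem_compl_iff, not_not, Set.mem_iUnion₂] at hω
  obtain ⟨p, hp, hv⟩ := hω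
  exact ⟨p.1, p.2, (Finset.mem_filter.1 hp).2, hv⟩

/-- Almost every run visits exactly one lossy pair, so these pairs partition the probability space.
-/
lemma integral_eq_sum_visits {F : (ℕ → Loc S (M₀ ⊕ 𝒩 × ℕ) A) → ℝ} (c : A → M₀ → ℝ)
    (hF : ∀ᵐ ω ∂(Strategy.switching U f m₀ ξ).measure, ∀ a m, (U a m).isRight →
      Visits a m ω → F ω = c a m) :
    ∫ ω, F ω ∂(Strategy.switching U f m₀ ξ).measure =
      ∑ a, ∑ m, if (U a m).isRight then f a m * c a m else 0 := by
  classical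
  set μ := (Strategy.switching U f m₀ ξ).measure with hμ
  let H : A → M₀ → (ℕ → Loc S (M₀ ⊕ 𝒩 × ℕ) A) → ℝ := fun a m =>
    {ω | Visits a m ω}.indicator fun _ => if (U a m).isRight then c a m else (0 : ℝ)
  have hH : ∀ a m, Integrable (H a m) μ := fun a m =>
    (integrable_const _).indicator (measurableSet_visits a m)
  have hae : ∀ᵐ ω ∂μ, F ω = ∑ a, ∑ m, H a m ω := by
    filter_upwards [hF, hf.ae_exists_visits (ξ := ξ),
      ae_visits_unique (U := U) (f := f) (m₀ := m₀) (ξ := ξ)] with ω hF ⟨a, m, hU, hv⟩ huniq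
    have hz : ∀ a' m', (a', m') ≠ (a, m) → H a' m' ω = 0 := by
      intro a' m' hne
      by_cases hv' : Visits a' m' ω
      swap
      · simp only [H]
        exact Set.indicator_of_notMem (s := {ω | Visits a' m' ω}) hv' _
      simp only [H, Set.indicator_apply]
      split_ifs with h1 hU'
      · obtain ⟨t, h1, h2⟩ := hv
        obtain ⟨t', h3, h4⟩ := hv'
        obtain rfl := huniq t t' _ _ h2 h4 (by rw [h1]; exact hU) (by rw [h3]; exact hU')
        exact (hne (Prod.ext (h3.symm.trans h1) (Sum.inl_injective (h4.symm.trans h2)))).elim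
      · rfl
      · rfl
    rw [hF a m hU hv, Finset.sum_eq_single a
      (fun a' _ ha => Finset.sum_eq_zero fun m' _ => hz a' m' fun h => ha (Prod.ext_iff.1 h).1)
      (by simp), Finset.sum_eq_single m
      (fun m' _ hm => hz a m' fun h => hm (Prod.ext_iff.1 h).2) (by simp)]
    simp only [H]
    rw [Set.indicator_of_mem (show ω ∈ {ω | Visits a m ω} from hv), if_pos hU]
  rw [integral_congr_ae hae,
    integral_finsetSum _ fun a _ => integrable_finsetSum _ fun m _ => hH a m]
  refine Finset.sum_congr rfl fun a _ => ?_
  rw [integral_finsetSum _ fun m _ => hH a m]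
  refine Finset.sum_congr rfl fun m _ => ?_
  simp only [H]
  rw [integral_indicator_const _ (measurableSet_visits a m), smul_eq_mul]
  split_ifs with hU
  · rw [hf.measure_visits hU]
  · rw [mul_zero]

omit hf in
omit [Fintype M₀] in
/-- After a switch to `ξ N`, the run behaves as a run of `ξ N`. -/
lemma ae_of_switch [Countable M₀] {s₀ : S} {N : 𝒩} (hN : (ξ N).IsMarkov) {D : Finset S} {q : A → ℝ}
    (h : ∀ s ∈ D, ∀ᵐ ω ∂(ξ N).measureFrom s, HasFreq q ω) :
    ∀ᵐ ω ∂(Strategy.switching U f m₀ ξ).measureFrom s₀, ∀ t,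
      (ω t).mem = Sum.inr (N, 0) → (ω t).state ∈ D → HasFreq q ω := by
  set ρ := Strategy.switching U f m₀ ξ with hρ
  -- Frequencies survive the removal of a prefix, so it suffices to treat the chain restarted at the
  -- switch. Its action there is one that ξ_N may choose initially, because the location has
  -- positive probability.
  have key := (ρ.play s₀).ae_shift (p := HasFreq q) (measurableSet_hasFreq q)
    (fun l => l.mem = Sum.inr (N, 0) ∧ l.state ∈ D) (by
      rintro t ⟨s, m, a⟩ ⟨hm, hs⟩ hne
      simp only at hm hs
      subst hm
      have ha : a ∈ ((ξ N).next s 0).support := by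
        by_contra hcon
        refine hne (measure_eq_zero_iff_ae_notMem.2 ?_)
        filter_upwards [ρ.ae_act_mem_support s₀] with ω hω hl
        have hl : ω t = _ := hl
        have := hω t
        rw [hl] at this
        exact hcon this
      -- The play of ξ_N embeds into the switching strategy with the same transitions.
      let φ : Loc S ℕ A → Loc S (M₀ ⊕ 𝒩 × ℕ) A := fun l => ⟨l.state, Sum.inr (N, l.mem), l.act⟩
      have hφ : Function.Injective φ := by
        rintro ⟨s, k, a⟩ ⟨s', k', a'⟩ h
        simpa [φ] using h
      have hmap := ((ξ N).play s).map_startAt (ρ.play s₀) hφ (by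
        rintro ⟨s', k, a'⟩
        simp only [hρ, φ, Strategy.play, Strategy.switching, PMF.map_bind, PMF.bind_map,
          PMF.map_comp, Function.comp_def]) ⟨s, 0, a⟩
      change ∀ᵐ ω ∂((ρ.play s₀).startAt (φ ⟨s, 0, a⟩)).runMeasure, HasFreq q ω
      have hφm : Measurable fun (ω : ℕ → Loc S ℕ A) i => φ (ω i) :=
        measurable_pi_lambda _ fun i =>
          (Measurable.of_discrete (f := φ)).comp (measurable_pi_apply i)
      rw [hmap, ae_map_iff hφm.aemeasurable (measurableSet_hasFreq q)]
      refine ((ξ N).play s).ae_startAt (p := HasFreq q) (measurableSet_hasFreq q) (h s hs) ?_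
      rw [Strategy.mem_support_init]
      exact ⟨rfl, by rw [hN.1]; simp, ha⟩)
  filter_upwards [key] with ω hω t hm hs
  exact (hω t ⟨hm, hs⟩).of_shift t

section Recurrent

variable {x : A → 𝒩 → ℝ} (hξ : AreRecurrent x ξ)
  (hsw : ∀ a m N, U a m = Sum.inr N → 0 < f a m →
    a ∈ (G.mec (G.st a)).2 ∧ 0 < ∑ b ∈ (G.mec (G.st a)).2, x b N)

include hξ hsw

omit hξ in
-- The switching action belongs to the MEC, so the following state, the first one with the memory of
-- ξ_N, is still in the MEC.
lemma ae_enters : ∀ᵐ ω ∂(Strategy.switching U f m₀ ξ).measure, ∀ a m N, U a m = Sum.inr N →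
    Visits a m ω → 0 < ∑ b ∈ (G.mec (G.st a)).2, x b N ∧
      ∃ t, (ω t).mem = Sum.inr (N, 0) ∧ (ω t).state ∈ (G.mec (G.st a)).1 := by
  filter_upwards [hf.ae_pos_of_visits (ξ := ξ), ae_switch (U := U) (f := f) (m₀ := m₀) (ξ := ξ),
    (Strategy.switching U f m₀ ξ).ae_step G.init] with ω hpos hswitch hstep a m N hU hv
  obtain ⟨hmem, hx⟩ := hsw a m N hU (hpos a m (by rw [hU]; rfl) hv)
  obtain ⟨t, rfl, hm⟩ := hv
  exact ⟨hx, t + 1, (hswitch t m N hm hU).1,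
    (MDP.isMEC_mec _).prop.succ_mem hmem (hstep t).1⟩

lemma ae_hasFreq : ∀ᵐ ω ∂(Strategy.switching U f m₀ ξ).measure, ∀ a m N, U a m = Sum.inr N →
    Visits a m ω → HasFreq (normFreq x (G.mec (G.st a)) N) ω := by
  have h1 : ∀ a N, ∀ᵐ ω ∂(Strategy.switching U f m₀ ξ).measure,
      0 < ∑ b ∈ (G.mec (G.st a)).2, x b N → ∀ t, (ω t).mem = Sum.inr (N, 0) →
        (ω t).state ∈ (G.mec (G.st a)).1 → HasFreq (normFreq x (G.mec (G.st a)) N) ω := by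
    intro a N
    by_cases hpos : 0 < ∑ b ∈ (G.mec (G.st a)).2, x b N
    · filter_upwards [ae_of_switch (U := U) (f := f) (m₀ := m₀) (s₀ := G.init) (hξ N).1
        fun s hs => hξ.ae_hasFreq (MDP.isMEC_mec (G.st a)) hpos hs] with ω hω _
      exact hω
    · exact ae_of_all _ fun ω h => (hpos h).elim
  simp_rw [← ae_all_iff] at h1
  filter_upwards [h1, hf.ae_enters hsw] with ω h1 h2 a m N hU hv
  obtain ⟨hpos, t, hm, hs⟩ := h2 a m N hU hv
  exact h1 a N hpos t hm hs

lemma switchesTo : (Strategy.switching U f m₀ ξ).SwitchesTo x ξ where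
  next_eq _ _ _ := rfl
  update_eq _ _ _ _ := rfl
  init_entry N k h := by simp [Strategy.switching, PMF.support_pure] at h
  update_entry a s m N k h := by
    simp only [Strategy.switching, PMF.support_pure, Set.mem_singleton_iff] at h
    rw [(hξ N).1.1, PMF.support_pure, Set.mem_singleton_iff]
    cases hU : U a m <;> simp [hU] at h
    exact h.2
  ae_switches := by
    filter_upwards [hf.ae_enters hsw, hf.ae_exists_visits (ξ := ξ)] with ω h1 ⟨a, m, hU, hv⟩
    obtain ⟨N, hN⟩ := Sum.isRight_iff.1 hU
    obtain ⟨hpos, t, hm, hs⟩ := h1 a m N hN hv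
    exact ⟨t, N, _, MDP.isMEC_mec (G.st a), hpos, hs, hm⟩

end Recurrent

end IsLiftedFlow

/-! ### Flows with memory inside a maximal end component -/

namespace MDP

variable {S A : Type*} [Fintype S] [Fintype A] {G : MDP S A}

open scoped Classical in
/-- Inside an end component, every flow can be sent to one state. -/
lemma IsEndComponent.exists_walk {C : Finset S × Finset A} (hC : G.IsEndComponent C) {t : S}
    (ht : t ∈ C.1) {e : S → ℝ} (he0 : ∀ s, 0 ≤ e s) (heC : ∀ s ∉ C.1, e s = 0) :
    ∃ W : A → ℝ, (∀ a, 0 ≤ W a) ∧ (∀ a, W a ≠ 0 → a ∈ C.2 ∧ G.st a ≠ t) ∧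
      ∀ v, e v + ∑ a, W a * G.p a v = ∑ a ∈ G.act v, W a + if v = t then ∑ s, e s else 0 := by
  have hex : ∀ s, ∃ w : A → ℝ, (∀ a, 0 ≤ w a) ∧ (∀ a, w a ≠ 0 → a ∈ C.2 ∧ G.st a ≠ t) ∧
      (s ∈ C.1 → ∀ v, (if v = s then 1 else 0) + ∑ a, w a * G.p a v =
        ∑ a ∈ G.act v, w a + if v = t then 1 else 0) := by
    intro s
    by_cases hs : s ∈ C.1
    · obtain ⟨w, h1, h2, h3⟩ := hC.exists_unit_flow hs ht
      exact ⟨w, h1, h2, fun _ => h3⟩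
    · exact ⟨0, fun _ => le_rfl, fun a h => (h rfl).elim, fun h => (hs h).elim⟩
  choose w h1 h2 h3 using hex
  refine ⟨fun a => ∑ s, e s * w s a, fun a => Finset.sum_nonneg fun s _ =>
    mul_nonneg (he0 s) (h1 s a), fun a ha => ?_, fun v => ?_⟩
  · obtain ⟨s, _, hs⟩ := Finset.exists_ne_zero_of_sum_ne_zero ha
    exact h2 s a (right_ne_zero_of_mul hs)
  · have h4 : ∀ s, e s * ((if v = s then 1 else 0) + ∑ a, w s a * G.p a v) =
        e s * (∑ a ∈ G.act v, w s a + if v = t then 1 else 0) := by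
      intro s
      by_cases hs : s ∈ C.1
      · rw [h3 s hs]
      · rw [heC s hs, zero_mul, zero_mul]
    have h5 := Finset.sum_congr rfl fun s (_ : s ∈ Finset.univ) => h4 s
    simp only [mul_add, Finset.sum_add_distrib, mul_ite, mul_one, mul_zero, Finset.mul_sum,
      Finset.sum_ite_eq, Finset.mem_univ, if_true] at h5
    rw [Finset.sum_comm] at h5
    rw [Finset.sum_comm (s := G.act v)]
    simp only [Finset.sum_mul, mul_assoc]
    rw [h5]
    split_ifs <;> simp

section Tests

variable {n : ℕ} {𝒩 : Finset (Finset (Fin n))} {x : A → 𝒩 → ℝ} (hx : ∀ a N, 0 ≤ x a N)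
  (hcirc : ∀ s N, ∑ a, x a N * G.p a s = ∑ a ∈ G.act s, x a N)

include hx hcirc in
/-- If there is no choice between actions in a MEC, then all frequencies coincide. -/
lemma normFreq_eq {C : Finset S × Finset A} (hC : G.IsMEC C)
    (hone : ∀ a ∈ C.2, ∀ b ∈ C.2, G.st a = G.st b → a = b) {N N' : 𝒩}
    (hN : 0 < ∑ b ∈ C.2, x b N) (hN' : 0 < ∑ b ∈ C.2, x b N') :
    normFreq x C N = normFreq x C N' := by
  classical
  have hext : ∀ f : A → ℝ, ∑ a : {a // a ∈ C.2}, f a = ∑ a ∈ C.2, f a :=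
    fun f => Finset.sum_coe_sort C.2 f
  have hzero : ∀ N a, a ∉ (G.mec (G.st a)).2 → x a N = 0 := fun N a ha =>
    le_antisymm (not_lt.1 fun h => ha
      (mem_mec_of_circulation (fun a => hx a N) (fun s => hcirc s N) h)) (hx a N)
  -- As `b` is the only action of its state with weight, conservation there says that `x` is
  -- stationary for one irreducible matrix that does not depend on `N`.
  have hst : ∀ N, ∀ b : {a // a ∈ C.2}, x b N =
      ∑ a : {a // a ∈ C.2}, x a N * (G.p a (G.st b)) := by
    intro N b
    rw [hext fun a => x a N * G.p a (G.st b)]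
    have h1 : ∑ a ∈ C.2, x a N * G.p a (G.st b) = ∑ a, x a N * G.p a (G.st b) := by
      refine Finset.sum_subset (Finset.subset_univ _) fun a _ ha => ?_
      by_contra hcon
      have h2 : a ∈ (G.mec (G.st a)).2 := by
        by_contra h
        exact hcon (by rw [hzero N a h, zero_mul])
      have hp : 0 < G.p a (G.st b) :=
        (G.p_nonneg _ _).lt_of_ne fun h => hcon (by rw [← h, mul_zero])
      refine ha (hC.mem_snd_iff.2 ⟨h2, ?_⟩)
      exact (isMEC_mec _).eq_of_mem hC ((isMEC_mec _).prop.succ_mem h2 hp) (hC.prop.st_mem b.2)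
    rw [h1, hcirc, Finset.sum_eq_single b.1]
    · intro a ha hab
      refine hzero N a fun h => hab (hone a ?_ b b.2 (G.mem_act.1 ha))
      rw [hC.mem_snd_iff, G.mem_act.1 ha, hC.mec_eq (hC.prop.st_mem b.2)]
      rw [G.mem_act.1 ha, hC.mec_eq (hC.prop.st_mem b.2)] at h
      exact ⟨h, rfl⟩
    · exact fun h => (h (G.mem_act.2 rfl)).elim
  have hirr := hC.prop.irreducible (q := fun _ => 1) fun _ _ => one_pos
  simp only [mul_one] at hirr
  have hpos : ∀ N, 0 < ∑ b ∈ C.2, x b N → ∀ a : {a // a ∈ C.2}, 0 < x a N := by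
    intro N hN a
    refine (hx a N).lt_of_ne fun h => hN.ne' ?_
    rw [← hext]
    exact Finset.sum_eq_zero fun b _ => stationary_eq_zero
      (Q := fun a b : {a // a ∈ C.2} => G.p a (G.st b)) (fun a b => G.p_nonneg _ _) hirr
      (d := fun a => x a N) (fun a => hx a N) (hst N) (b := a) h.symm b
  obtain ⟨c, hc⟩ := stationary_unique
    (Q := fun a b : {a // a ∈ C.2} => G.p a (G.st b)) (fun a b => G.p_nonneg _ _) hirr
    (x := fun a => x a N) (hpos N hN) (hst N) (μ := fun a => x a N') (hst N')
  have hsum : ∑ b ∈ C.2, x b N' = c * ∑ b ∈ C.2, x b N := by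
    rw [← hext fun b => x b N', ← hext fun b => x b N, Finset.mul_sum]
    exact Finset.sum_congr rfl fun b _ => hc b
  have hc0 : c ≠ 0 := fun h => hN'.ne' (by rw [hsum, h, zero_mul])
  funext a
  unfold normFreq
  split_ifs with ha
  · rw [hsum, hc ⟨a, ha⟩, mul_div_mul_left _ _ hc0]
  · rfl

include hx hcirc in
open scoped Classical in
/-- A sequence of randomized tests in a MEC: a test `j` is made in the state of the action
`miss j`, where the action `hit j` is taken with the share `η j`. Each action `b` leaving `C` is
hit with total share `y b`, and the hits inside `C` together with the remaining share `ρ` can be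
assigned to the strategies `ξ_N` without changing the distribution of the frequencies. -/
lemma exists_tests {C : Finset S × Finset A} (hC : G.IsMEC C) (hne : C.2.Nonempty) {y : A → ℝ}
    (hy : ∀ a, 0 ≤ y a) (N₀ : 𝒩) :
    ∃ (hit miss : A ⊕ 𝒩 → A) (η : A ⊕ 𝒩 → ℝ) (dest : A ⊕ 𝒩 → 𝒩) (N₁ : 𝒩) (ρ : ℝ),
      (∀ j, miss j ∈ C.2) ∧ (∀ j, G.st (hit j) = G.st (miss j)) ∧ (∀ j, 0 ≤ η j) ∧ 0 ≤ ρ ∧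
      (∀ j, hit j = miss j → η j = 0) ∧
      (∀ b ∉ C.2, G.st b ∈ C.1 → ∑ j, (if hit j = b then η j else 0) = y b) ∧
      (∀ g : (A → ℝ) → ℝ, ∑ j, (if hit j ∈ C.2 then η j * g (normFreq x C (dest j)) else 0) +
        ρ * g (normFreq x C N₁) = ∑ N, (∑ b ∈ C.2, x b N) * g (normFreq x C N)) ∧
      (∀ j, hit j ∈ C.2 → 0 < η j → 0 < ∑ b ∈ C.2, x b (dest j)) ∧
      (0 < ρ → 0 < ∑ b ∈ C.2, x b N₁) := by
  obtain ⟨a₀, ha₀⟩ := hne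
  -- `P` marks the actions leaving `C`. Indices without `P` become dummy tests with equal hit and
  -- miss and share 0.
  let P : A → Prop := fun b => b ∉ C.2 ∧ G.st b ∈ C.1
  have hmiss : ∀ b, ∃ a ∈ C.2, P b → G.st a = G.st b := by
    intro b
    by_cases hb : P b
    · obtain ⟨a, ha, hab⟩ := hC.prop.exists_action ⟨a₀, ha₀⟩ hb.2
      exact ⟨a, ha, fun _ => hab⟩
    · exact ⟨a₀, ha₀, fun h => (hb h).elim⟩
  choose mi hmi hmist using hmiss
  have hxC : ∀ N, 0 ≤ ∑ b ∈ C.2, x b N := fun N => Finset.sum_nonneg fun b _ => hx b N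
  have hexit : ∀ b, b ∉ C.2 → G.st b ∈ C.1 → ∑ b', (if (if P b' then b' else mi b') = b then
      (if P b' then y b' else 0) else 0) = y b := by
    intro b hb hbC
    rw [Finset.sum_eq_single b]
    · simp [P, hb, hbC]
    · intro b' _ hne
      by_cases h : P b'
      · simp [h, hne]
      · simp [h]
    · simp
  have hzero : ∀ (b : A) (c : ℝ), (if (if P b then b else mi b) ∈ C.2 then
      (if P b then y b else 0) * c else 0) = 0 := by
    intro b c
    by_cases h : P b
    · simp [h, h.1]
    · simp [h]
  by_cases hone : ∀ a ∈ C.2, ∀ b ∈ C.2, G.st a = G.st b → a = b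
  -- Without a choice the strategies cannot be separated inside `C`, but their frequencies coincide.
  -- All mass that stays in `C` goes to one `N₁`, chosen with positive weight if there is one.
  · obtain ⟨N₁, hN₁⟩ : ∃ N₁ : 𝒩, ∀ N, 0 < ∑ b ∈ C.2, x b N → 0 < ∑ b ∈ C.2, x b N₁ := by
      by_cases h : ∃ N, 0 < ∑ b ∈ C.2, x b N
      · exact h.imp fun N₁ h1 _ _ => h1
      · exact ⟨N₀, fun N hN => (h ⟨N, hN⟩).elim⟩
    refine ⟨Sum.elim (fun b => if P b then b else mi b) fun _ => a₀, Sum.elim mi fun _ => a₀,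
      Sum.elim (fun b => if P b then y b else 0) fun _ => 0, fun _ => N₀, N₁,
      ∑ N, ∑ b ∈ C.2, x b N, ?_, ?_, ?_, Finset.sum_nonneg fun N _ => hxC N, ?_, ?_, fun g => ?_,
      ?_,
      fun h => ?_⟩
    · rintro (b | N)
      exacts [hmi b, ha₀]
    · rintro (b | N)
      · by_cases h : P b
        · simp [h, hmist b h]
        · simp [h]
      · rfl
    · rintro (b | N)
      · simp only [Sum.elim_inl]
        split_ifs
        exacts [hy b, le_rfl]
      · exact le_rfl
    · rintro (b | N)
      · by_cases h : P b
        · simp only [Sum.elim_inl, if_pos h]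
          exact fun h' => (h.1 (h' ▸ hmi b)).elim
        · simp [h]
      · exact fun _ => rfl
    · intro b hb hbC
      rw [Fintype.sum_sum_type]
      change (∑ b', if (if P b' then b' else mi b') = b then (if P b' then y b' else 0) else 0) +
        ∑ _N : 𝒩, (if a₀ = b then (0 : ℝ) else 0) = y b
      rw [hexit b hb hbC]
      simp
    · rw [Fintype.sum_sum_type]
      change (∑ b, if (if P b then b else mi b) ∈ C.2 then
        (if P b then y b else 0) * g (normFreq x C N₀) else 0) +
        (∑ _N : 𝒩, if a₀ ∈ C.2 then 0 * g (normFreq x C N₀) else 0) + _ = _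
      simp only [hzero, zero_mul, ite_self, Finset.sum_const_zero, zero_add]
      rw [Finset.sum_mul]
      refine Finset.sum_congr rfl fun N _ => ?_
      rcases (hxC N).eq_or_lt with h | h
      · rw [← h, zero_mul, zero_mul]
      · rw [normFreq_eq hx hcirc hC hone h (hN₁ N h)]
    · rintro (b | N)
      · by_cases h : P b
        · simp [h, h.1]
        · simp [h]
      · simp
    · obtain ⟨N, _, hN⟩ := Finset.exists_ne_zero_of_sum_ne_zero h.ne'
      exact hN₁ N ((hxC N).lt_of_ne hN.symm)
  · push Not at hone
    obtain ⟨a₁, ha₁, a₂, ha₂, hst, hne⟩ := hone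
    -- Two actions `a₁`, `a₂` of one state serve as a coin: test `N` hits `a₁` with the mass of `x`
    -- in `C` for `N`. Nothing remains after the last test.
    refine ⟨Sum.elim (fun b => if P b then b else mi b) fun _ => a₁, Sum.elim mi fun _ => a₂,
      Sum.elim (fun b => if P b then y b else 0) fun N => ∑ b ∈ C.2, x b N,
      Sum.elim (fun _ => N₀) id, N₀, 0, ?_, ?_, ?_, le_rfl, ?_, ?_, fun g => ?_, ?_,
      fun h => (lt_irrefl _ h).elim⟩
    · rintro (b | N)
      exacts [hmi b, ha₂]
    · rintro (b | N)
      · by_cases h : P b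
        · simp [h, hmist b h]
        · simp [h]
      · exact hst
    · rintro (b | N)
      · simp only [Sum.elim_inl]
        split_ifs
        exacts [hy b, le_rfl]
      · exact hxC N
    · rintro (b | N)
      · by_cases h : P b
        · simp only [Sum.elim_inl, if_pos h]
          exact fun h' => (h.1 (h' ▸ hmi b)).elim
        · simp [h]
      · exact fun h => (hne h).elim
    · intro b hb hbC
      have : a₁ ≠ b := fun h => hb (h ▸ ha₁)
      rw [Fintype.sum_sum_type]
      change (∑ b', if (if P b' then b' else mi b') = b then (if P b' then y b' else 0) else 0) +
        (∑ N, if a₁ = b then ∑ b ∈ C.2, x b N else 0) = y b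
      rw [hexit b hb hbC]
      simp [this]
    · rw [Fintype.sum_sum_type]
      change (∑ b, if (if P b then b else mi b) ∈ C.2 then
        (if P b then y b else 0) * g (normFreq x C N₀) else 0) +
        (∑ N, if a₁ ∈ C.2 then (∑ b ∈ C.2, x b N) * g (normFreq x C N) else 0) + _ = _
      simp only [hzero, Finset.sum_const_zero, zero_add, ha₁, if_true, zero_mul, add_zero]
    · rintro (b | N)
      · by_cases h : P b
        · simp [h, h.1]
        · simp [h]
      · exact fun _ h => h

end Tests

end MDP

/-! ### The flow inside one maximal end component -/

namespace MDP

variable {S A : Type*} [Fintype S] [Fintype A] {G : MDP S A} {n : ℕ} {𝒩 : Finset (Finset (Fin n))}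

open scoped Classical in
/-- A flow with memory in the MEC `C`, entering by `I` with memory `m₀`, leaving `C` by `y`, and
lost in `C` in accordance with the frequencies `x`. -/
structure IsLocalFlow {M₀ : Type*} [Fintype M₀] (G : MDP S A) (C : Finset S × Finset A)
    (I : S → ℝ) (y : A → ℝ) (x : A → 𝒩 → ℝ) (U : A → M₀ → M₀ ⊕ 𝒩) (m₀ : M₀) (f : A → M₀ → ℝ) :
    Prop where
  nonneg : ∀ a m, 0 ≤ f a m
  exit : ∀ a ∉ C.2, ∀ m, U a m = Sum.inl m₀
  exit_flow : ∀ a ∉ C.2, G.st a ∈ C.1 → ∑ m, f a m = y a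
  conservation : ∀ s ∈ C.1, ∀ m, (if m = m₀ then I s else 0) +
    ∑ a ∈ C.2, ∑ m', (if U a m' = Sum.inl m then f a m' * G.p a s else 0) = ∑ a ∈ G.act s, f a m
  loss : ∀ g : (A → ℝ) → ℝ, ∑ a ∈ C.2, ∑ m,
    Sum.elim (fun _ => 0) (fun N => f a m * g (normFreq x C N)) (U a m) =
      ∑ N, (∑ b ∈ C.2, x b N) * g (normFreq x C N)
  loss_pos : ∀ a ∈ C.2, ∀ m N, U a m = Sum.inr N → 0 < f a m → 0 < ∑ b ∈ C.2, x b N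

omit [Fintype S] in
open scoped Classical in
-- A MEC without actions is a single state carrying no mass of `x`: no test is needed, and the
-- entering flow leaves directly by `y`.
lemma isLocalFlow_of_trivial {M₀ : Type*} [Fintype M₀] {C : Finset S × Finset A} {x : A → 𝒩 → ℝ}
    (hC : G.IsMEC C) (hne : C.2 = ∅) {I : S → ℝ} {y : A → ℝ} (hy : ∀ a, 0 ≤ y a)
    (hI : ∑ s ∈ C.1, I s =
      ∑ a with a ∉ C.2 ∧ G.st a ∈ C.1, y a + ∑ N : 𝒩, ∑ b ∈ C.2, x b N) (m₀ : M₀) :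
    IsLocalFlow G C I y x (fun _ _ => Sum.inl m₀) m₀ fun a m => if m = m₀ then y a else 0 where
  nonneg a m := by
    split_ifs
    exacts [hy a, le_rfl]
  exit _ _ _ := rfl
  exit_flow a _ _ := by simp
  conservation s hs m := by
    have hC1 : C.1 = {s} := by
      refine Finset.eq_singleton_iff_unique_mem.2 ⟨hs, fun t ht => ?_⟩
      by_contra hst
      obtain ⟨a, ha, _⟩ := hC.prop.exists_action_of_ne ht hs hst
      simp [hne] at ha
    have hf : (Finset.univ.filter fun a => a ∉ C.2 ∧ G.st a ∈ C.1) = G.act s := by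
      ext a
      simp [hne, hC1, G.mem_act]
    rw [hf, hC1, hne] at hI
    simp only [Finset.sum_singleton, Finset.sum_empty, Finset.sum_const_zero, add_zero] at hI
    rw [hne, Finset.sum_empty, add_zero]
    split_ifs
    · exact hI
    · simp
  loss g := by simp [hne]
  loss_pos a ha := by simp [hne] at ha

open scoped Classical in
-- The memory is the number of the current test. Within a test the flow walks to the state of `miss
-- m`, where it divides between hit and miss.
lemma exists_isLocalFlow_of_nonempty {C : Finset S × Finset A} {x : A → 𝒩 → ℝ}
    (hx : ∀ a N, 0 ≤ x a N)
    (hcirc : ∀ s N, ∑ a, x a N * G.p a s = ∑ a ∈ G.act s, x a N) (hC : G.IsMEC C)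
    (hne : C.2.Nonempty) {I : S → ℝ} {y : A → ℝ} (hI0 : ∀ s, 0 ≤ I s) (hy : ∀ a, 0 ≤ y a)
    (hI : ∑ s ∈ C.1, I s =
      ∑ a with a ∉ C.2 ∧ G.st a ∈ C.1, y a + ∑ N : 𝒩, ∑ b ∈ C.2, x b N) (N₀ : 𝒩)
    {K : ℕ} (hK : 0 < K) (e : Fin K ≃ A ⊕ 𝒩) :
    ∃ (U : A → Fin K → Fin K ⊕ 𝒩) (f : A → Fin K → ℝ), IsLocalFlow G C I y x U ⟨0, hK⟩ f := by
  obtain ⟨hit', miss', η', dest', N₁, ρ, hmiss', hst', hη', hρ, heq', hexit', hg', hpos', hρpos⟩ :=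
    exists_tests hx hcirc hC hne hy N₀
  let hit : Fin K → A := fun m => hit' (e m)
  let miss : Fin K → A := fun m => miss' (e m)
  let η : Fin K → ℝ := fun m => η' (e m)
  let dest : Fin K → 𝒩 := fun m => dest' (e m)
  have hmiss : ∀ m, miss m ∈ C.2 := fun m => hmiss' _
  have hst : ∀ m, G.st (hit m) = G.st (miss m) := fun m => hst' _
  have hη : ∀ m, 0 ≤ η m := fun m => hη' _
  have heq : ∀ m, hit m = miss m → η m = 0 := fun m => heq' _
  have hexit : ∀ b ∉ C.2, G.st b ∈ C.1 → ∑ m, (if hit m = b then η m else 0) = y b :=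
    fun b hb hbC => (e.sum_comp fun j => if hit' j = b then η' j else 0).trans (hexit' b hb hbC)
  have hg : ∀ g : (A → ℝ) → ℝ, ∑ m, (if hit m ∈ C.2 then η m * g (normFreq x C (dest m)) else 0) +
      ρ * g (normFreq x C N₁) = ∑ N, (∑ b ∈ C.2, x b N) * g (normFreq x C N) := fun g => by
    rw [← hg' g]
    congr 1
    exact e.sum_comp fun j => if hit' j ∈ C.2 then η' j * g (normFreq x C (dest' j)) else 0
  have hpos : ∀ m, hit m ∈ C.2 → 0 < η m → 0 < ∑ b ∈ C.2, x b (dest m) := fun m => hpos' _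
  clear_value hit miss η
  -- The flow present at the beginning of test `j`: the shares of this and all later tests, and the
  -- final remainder.
  let R : ℕ → ℝ := fun j => ρ + ∑ i : Fin K, if j ≤ i.1 then η i else 0
  have hR0 : ∀ j, 0 ≤ R j := fun j => add_nonneg hρ (Finset.sum_nonneg fun i _ => by
    split_ifs
    exacts [hη i, le_rfl])
  have hRsucc : ∀ m : Fin K, R m.1 = η m + R (m.1 + 1) := by
    intro m
    have h1 : ∑ i : Fin K, (if m.1 ≤ i.1 then η i else 0) =
        ∑ i : Fin K, ((if i = m then η i else 0) + if m.1 + 1 ≤ i.1 then η i else 0) := by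
      refine Finset.sum_congr rfl fun i _ => ?_
      by_cases him : i = m
      · subst him; simp
      · have : i.1 ≠ m.1 := fun h => him (Fin.ext h)
        have : m.1 ≤ i.1 ↔ m.1 + 1 ≤ i.1 := by omega
        simp [him, this]
    simp only [R]
    rw [h1, Finset.sum_add_distrib]
    simp
    ring
  have hRK : R K = ρ := by
    have : ∑ i : Fin K, (if K ≤ i.1 then η i else 0) = 0 :=
      Finset.sum_eq_zero fun i _ => if_neg (by omega)
    simp only [R, this, add_zero]
  have hRzero : R 0 = ∑ s ∈ C.1, I s := by
    have h1 : ∑ a with a ∉ C.2 ∧ G.st a ∈ C.1, y a = ∑ m, if hit m ∈ C.2 then 0 else η m := by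
      have h2 : ∀ a ∈ Finset.univ.filter (fun a => a ∉ C.2 ∧ G.st a ∈ C.1),
          y a = ∑ m, (if hit m = a then η m else 0) := fun a ha => by
        obtain ⟨_, h3, h4⟩ := Finset.mem_filter.1 ha
        exact (hexit a h3 h4).symm
      rw [Finset.sum_congr rfl h2, Finset.sum_comm]
      refine Finset.sum_congr rfl fun m _ => ?_
      rw [Finset.sum_ite_eq]
      have h5 : G.st (hit m) ∈ C.1 := hst m ▸ hC.prop.st_mem (hmiss m)
      by_cases h : hit m ∈ C.2 <;> simp [h, h5]
    have h2 := hg fun _ => 1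
    simp only [mul_one] at h2
    rw [hI, h1, ← h2, ← add_assoc, ← Finset.sum_add_distrib]
    simp only [R, Nat.zero_le, if_true]
    rw [add_comm]
    congr 1
    refine Finset.sum_congr rfl fun m _ => ?_
    split_ifs <;> simp
  -- Where test `m` begins: test 0 with the flow entering `C`, a later test at the successors of the
  -- preceding miss. The total is `R m`.
  let ent : Fin K → S → ℝ := fun m s => if m.1 = 0 then (if s ∈ C.1 then I s else 0) else
    R m.1 * G.p (miss ⟨m.1 - 1, by omega⟩) s
  have hent0 : ∀ m s, 0 ≤ ent m s := by
    intro m s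
    simp only [ent]
    split_ifs
    · exact hI0 s
    · exact le_rfl
    · exact mul_nonneg (hR0 _) (G.p_nonneg _ _)
  have hentC : ∀ m, ∀ s ∉ C.1, ent m s = 0 := by
    intro m s hs
    simp only [ent]
    rw [if_neg hs]
    split_ifs
    · rfl
    · rw [le_antisymm (not_lt.1 fun h => hs (hC.prop.succ_mem (hmiss _) h)) (G.p_nonneg _ _),
        mul_zero]
  have hentR : ∀ m, ∑ s, ent m s = R m.1 := by
    intro m
    simp only [ent]
    split_ifs with h
    · rw [h, hRzero, Finset.sum_ite_mem, Finset.univ_inter]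
    · rw [← Finset.mul_sum, G.sum_p, mul_one]
  choose W hW0 hW hWc using fun m => hC.prop.exists_walk (hC.prop.st_mem (hmiss m)) (hent0 m)
    (hentC m)
  simp_rw [hentR] at hWc
  have hWst : ∀ m a, G.st a = G.st (miss m) → W m a = 0 := fun m a ha => by
    by_contra h
    exact (hW m a h).2 ha
  let f : A → Fin K → ℝ := fun a m => W m a + (if hit m = a then η m else 0) +
    if miss m = a then R (m.1 + 1) else 0
  -- Leaving `C` resets the memory. A miss advances it, and the last miss switches to `N₁`; a hit
  -- inside `C` switches to `dest m`. If hit and miss coincide, the share is 0 and the miss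
  -- prevails.
  let U : A → Fin K → Fin K ⊕ 𝒩 := fun a m => if a ∉ C.2 then Sum.inl ⟨0, hK⟩ else
    if miss m = a then (if h : m.1 + 1 < K then Sum.inl ⟨m.1 + 1, h⟩ else Sum.inr N₁) else
    if hit m = a then Sum.inr (dest m) else Sum.inl m
  have hfmiss : ∀ m a, miss m = a → f a m = R (m.1 + 1) := by
    rintro m a rfl
    have h1 : (if hit m = miss m then η m else 0) = 0 := by
      split_ifs with h
      exacts [heq m h, rfl]
    simp only [f]
    rw [h1, hWst m _ rfl, if_pos trivial, zero_add, zero_add]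
  have hfhit : ∀ m a, miss m ≠ a → hit m = a → f a m = η m := by
    rintro m a h1 rfl
    simp only [f]
    rw [hWst m _ (hst m), if_pos trivial, if_neg h1, zero_add, add_zero]
  have hfelse : ∀ m a, miss m ≠ a → hit m ≠ a → f a m = W m a := by
    intro m a h1 h2
    simp only [f]
    rw [if_neg h1, if_neg h2, add_zero, add_zero]
  refine ⟨U, f, fun a m => ?_, fun a ha m => if_pos ha, fun a ha haC => ?_, fun s hs m => ?_,
    fun g => ?_, fun a ha m N hU hfa => ?_⟩
  · refine add_nonneg (add_nonneg (hW0 m a) ?_) ?_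
    · split_ifs
      exacts [hη m, le_rfl]
    · split_ifs
      exacts [hR0 _, le_rfl]
  · rw [← hexit a ha haC]
    refine Finset.sum_congr rfl fun m _ => ?_
    have h1 : W m a = 0 := by
      by_contra h
      exact ha (hW m a h).1
    have h2 : miss m ≠ a := fun h => ha (h ▸ hmiss m)
    simp only [f]
    rw [h1, if_neg h2, zero_add, add_zero]
  -- Memory `m` arises inside `C` in two ways: by walking within test `m`, or by the miss of test `m
  -- - 1`.
  · have key : ∀ a ∈ C.2, ∀ m', (if U a m' = Sum.inl m then f a m' * G.p a s else 0) =
        (if m' = m then W m a * G.p a s else 0) +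
          if miss m' = a then (if m'.1 + 1 = m.1 then R m.1 * G.p (miss m') s else 0) else 0 := by
      intro a ha m'
      have hUa : U a m' = if miss m' = a then
          (if h : m'.1 + 1 < K then Sum.inl ⟨m'.1 + 1, h⟩ else Sum.inr N₁) else
          if hit m' = a then Sum.inr (dest m') else Sum.inl m' := if_neg (not_not.2 ha)
      rw [hUa]
      by_cases h1 : miss m' = a
      · have hW1 : (if m' = m then W m a * G.p a s else 0) = 0 := by
          split_ifs with h
          · rw [← h, hWst m' a (by rw [h1]), zero_mul]
          · rfl
        rw [if_pos h1, if_pos h1, hW1, zero_add, hfmiss m' a h1]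
        by_cases h2 : m'.1 + 1 = m.1
        · rw [if_pos h2, dif_pos (h2 ▸ m.2), if_pos (by rw [Sum.inl.injEq]; exact Fin.ext h2), h2,
            h1]
        · rw [if_neg h2, if_neg]
          split_ifs
          · rw [Sum.inl.injEq]
            exact fun h => h2 (Fin.ext_iff.1 h)
          · simp
      · rw [if_neg h1, if_neg h1, add_zero]
        by_cases h2 : hit m' = a
        · rw [if_pos h2, if_neg (by simp)]
          split_ifs with h
          · rw [← h, hWst m' a (by rw [← h2, hst]), zero_mul]
          · rfl
        · rw [if_neg h2, hfelse m' a h1 h2]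
          simp only [Sum.inl.injEq]
          split_ifs with h
          · rw [h]
          · rfl
    have h1 : ∑ a ∈ C.2, ∑ m', (if U a m' = Sum.inl m then f a m' * G.p a s else 0) =
        ∑ a, W m a * G.p a s + if m.1 = 0 then 0 else ent m s := by
      rw [Finset.sum_congr rfl fun a ha => Finset.sum_congr rfl fun m' _ => key a ha m']
      simp_rw [Finset.sum_add_distrib]
      congr 1
      · simp only [Finset.sum_ite_eq', Finset.mem_univ, if_true]
        refine Finset.sum_subset (Finset.subset_univ _) fun a _ ha => ?_
        have : W m a = 0 := by
          by_contra h
          exact ha (hW m a h).1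
        rw [this, zero_mul]
      · rw [Finset.sum_comm]
        simp only [Finset.sum_ite_eq, hmiss, if_true]
        split_ifs with hm
        · exact Finset.sum_eq_zero fun m' _ => if_neg (by omega)
        · rw [Finset.sum_eq_single ⟨m.1 - 1, by omega⟩]
          · rw [if_pos (show m.1 - 1 + 1 = m.1 by omega)]
            simp only [ent, if_neg hm]
          · intro m' _ hm'
            refine if_neg fun h => hm' (Fin.ext ?_)
            simp only
            omega
          · simp
    have h2 : (if m = ⟨0, hK⟩ then I s else 0) + (if m.1 = 0 then 0 else ent m s) = ent m s := by
      by_cases hm : m.1 = 0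
      · rw [if_pos hm, if_pos (Fin.ext hm), add_zero]
        simp only [ent, if_pos hm, if_pos hs]
      · rw [if_neg hm, if_neg fun h => hm (Fin.ext_iff.1 h), zero_add]
    have h3 : ∑ a ∈ G.act s, f a m = ∑ a ∈ G.act s, W m a +
        if s = G.st (miss m) then R m.1 else 0 := by
      simp only [f]
      rw [Finset.sum_add_distrib, Finset.sum_add_distrib, Finset.sum_ite_eq, Finset.sum_ite_eq,
        add_assoc]
      simp only [G.mem_act, hst, eq_comm (a := s)]
      congr 1
      split_ifs
      · exact (hRsucc m).symm
      · simp
    have h4 : (if m = ⟨0, hK⟩ then I s else 0) +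
        ∑ a ∈ C.2, ∑ m', (if U a m' = Sum.inl m then f a m' * G.p a s else 0) =
        ∑ a ∈ G.act s, f a m := by
      rw [h1, h3, ← hWc, add_comm (∑ a, _), ← add_assoc, h2]
    convert h4
  · have key : ∀ a ∈ C.2, ∀ m, Sum.elim (fun _ => 0) (fun N => f a m * g (normFreq x C N)) (U a m) =
        (if miss m = a then (if m.1 + 1 < K then 0 else ρ * g (normFreq x C N₁)) else 0) +
        (if hit m = a then η m * g (normFreq x C (dest m)) else 0) := by
      intro a ha m
      have hUa : U a m = if miss m = a then
          (if h : m.1 + 1 < K then Sum.inl ⟨m.1 + 1, h⟩ else Sum.inr N₁) else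
          if hit m = a then Sum.inr (dest m) else Sum.inl m := if_neg (not_not.2 ha)
      rw [hUa]
      by_cases h1 : miss m = a
      · have h2 : (if hit m = a then η m * g (normFreq x C (dest m)) else 0) = 0 := by
          split_ifs with h
          · rw [heq m (h.trans h1.symm), zero_mul]
          · rfl
        rw [if_pos h1, if_pos h1, h2, add_zero, hfmiss m a h1]
        by_cases h3 : m.1 + 1 < K
        · simp [h3]
        · have : m.1 + 1 = K := by omega
          rw [dif_neg h3, if_neg h3, Sum.elim_inr, this, hRK]
      · rw [if_neg h1, if_neg h1, zero_add]
        by_cases h2 : hit m = a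
        · rw [if_pos h2, if_pos h2, Sum.elim_inr, hfhit m a h1 h2]
        · rw [if_neg h2, if_neg h2, Sum.elim_inl]
    rw [Finset.sum_congr rfl fun a ha => Finset.sum_congr rfl fun m _ => key a ha m, ← hg g,
      Finset.sum_comm]
    simp_rw [Finset.sum_add_distrib, Finset.sum_ite_eq, hmiss, if_true]
    rw [add_comm]
    congr 1
    rw [Finset.sum_eq_single ⟨K - 1, by omega⟩]
    · rw [if_neg]
      simp only
      omega
    · intro m _ hm
      refine if_pos ?_
      have : m.1 ≠ K - 1 := fun h => hm (Fin.ext h)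
      omega
    · simp
  · have hUa : U a m = if miss m = a then
        (if h : m.1 + 1 < K then Sum.inl ⟨m.1 + 1, h⟩ else Sum.inr N₁) else
        if hit m = a then Sum.inr (dest m) else Sum.inl m := if_neg (not_not.2 ha)
    rw [hUa] at hU
    by_cases h1 : miss m = a
    · rw [if_pos h1] at hU
      rw [hfmiss m a h1] at hfa
      by_cases h3 : m.1 + 1 < K
      · simp [h3] at hU
      · rw [dif_neg h3, Sum.inr.injEq] at hU
        have : m.1 + 1 = K := by omega
        rw [this, hRK] at hfa
        exact hU ▸ hρpos hfa
    · rw [if_neg h1] at hU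
      by_cases h2 : hit m = a
      · rw [if_pos h2, Sum.inr.injEq] at hU
        rw [hfhit m a h1 h2] at hfa
        exact hU ▸ hpos m (h2 ▸ ha) hfa
      · simp [h2] at hU

end MDP

/-! ### Gluing the local flows, and the witness strategy -/

namespace MDP

variable {S A : Type*} [Fintype S] [Fintype A] {G : MDP S A}

open scoped Classical in
lemma sum_eq_sum_mec (F : A → ℝ) (hF : ∀ a ∉ (G.mec (G.st a)).2, F a = 0) :
    ∑ a, F a = ∑ C ∈ Finset.univ.image G.mec, ∑ a ∈ C.2, F a := by
  rw [← Finset.sum_fiberwise_of_maps_to (s := Finset.univ) (t := Finset.univ.image G.mec)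
    (g := fun a => G.mec (G.st a)) fun a _ => Finset.mem_image_of_mem _ (Finset.mem_univ _)]
  refine Finset.sum_congr rfl fun C hC => ?_
  obtain ⟨s, _, rfl⟩ := Finset.mem_image.1 hC
  symm
  refine Finset.sum_subset (fun a ha => ?_) fun a ha hna => hF a fun h => hna ?_
  · exact Finset.mem_filter.2 ⟨Finset.mem_univ _, ((isMEC_mec s).mem_snd_iff.1 ha).2⟩
  · rwa [(Finset.mem_filter.1 ha).2] at h

end MDP

namespace LPVars.IsFlow

variable {S A : Type*} [Fintype S] [Fintype A] {G : MDP S A} {n : ℕ} {𝒩 : Finset (Finset (Fin n))}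
  {v : LPVars S A 𝒩} {r : A → Fin n → ℝ} {exp sat : Fin n → ℝ} (hv : v.IsFlow G r exp sat)

include hv

open scoped Classical in
lemma nonempty_index : Nonempty 𝒩 := by
  by_contra h
  rw [not_nonempty_iff] at h
  have := hv.switching
  simp at this

lemma eq_zero_of_notMem_mec (N : 𝒩) {a : A} (ha : a ∉ (G.mec (G.st a)).2) : v.x a N = 0 :=
  le_antisymm (not_lt.1 fun h => ha (MDP.mem_mec_of_circulation (fun a => hv.x_nonneg a N)
    (fun s => hv.recurrent_flow s N) h)) (hv.x_nonneg a N)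

open scoped Classical in
/-- The flow into a MEC. -/
lemma sum_entering {C : Finset S × Finset A} (hC : G.IsMEC C) :
    ∑ s ∈ C.1, ((if s = G.init then 1 else 0) +
      ∑ a, if a ∉ (G.mec (G.st a)).2 then v.yAct a * G.p a s else 0) =
    ∑ a with a ∉ C.2 ∧ G.st a ∈ C.1, v.yAct a + ∑ N : 𝒩, ∑ b ∈ C.2, v.x b N := by
  have h1 : ∑ s ∈ C.1, ((if s = G.init then 1 else 0) + ∑ a, v.yAct a * G.p a s) =
      ∑ s ∈ C.1, (∑ a ∈ G.act s, v.yAct a + ∑ N, v.ySwitch s N) :=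
    Finset.sum_congr rfl fun s _ => hv.transient_flow s
  have h2 : ∑ s ∈ C.1, ∑ N, v.ySwitch s N = ∑ N : 𝒩, ∑ b ∈ C.2, v.x b N := by
    rw [Finset.sum_comm]
    exact Finset.sum_congr rfl fun N _ => hv.switch_eq_freq C hC N
  have h3 : ∑ s ∈ C.1, ∑ a ∈ G.act s, v.yAct a =
      ∑ a ∈ C.2, v.yAct a + ∑ a with a ∉ C.2 ∧ G.st a ∈ C.1, v.yAct a := by
    simp_rw [G.sum_act]
    rw [Finset.sum_comm]
    simp_rw [Finset.sum_ite_eq]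
    rw [Finset.sum_filter, ← Finset.univ_inter C.2, ← Finset.sum_ite_mem,
      ← Finset.sum_add_distrib]
    refine Finset.sum_congr rfl fun a _ => ?_
    by_cases ha : a ∈ C.2
    · simp [ha, hC.prop.st_mem ha]
    · simp [ha]
  -- Actions of `C` lead back into `C`, so their flow cancels; actions of other MECs never reach
  -- `C`. Only actions outside all MECs enter.
  have h4 : ∑ s ∈ C.1, ∑ a, v.yAct a * G.p a s = ∑ a ∈ C.2, v.yAct a +
      ∑ s ∈ C.1, ∑ a, if a ∉ (G.mec (G.st a)).2 then v.yAct a * G.p a s else 0 := by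
    rw [Finset.sum_comm, Finset.sum_comm (s := C.1), ← Finset.univ_inter C.2,
      ← Finset.sum_ite_mem, ← Finset.sum_add_distrib]
    refine Finset.sum_congr rfl fun a _ => ?_
    have hz : ∀ D, G.IsEndComponent D → a ∈ D.2 → ∀ s ∉ D.1, G.p a s = 0 := fun D hD ha s hs =>
      le_antisymm (not_lt.1 fun h => hs (hD.succ_mem ha h)) (G.p_nonneg a s)
    by_cases ha : a ∈ C.2
    · have h5 := (hC.mem_snd_iff.1 ha).1
      have h6 : ∑ s ∈ C.1, G.p a s = 1 := by
        rw [← G.sum_p a]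
        exact Finset.sum_subset (Finset.subset_univ _) fun s _ hs => hz C hC.prop ha s hs
      simp [ha, h5, ← Finset.mul_sum, h6]
    · by_cases h5 : a ∈ (G.mec (G.st a)).2
      · have h6 : ∀ s ∈ C.1, v.yAct a * G.p a s = 0 := fun s hs => by
          rw [hz _ (MDP.isMEC_mec _).prop h5 s, mul_zero]
          intro hs'
          exact ha (hC.mem_snd_iff.2 ⟨h5, (MDP.isMEC_mec _).eq_of_mem hC hs' hs⟩)
        simp [ha, h5, Finset.sum_eq_zero h6]
      · simp [ha, h5]
  simp_rw [Finset.sum_add_distrib] at h1 ⊢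
  rw [h2, h3, h4] at h1
  linarith

open scoped Classical in
/-- A solution of the linear program can be lifted to a flow with deterministic memory, which is
lost in accordance with the frequencies of the solution. -/
lemma exists_isLiftedFlow : ∃ (K : ℕ) (U : A → Fin K → Fin K ⊕ 𝒩) (m₀ : Fin K)
    (f : A → Fin K → ℝ), IsLiftedFlow G U m₀ f ∧
    (∀ a m N, U a m = Sum.inr N → 0 < f a m →
      a ∈ (G.mec (G.st a)).2 ∧ 0 < ∑ b ∈ (G.mec (G.st a)).2, v.x b N) ∧
    ∀ g : (A → ℝ) → ℝ, ∑ a, ∑ m,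
      Sum.elim (fun _ => 0) (fun N => f a m * g (normFreq v.x (G.mec (G.st a)) N)) (U a m) =
      ∑ C ∈ Finset.univ.image G.mec, ∑ N, (∑ b ∈ C.2, v.x b N) * g (normFreq v.x C N) := by
  obtain ⟨N₀⟩ := hv.nonempty_index
  let K := Fintype.card (A ⊕ 𝒩)
  let e : Fin K ≃ A ⊕ 𝒩 := (Fintype.equivFin _).symm
  have hK : 0 < K := Fintype.card_pos_iff.2 ⟨Sum.inr N₀⟩
  -- The values of `yAct` inside MECs are discarded, since the local flows supply their own walks.
  let I : S → ℝ := fun s => (if s = G.init then 1 else 0) +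
    ∑ a, if a ∉ (G.mec (G.st a)).2 then v.yAct a * G.p a s else 0
  have hI : ∀ s, 0 ≤ I s := fun s => by
    refine add_nonneg (by split_ifs <;> norm_num) (Finset.sum_nonneg fun a _ => ?_)
    split_ifs
    exacts [le_rfl, mul_nonneg (hv.yAct_nonneg a) (G.p_nonneg a s)]
  have hex : ∀ C : Finset S × Finset A, ∃ (U : A → Fin K → Fin K ⊕ 𝒩) (f : A → Fin K → ℝ),
      G.IsMEC C → G.IsLocalFlow C I v.yAct v.x U ⟨0, hK⟩ f := by
    intro C
    by_cases hC : G.IsMEC C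
    swap
    · exact ⟨fun _ m => Sum.inl m, fun _ _ => 0, fun h => (hC h).elim⟩
    rcases C.2.eq_empty_or_nonempty with hne | hne
    · exact ⟨_, _, fun _ => MDP.isLocalFlow_of_trivial hC hne hv.yAct_nonneg
        (hv.sum_entering hC) _⟩
    · obtain ⟨U, f, h⟩ := MDP.exists_isLocalFlow_of_nonempty hv.x_nonneg hv.recurrent_flow hC hne hI
        hv.yAct_nonneg (hv.sum_entering hC) N₀ hK e
      exact ⟨U, f, fun _ => h⟩
  choose U f hf using hex
  have hloc : ∀ s, G.IsLocalFlow (G.mec s) I v.yAct v.x (U (G.mec s)) ⟨0, hK⟩ (f (G.mec s)) :=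
    fun s => hf _ (MDP.isMEC_mec s)
  refine ⟨K, fun a => U (G.mec (G.st a)) a, ⟨0, hK⟩, fun a => f (G.mec (G.st a)) a,
    ⟨fun a m => (hloc _).nonneg a m, fun s m => ?_⟩, fun a m N hU hfa => ?_, fun g => ?_⟩
  -- A state receives flow from the actions of its own MEC, with the memory of that MEC, and from
  -- actions outside all MECs, which arrive with the initial memory.
  · have key : ∀ a, ∑ m', (if U (G.mec (G.st a)) a m' = Sum.inl m then
        f (G.mec (G.st a)) a m' * G.p a s else 0) =
        (if a ∈ (G.mec s).2 then ∑ m', (if U (G.mec s) a m' = Sum.inl m then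
          f (G.mec s) a m' * G.p a s else 0) else 0) +
        (if m = ⟨0, hK⟩ then
          (if a ∉ (G.mec (G.st a)).2 then v.yAct a * G.p a s else 0) else 0) := by
      intro a
      by_cases ha : a ∈ (G.mec s).2
      · have h1 := (MDP.isMEC_mec s).mem_snd_iff.1 ha
        simp only [ha, h1.2, if_true, not_true_eq_false, if_false, ite_self, add_zero]
      · rw [if_neg ha, zero_add]
        by_cases h1 : a ∈ (G.mec (G.st a)).2
        · have h2 : G.p a s = 0 := by
            refine le_antisymm (not_lt.1 fun h => ha ?_) (G.p_nonneg a s)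
            rwa [(MDP.isMEC_mec _).mec_eq ((MDP.isMEC_mec _).prop.succ_mem h1 h)]
          simp [h2]
        · simp only [(hloc _).exit a h1, Sum.inl.injEq, eq_comm (b := m)]
          split_ifs
          · rw [← Finset.sum_mul, (hloc _).exit_flow a h1 (MDP.mem_mec _)]
          · simp
    have h1 := (hloc s).conservation s (MDP.mem_mec s) m
    have h2 : ∑ a ∈ G.act s, f (G.mec (G.st a)) a m = ∑ a ∈ G.act s, f (G.mec s) a m :=
      Finset.sum_congr rfl fun a ha => by rw [G.mem_act.1 ha]
    have h3 : ∑ a, ∑ m', (if U (G.mec (G.st a)) a m' = Sum.inl m then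
        f (G.mec (G.st a)) a m' * G.p a s else 0) =
        ∑ a ∈ (G.mec s).2, ∑ m', (if U (G.mec s) a m' = Sum.inl m then
          f (G.mec s) a m' * G.p a s else 0) +
        (if m = ⟨0, hK⟩ then
          ∑ a, (if a ∉ (G.mec (G.st a)).2 then v.yAct a * G.p a s else 0) else 0) := by
      rw [Finset.sum_congr rfl fun a _ => key a, Finset.sum_add_distrib, Finset.sum_ite_mem,
        Finset.univ_inter]
      congr 1
      split_ifs <;> simp
    have h4 : (if s = G.init ∧ m = ⟨0, hK⟩ then (1 : ℝ) else 0) +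
        ∑ a, ∑ m', (if U (G.mec (G.st a)) a m' = Sum.inl m then
          f (G.mec (G.st a)) a m' * G.p a s else 0) = ∑ a ∈ G.act s, f (G.mec (G.st a)) a m := by
      rw [h2, h3]
      have h5 : (if m = ⟨0, hK⟩ then I s else 0) +
          ∑ a ∈ (G.mec s).2, ∑ m', (if U (G.mec s) a m' = Sum.inl m then
          f (G.mec s) a m' * G.p a s else 0) = ∑ a ∈ G.act s, f (G.mec s) a m := by
        convert h1
      rw [← h5]
      by_cases hm : m = ⟨0, hK⟩
      · simp only [hm, and_true, if_true, I]
        ring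
      · simp [hm]
    convert h4
  · have ha : a ∈ (G.mec (G.st a)).2 := by
      by_contra h
      beta_reduce at hU
      rw [(hloc _).exit a h m] at hU
      cases hU
    exact ⟨ha, (hloc _).loss_pos a ha m N hU hfa⟩
  · rw [MDP.sum_eq_sum_mec (G := G)]
    · refine Finset.sum_congr rfl fun C hC => ?_
      obtain ⟨s, _, rfl⟩ := Finset.mem_image.1 hC
      rw [← (hloc s).loss g]
      refine Finset.sum_congr rfl fun a ha => ?_
      beta_reduce
      rw [((MDP.isMEC_mec s).mem_snd_iff.1 ha).2]
    · intro a ha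
      refine Finset.sum_eq_zero fun m _ => ?_
      beta_reduce
      rw [(hloc _).exit a ha m]
      rfl

/-- Every solution of the linear program is realized by a strategy with deterministic update, which
uses finite memory until it switches to recurrent strategies. -/
theorem exists_strategy {ξ : 𝒩 → Strategy G ℕ} (hξ : AreRecurrent v.x ξ) :
    ∃ (K : ℕ) (ρ : Strategy G (Fin K ⊕ 𝒩 × ℕ)), ρ.IsDeterministicUpdate ∧ ρ.SwitchesTo v.x ξ ∧
      ρ.SatisfiesExp r exp ∧ ∀ J : Finset (Fin n), ∑ N : 𝒩 with J ⊆ N.1, ∑ a, v.x a N ≤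
        ρ.measure.real {ω | ∀ i ∈ J, sat i ≤ lrInf (fun a => r a i) ω} := by
  classical
  obtain ⟨K, U, m₀, f, hf, hsw, hloss⟩ := hv.exists_isLiftedFlow
  set ρ := Strategy.switching U f m₀ ξ with hρ
  -- Every quantity determined by the frequencies has the expectation that the loss identity
  -- prescribes. Long-run rewards and the satisfaction of thresholds are of this kind.
  have hint : ∀ (F : (ℕ → Loc S (Fin K ⊕ 𝒩 × ℕ) A) → ℝ) (g : (A → ℝ) → ℝ),
      (∀ ω q, HasFreq q ω → F ω = g q) → ∫ ω, F ω ∂ρ.measure =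
        ∑ C ∈ Finset.univ.image G.mec, ∑ N, (∑ b ∈ C.2, v.x b N) * g (normFreq v.x C N) := by
    intro F g hF
    rw [hf.integral_eq_sum_visits (ξ := ξ) (fun a m =>
      Sum.elim (fun _ => 0) (fun N => g (normFreq v.x (G.mec (G.st a)) N)) (U a m)), ← hloss g]
    · refine Finset.sum_congr rfl fun a _ => Finset.sum_congr rfl fun m _ => ?_
      rcases hU : U a m with m' | N <;> simp
    · filter_upwards [hf.ae_hasFreq hξ hsw] with ω hω a m hU hvis
      obtain ⟨N, hN⟩ := Sum.isRight_iff.1 hU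
      rw [hN, Sum.elim_inr]
      exact hF ω _ (hω a m N hN hvis)
  have hxC : ∀ (C : Finset S × Finset A) N, 0 ≤ ∑ b ∈ C.2, v.x b N :=
    fun C N => Finset.sum_nonneg fun b _ => hv.x_nonneg b N
  have hnorm : ∀ (C : Finset S × Finset A) N (h : A → ℝ),
      (∑ b ∈ C.2, v.x b N) * ∑ a, h a * normFreq v.x C N a = ∑ a ∈ C.2, v.x a N * h a := by
    intro C N h
    have h1 : ∑ a, h a * normFreq v.x C N a =
        ∑ a ∈ C.2, h a * (v.x a N / ∑ b ∈ C.2, v.x b N) := by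
      unfold normFreq
      simp only [mul_ite, mul_zero, Finset.sum_ite_mem, Finset.univ_inter]
    rw [h1, Finset.mul_sum]
    refine Finset.sum_congr rfl fun a ha => ?_
    rcases (hxC C N).eq_or_lt with h2 | h2
    · rw [(Finset.sum_eq_zero_iff_of_nonneg fun b _ => hv.x_nonneg b N).1 h2.symm a ha]
      simp
    · field_simp
  refine ⟨K, ρ, Strategy.isDeterministicUpdate_switching fun N => (hξ N).1,
    hf.switchesTo hξ hsw, fun i => ?_, fun J => ?_⟩
  · refine (hv.expected_reward i).trans_eq ?_
    rw [hint _ (fun q => ∑ a, r a i * q a) fun ω q hq => hq.lrInf_eq _, Finset.sum_comm,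
      Finset.sum_comm (s := Finset.univ.image G.mec)]
    refine Finset.sum_congr rfl fun N _ => ?_
    rw [MDP.sum_eq_sum_mec (G := G) _ fun a ha => by rw [hv.eq_zero_of_notMem_mec N ha, zero_mul]]
    exact Finset.sum_congr rfl fun C _ => (hnorm C N _).symm
  · have hm : MeasurableSet {ω : ℕ → Loc S (Fin K ⊕ 𝒩 × ℕ) A |
        ∀ i ∈ J, sat i ≤ lrInf (fun a => r a i) ω} := by
      have : {ω : ℕ → Loc S (Fin K ⊕ 𝒩 × ℕ) A | ∀ i ∈ J, sat i ≤ lrInf (fun a => r a i) ω} =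
          ⋂ i ∈ J, {ω | sat i ≤ lrInf (fun a => r a i) ω} := by
        ext ω; simp
      rw [this]
      exact Finset.measurableSet_biInter J fun i _ =>
        measurableSet_le measurable_const (measurable_lrInf _)
    rw [← integral_indicator_one hm, hint _
      (fun q => if ∀ i ∈ J, sat i ≤ ∑ a, r a i * q a then 1 else 0) fun ω q hq => by
        simp only [Set.indicator_apply, Set.mem_ofPred_eq, hq.lrInf_eq, Pi.one_apply],
      Finset.sum_comm (s := Finset.univ.image G.mec)]
    -- Commitments `N` without `J ⊆ N` can only add probability. For the others, `commitment`
    -- divided by the mass of `x` in the MEC is the threshold inequality.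
    refine (Finset.sum_le_sum fun N hN => ?_).trans (Finset.sum_le_sum_of_subset_of_nonneg
      (Finset.filter_subset _ _) fun N _ _ => Finset.sum_nonneg fun C _ =>
        mul_nonneg (hxC C N) (by split_ifs <;> norm_num))
    rw [MDP.sum_eq_sum_mec (G := G) _ fun a ha => hv.eq_zero_of_notMem_mec N ha]
    refine Finset.sum_le_sum fun C hC => ?_
    obtain ⟨s, _, rfl⟩ := Finset.mem_image.1 hC
    rcases (hxC (G.mec s) N).eq_or_lt with h0 | h0
    · rw [← h0, zero_mul]
    · rw [if_pos, mul_one]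
      intro i hi
      have h1 := hv.commitment _ (MDP.isMEC_mec s) N i ((Finset.mem_filter.1 hN).2 hi)
      rw [← hnorm _ _ fun a => r a i, ← Finset.sum_mul] at h1
      exact le_of_mul_le_mul_left h1 h0

end LPVars.IsFlow

theorem mainTheorem6 {S A : Type*} [Fintype S] [Fintype A] (G : MDP S A) (n : ℕ)
    (r : A → Fin n → ℝ) (exp sat : Fin n → ℝ) :
    (∀ pr : Fin n → ℝ, G.ConjRealizable r exp sat pr →
      (∃ (v : LPVars S A (allSubsets n)) (ξ : allSubsets n → Strategy G ℕ),
        v.IsConjSolution G r exp sat pr ∧ AreRecurrent v.x ξ) ∧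
      ∀ (v : LPVars S A (allSubsets n)) (ξ : allSubsets n → Strategy G ℕ),
        v.IsConjSolution G r exp sat pr → AreRecurrent v.x ξ →
        ∃ (M₀ : Type) (_ : Finite M₀) (ρ : Strategy G (M₀ ⊕ allSubsets n × ℕ)),
          ρ.IsDeterministicUpdate ∧ ρ.SwitchesTo v.x ξ ∧ ρ.IsConjWitness r exp sat pr) ∧
    (∀ pr : ℝ, G.JointRealizable r exp sat pr →
      (∃ (v : LPVars S A (jointSubsets n)) (ξ : jointSubsets n → Strategy G ℕ),
        v.IsJointSolution G r exp sat pr ∧ AreRecurrent v.x ξ) ∧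
      ∀ (v : LPVars S A (jointSubsets n)) (ξ : jointSubsets n → Strategy G ℕ),
        v.IsJointSolution G r exp sat pr → AreRecurrent v.x ξ →
        ∃ (M₀ : Type) (_ : Finite M₀) (ρ : Strategy G (M₀ ⊕ jointSubsets n × ℕ)),
          ρ.IsDeterministicUpdate ∧ ρ.SwitchesTo v.x ξ ∧ ρ.IsJointWitness r exp sat pr) := by
  refine ⟨fun pr hreal => ⟨?_, fun v ξ hv hξ => ?_⟩, fun pr hreal => ⟨?_, fun v ξ hv hξ => ?_⟩⟩
  · obtain ⟨M, _, σ, hσ⟩ := hreal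
    obtain ⟨v, hv⟩ := hσ.exists_isConjSolution
    obtain ⟨ξ, hξ⟩ := exists_areRecurrent hv.1.x_nonneg fun s N => hv.1.recurrent_flow s N
    exact ⟨v, ξ, hv, hξ⟩
  · obtain ⟨K, ρ, h1, h2, h3, h4⟩ := hv.1.exists_strategy hξ
    refine ⟨Fin K, inferInstance, ρ, h1, h2, h3, fun i => (hv.2 i).trans ?_⟩
    -- Singletons give the conjunctive probabilities; the full set gives the joint one below.
    have := h4 {i}
    simp only [Finset.singleton_subset_iff, Finset.mem_singleton, forall_eq] at this
    convert this
  · obtain ⟨M, _, σ, hσ⟩ := hreal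
    obtain ⟨v, hv⟩ := hσ.exists_isJointSolution
    obtain ⟨ξ, hξ⟩ := exists_areRecurrent hv.1.x_nonneg fun s N => hv.1.recurrent_flow s N
    exact ⟨v, ξ, hv, hξ⟩
  · obtain ⟨K, ρ, h1, h2, h3, h4⟩ := hv.1.exists_strategy hξ
    refine ⟨Fin K, inferInstance, ρ, h1, h2, h3, hv.2.trans ?_⟩
    have := h4 Finset.univ
    simp only [Finset.univ_subset_iff, Finset.mem_univ, true_imp_iff] at this
    convert this
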